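/- **Setting.** Let $k$ be an algebraically closed field and $(\mathcal P,\le)$ a finite nonempty preordered set; write $\overline i<\overline j$ if $i\le j$ and not $j\le i$. For a finite-dimensional $k$-algebra $\Lambda$ and left $\Lambda$-modules $\{\Delta_i\}_{i\in\mathcal P}$, the triple $(\mathcal P,\le,\{\Delta_i\})$ is a *homological system* for $\Lambda$ if the $\Delta_i$ are finite-dimensional, indecomposable, pairwise non-isomorphic, $\mathrm{Hom}_\Lambda(\Delta_i,\Delta_j)\neq0$ implies $i\le j$, and $\mathrm{Ext}^1_\Lambda(\Delta_i,\Delta_j)\ne0$ implies $\overline i<\overline j$. It is *admissible* if moreover $\Lambda$ has a finite filtration by submodules with all factors isomorphic to some $\Delta_i$, and the number of isomorphism classes of indecomposable projective $\Lambda$-modules is $|\mathcal P|$. It is *strict* if it is admissible and $\mathrm{Ext}^n_\Lambda(\Delta_i,\Delta_j)\ne0$ implies $\overline i<\overline j$ for all $n\ge1$. A *weak ditalgebra* is a pair $(T,\delta)$ with $T=\bigoplus_{n\ge0}T_n$ a graded $k$-algebra and $\delta:T\to T$ linear, homogeneous of degree $1$, with $\delta(ab)=\delta(a)b+(-1)^{\deg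 a}a\delta(b)$ for $a$ homogeneous. Put $A=T_0$ and $V=T_1$. It has *layer* $(R,W_0\oplus W_1)$ if $R\subseteq A$ is a subalgebra with $\delta(R)=0$, $W_0\subseteq A$ and $W_1\subseteq V$ are $R$-$R$-subbimodules, and $T$ is the tensor algebra $T_R(W_0\oplus W_1)$ (so $A=T_R(W_0)$). The layer is *triangular* if there are finite filtrations by $R$-$R$-subbimodules $0=W_0^0\subseteq\cdots\subseteq W_0^r=W_0$ and $0=W_1^0\subseteq\cdots\subseteq W_1^s=W_1$ with $\delta(W_0^{i+1})\subseteq A_iW_1A_i$, where $A_i$ is the subalgebra generated by $R$ and $W_0^i$, and $\delta(W_1^{i+1})\subseteq AW_1^iAW_1^iA$. It is *interlaced* with the ideal $I$ of $A$ if $\delta(I)\subseteq IV+VI$, $\delta^2(A)\subseteq IV^2+VIV+V^2I$ and $\delta^2(V)\subseteq IV^3+VIV^2+V^2IV+V^3I$. The ideal $I$ is *triangular* if there are subspaces $0=H_0\subseteq\cdots\subseteq H_t=I$ with $\delta(H_{i+1})\subseteq AH_iV+VH_iA$. Let $\underline{\mathcal A}=(\mathcal A,I)$, with $\mathcal A=(T,\delta)$,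 be a weak ditalgebra with triangular layer $(S,W_0\oplus W_1)$ interlaced with a triangular ideal $I$. It is *$\mathcal P$-strict* if $S=\bigoplus_{i\in\mathcal P}ke_i$ for nonzero orthogonal idempotents $e_i$ with $\sum_ie_i=1$; $W_0,W_1$ are finite-dimensional; $e_jW_1e_i\neq0$ implies $i\le j$; $e_jW_0e_i\ne0$ implies $\overline i<\overline j$; and $I\subseteq\mathrm{rad}(A)^2$. Put $\underline A=A/I$. The objects of $\underline{\mathcal A}\text{-Mod}$ are the left $\underline A$-modules. A morphism $f:M\to N$ is a pair $(f^0,f^1)$ with $f^0\in\mathrm{Hom}_k(M,N)$ and $f^1\in\mathrm{Hom}_{A\text{-}A}(V,\mathrm{Hom}_k(M,N))$ such that $af^0(m)=f^0(am)+f^1(\delta(a))(m)$ for all $a\in A$ and $m\in M$. Composition is $(gf)^0=g^0f^0$ and $(gf)^1(v)=g^0f^1(v)+g^1(v)f^0+(g^1*f^1)(\delta(v))$, where $(g^1*f^1)(vw)=g^1(v)f^1(w)$ for $v,w\in V$. Let $\underline{\mathcal A}\text{-mod}$ be the full subcategory of finite-dimensional objects. A pair $M\xrightarrow{f}E\xrightarrow{g}N$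 is a *conflation* if it is isomorphic to a pair $((\varphi,0),(\psi,0))$ where $0\to M'\xrightarrow{\varphi}E'\xrightarrow{\psi}N'\to0$ is an exact sequence of $\underline A$-modules that splits over $S$; $\underline{\mathcal E}$ is the class of conflations in $\underline{\mathcal A}\text{-mod}$. An object $Q$ of $\underline{\mathcal A}\text{-mod}$ is *$\underline{\mathcal E}$-projective* if for each conflation $M\to E\to N$ in $\underline{\mathcal E}$ every morphism $Q\to N$ factors through $E\to N$. The *right algebra* is $\Gamma=\mathrm{End}_{\underline{\mathcal A}}(\underline A)^{op}$; it is an $\underline A$-algebra through $a\mapsto(x\mapsto xa,\,0)$. Let $S_i=\underline Ae_i/\mathrm{rad}(\underline Ae_i)$, and write $i\prec j$ if there is a sequence $i=i_0,i_1,\dots,i_n=j$ with $n\ge1$ and $e_{i_{l+1}}W_0e_{i_l}\ne0$ for all $0\le l<n$. **Proposition.** Let $\underline{\mathcal A}$ be a $\mathcal P$-strict interlaced weak ditalgebra with right algebra $\Gamma$. 1. There is a family $\{Q_i\}_{i\in\mathcal P}$ of pairwise non-isomorphic indecomposable $\underline{\mathcal E}$-projective objects of $\underline{\mathcal A}\text{-mod}$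 that is a complete family of representatives of the indecomposable $\underline{\mathcal E}$-projective objects and satisfies, in $\underline{\mathcal A}\text{-mod}$, $\underline Ae_i\cong Q_i\oplus\bigoplus_{i\prec j}m_{ij}Q_j$ for suitable integers $m_{ij}\ge0$. For every such family, the modules $P'_i=\Gamma\otimes_{\underline A}Q_i$, $i\in\mathcal P$, form a complete family of pairwise non-isomorphic representatives of the indecomposable projective left $\Gamma$-modules. 2. With $\Delta'_i=\Gamma\otimes_{\underline A}S_i$, the triple $(\mathcal P,\le,\{\Delta'_i\}_{i\in\mathcal P})$ is a strict homological system for the (finite-dimensional) algebra $\Gamma$. -/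

import Mathlib

universe u v

open CategoryTheory CategoryTheory.Limits
open scoped TensorProduct

noncomputable section

/-- A weak differential graded algebra over `k`: a graded `k`-algebra `T = ⨁ₙ Tₙ` with a
homogeneous linear map `δ` of degree one satisfying the graded Leibniz rule. -/
structure WeakDitalgebra (k : Type u) [Field k] (T : Type u) [Ring T] [Algebra k T] where
  deg : ℕ → Submodule k T
  gradedMonoid : SetLike.GradedMonoid deg
  isInternal : DirectSum.IsInternal deg
  δ : T →ₗ[k] T
  δ_mem : ∀ {n : ℕ} {x : T}, x ∈ deg n → δ x ∈ deg (n + 1)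
  leibniz : ∀ {n : ℕ} {a : T}, a ∈ deg n → ∀ b : T,
    δ (a * b) = δ a * b + (-1) ^ n * (a * δ b)

/-- `W` is an `R`-`R`-subbimodule of `T`. -/
def IsSubbimodule {k T : Type u} [Field k] [Ring T] [Algebra k T]
    (R : Subalgebra k T) (W : Submodule k T) : Prop :=
  ∀ r ∈ R, ∀ w ∈ W, r * w ∈ W ∧ w * r ∈ W

/-- `ψ : W → B` is a morphism of `R`-`R`-bimodules, where `R` acts on `B` through `φ`. -/
def IsBimoduleMap {k T B : Type u} [Field k] [Ring T] [Algebra k T] [Ring B] [Algebra k B]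
    {R : Subalgebra k T} {W : Submodule k T} (φ : R →ₐ[k] B) (ψ : W →ₗ[k] B) : Prop :=
  ∀ (r : R) (w w' : W),
    ((w' : T) = r * w → ψ w' = φ r * ψ w) ∧ ((w' : T) = w * r → ψ w' = ψ w * φ r)

namespace WeakDitalgebra

variable {k T : Type u} [Field k] [Ring T] [Algebra k T]

/-- `(R, W₀ ⊕ W₁)` is a layer of the weak ditalgebra: `R` is a subalgebra of `T₀`, the spaces
`W₀ ⊆ T₀` and `W₁ ⊆ T₁` are `R`-`R`-subbimodules, `δ(R) = 0`, and `T` is freely generated by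
`(R, W₀ ⊕ W₁)`, that is, `T` is the tensor algebra `T_R(W₀ ⊕ W₁)`. -/
structure IsLayer (D : WeakDitalgebra k T) (R : Subalgebra k T) (W₀ W₁ : Submodule k T) :
    Prop where
  R_le : Subalgebra.toSubmodule R ≤ D.deg 0
  W₀_le : W₀ ≤ D.deg 0
  W₁_le : W₁ ≤ D.deg 1
  W₀_bimod : IsSubbimodule R W₀
  W₁_bimod : IsSubbimodule R W₁
  δ_R : ∀ r ∈ R, D.δ r = 0
  free : ∀ (B : Type u) [Ring B] [Algebra k B] (φ : R →ₐ[k] B) (ψ₀ : W₀ →ₗ[k] B)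
    (ψ₁ : W₁ →ₗ[k] B), IsBimoduleMap φ ψ₀ → IsBimoduleMap φ ψ₁ →
      ∃! Φ : T →ₐ[k] B,
        (∀ r : R, Φ r = φ r) ∧ (∀ w : W₀, Φ w = ψ₀ w) ∧ ∀ w : W₁, Φ w = ψ₁ w

/-- A layer is triangular if `W₀` and `W₁` have filtrations by subbimodules with
`δ(W₀^{i+1}) ⊆ Aᵢ W₁ Aᵢ`, where `Aᵢ` is the subalgebra generated by `R` and `W₀^i`, and
`δ(W₁^{i+1}) ⊆ A W₁^i A W₁^i A`, where `A = T₀`. -/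
def IsTriangularLayer (D : WeakDitalgebra k T) (R : Subalgebra k T) (W₀ W₁ : Submodule k T) :
    Prop :=
  (∃ (r : ℕ) (F : ℕ → Submodule k T), Monotone F ∧ F 0 = ⊥ ∧ F r = W₀ ∧
      (∀ i, IsSubbimodule R (F i)) ∧
      ∀ i < r, (F (i + 1)).map D.δ ≤
        Subalgebra.toSubmodule (Algebra.adjoin k ((R : Set T) ∪ F i)) * W₁ *
          Subalgebra.toSubmodule (Algebra.adjoin k ((R : Set T) ∪ F i))) ∧
  ∃ (s : ℕ) (F : ℕ → Submodule k T), Monotone F ∧ F 0 = ⊥ ∧ F s = W₁ ∧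
      (∀ i, IsSubbimodule R (F i)) ∧
      ∀ i < s, (F (i + 1)).map D.δ ≤ D.deg 0 * F i * D.deg 0 * F i * D.deg 0

/-- The weak ditalgebra is interlaced with the ideal `I` of `A = T₀`, where `V = T₁`. -/
structure IsInterlaced (D : WeakDitalgebra k T) (I : Submodule k T) : Prop where
  le : I ≤ D.deg 0
  left : D.deg 0 * I ≤ I
  right : I * D.deg 0 ≤ I
  δ_I : I.map D.δ ≤ I * D.deg 1 ⊔ D.deg 1 * I
  δδ_A : (D.deg 0).map (D.δ ∘ₗ D.δ) ≤
    I * D.deg 1 ^ 2 ⊔ D.deg 1 * I * D.deg 1 ⊔ D.deg 1 ^ 2 * I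
  δδ_V : (D.deg 1).map (D.δ ∘ₗ D.δ) ≤
    I * D.deg 1 ^ 3 ⊔ D.deg 1 * I * D.deg 1 ^ 2 ⊔ D.deg 1 ^ 2 * I * D.deg 1 ⊔ D.deg 1 ^ 3 * I

/-- `I` is a triangular ideal: it has a filtration by subspaces with
`δ(Hᵢ₊₁) ⊆ A Hᵢ V + V Hᵢ A`. -/
def IsTriangularIdeal (D : WeakDitalgebra k T) (I : Submodule k T) : Prop :=
  ∃ (t : ℕ) (H : ℕ → Submodule k T), Monotone H ∧ H 0 = ⊥ ∧ H t = I ∧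
    ∀ i < t, (H (i + 1)).map D.δ ≤ D.deg 0 * H i * D.deg 1 ⊔ D.deg 1 * H i * D.deg 0

/-- The algebra `A = T₀`. -/
def A (D : WeakDitalgebra k T) : Subalgebra k T where
  carrier := D.deg 0
  mul_mem' {a b} ha hb := by
    have := D.gradedMonoid
    simpa using SetLike.mul_mem_graded ha hb
  add_mem' := (D.deg 0).add_mem
  algebraMap_mem' r := by
    have := D.gradedMonoid
    exact SetLike.algebraMap_mem_graded D.deg r

theorem mem_A {D : WeakDitalgebra k T} {x : T} : x ∈ D.A ↔ x ∈ D.deg 0 := Iff.rfl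

/-- The `A`-`A`-bimodule structure `a v b` of `V = T₁`. -/
def bimul (D : WeakDitalgebra k T) (a : D.A) (v : D.deg 1) (b : D.A) : D.deg 1 :=
  ⟨a * v * b, by
    have := D.gradedMonoid
    have h : (a : T) * v ∈ D.deg (0 + 1) := SetLike.mul_mem_graded a.2 v.2
    have h' : (a : T) * v * b ∈ D.deg (0 + 1 + 0) := SetLike.mul_mem_graded h b.2
    simpa using h'⟩

/-- The product `V × V → T₂`. -/
def mulVV (D : WeakDitalgebra k T) (v w : D.deg 1) : D.deg 2 :=
  ⟨v * w, by
    have := D.gradedMonoid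
    exact SetLike.mul_mem_graded (i := 1) (j := 1) v.2 w.2⟩

/-- The differential as a map `A → V`. -/
def δA (D : WeakDitalgebra k T) : D.A →ₗ[k] D.deg 1 :=
  (D.δ ∘ₗ D.A.val.toLinearMap).codRestrict _ fun a => D.δ_mem a.2

/-- The differential as a map `V → T₂`. -/
def δV (D : WeakDitalgebra k T) : D.deg 1 →ₗ[k] D.deg 2 :=
  (D.δ ∘ₗ (D.deg 1).subtype).codRestrict _ fun v => D.δ_mem v.2

section layer

variable {D : WeakDitalgebra k T} {R : Subalgebra k T} {W₀ W₁ : Submodule k T}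

theorem IsLayer.adjoin_eq_top (h : D.IsLayer R W₀ W₁) :
    Algebra.adjoin k ((R : Set T) ∪ W₀ ∪ W₁) = ⊤ := by
  set T' := Algebra.adjoin k ((R : Set T) ∪ W₀ ∪ W₁) with hT'
  have hR : R ≤ T' := fun x hx => Algebra.subset_adjoin (Or.inl (Or.inl hx))
  have h0 : W₀ ≤ Subalgebra.toSubmodule T' :=
    fun x hx => Algebra.subset_adjoin (Or.inl (Or.inr hx))
  have h1 : W₁ ≤ Subalgebra.toSubmodule T' := fun x hx => Algebra.subset_adjoin (Or.inr hx)
  obtain ⟨Φ, ⟨a1, a2, a3⟩, -⟩ := h.free T' (Subalgebra.inclusion hR)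
    (Submodule.inclusion h0) (Submodule.inclusion h1)
    (fun r w w' => ⟨fun e => Subtype.ext e, fun e => Subtype.ext e⟩)
    (fun r w w' => ⟨fun e => Subtype.ext e, fun e => Subtype.ext e⟩)
  obtain ⟨Ψ, -, hΨ⟩ := h.free T R.val W₀.subtype W₁.subtype
    (fun r w w' => ⟨fun e => e, fun e => e⟩) (fun r w w' => ⟨fun e => e, fun e => e⟩)
  have e1 := hΨ (T'.val.comp Φ) ⟨fun r => congrArg Subtype.val (a1 r), fun w => congrArg Subtype.val (a2 w),
    fun w => congrArg Subtype.val (a3 w)⟩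
  have e2 := hΨ (AlgHom.id k T) ⟨fun r => rfl, fun r => rfl, fun r => rfl⟩
  rw [eq_top_iff]
  intro x _
  have : (Φ x : T) = x := by
    have := DFunLike.congr_fun (e1.trans e2.symm) x
    simpa using this
  rw [← this]
  exact (Φ x).2

/-- The subspace `A₀ (W₁ A₀)ⁿ`, where `A₀` is generated by `R` and `W₀`. -/
def piece (R : Subalgebra k T) (W₀ W₁ : Submodule k T) (n : ℕ) : Submodule k T :=
  Subalgebra.toSubmodule (Algebra.adjoin k ((R : Set T) ∪ W₀)) *
    (W₁ * Subalgebra.toSubmodule (Algebra.adjoin k ((R : Set T) ∪ W₀))) ^ n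

theorem piece_mul (m n : ℕ) :
    piece R W₀ W₁ m * piece R W₀ W₁ n ≤ piece R W₀ W₁ (m + n) := by
  unfold piece
  set A₀ := Subalgebra.toSubmodule (Algebra.adjoin k ((R : Set T) ∪ W₀)) with hA
  have hAA : A₀ * A₀ = A₀ := (Subalgebra.isIdempotentElem_toSubmodule _).eq
  cases m with
  | zero => simp [← mul_assoc, hAA]
  | succ m =>
    have e : (W₁ * A₀) ^ (m + 1) * A₀ = (W₁ * A₀) ^ (m + 1) := by
      rw [pow_succ, mul_assoc, mul_assoc, hAA]
    rw [mul_assoc, ← mul_assoc _ A₀, e, pow_add _ (m + 1) n]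

theorem IsLayer.adjoin_le (h : D.IsLayer R W₀ W₁) :
    Subalgebra.toSubmodule (Algebra.adjoin k ((R : Set T) ∪ W₀)) ≤ D.deg 0 := by
  have : Algebra.adjoin k ((R : Set T) ∪ W₀) ≤ D.A :=
    Algebra.adjoin_le (Set.union_subset (fun x hx => h.R_le hx) (fun x hx => h.W₀_le hx))
  exact this

theorem IsLayer.piece_le (h : D.IsLayer R W₀ W₁) (n : ℕ) : piece R W₀ W₁ n ≤ D.deg n := by
  have := D.gradedMonoid
  have mul_le : ∀ i j, D.deg i * D.deg j ≤ D.deg (i + j) := fun i j =>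
    Submodule.mul_le.2 fun a ha b hb => SetLike.mul_mem_graded ha hb
  have hX : W₁ * Subalgebra.toSubmodule (Algebra.adjoin k ((R : Set T) ∪ W₀)) ≤ D.deg 1 :=
    (mul_le_mul' h.W₁_le h.adjoin_le).trans (mul_le 1 0)
  have key : ∀ n : ℕ, (W₁ * Subalgebra.toSubmodule (Algebra.adjoin k ((R : Set T) ∪ W₀))) ^ n
      ≤ D.deg n := by
    intro n
    induction n with
    | zero =>
      rw [pow_zero, Submodule.one_le]
      exact SetLike.one_mem_graded D.deg
    | succ n ih => rw [pow_succ]; exact (mul_le_mul' ih hX).trans (mul_le n 1)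
  exact (mul_le_mul' h.adjoin_le (key n)).trans (by simpa using mul_le 0 n)

theorem IsLayer.iSup_piece (h : D.IsLayer R W₀ W₁) : ⨆ n, piece R W₀ W₁ n = ⊤ := by
  rw [eq_top_iff]
  intro x _
  have hx : x ∈ Algebra.adjoin k ((R : Set T) ∪ W₀ ∪ W₁) := by rw [h.adjoin_eq_top]; trivial
  have h0 : ∀ y ∈ Algebra.adjoin k ((R : Set T) ∪ W₀), y ∈ ⨆ n, piece R W₀ W₁ n :=
    fun y hy => Submodule.mem_iSup_of_mem 0 (by simpa [piece] using hy)
  induction hx using Algebra.adjoin_induction with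
  | mem x hx =>
    rcases hx with hx | hx
    · exact h0 x (Algebra.subset_adjoin hx)
    · refine Submodule.mem_iSup_of_mem 1 ?_
      have : (1 : T) * (x * 1) ∈ piece R W₀ W₁ 1 := by
        rw [piece, pow_one]
        exact Submodule.mul_mem_mul (one_mem (Algebra.adjoin k _))
          (Submodule.mul_mem_mul hx (one_mem (Algebra.adjoin k _)))
      simpa using this
  | algebraMap r => exact h0 _ (Subalgebra.algebraMap_mem _ r)
  | add x y _ _ hx hy => exact add_mem (hx trivial) (hy trivial)
  | mul x y _ _ hx hy =>
    have := Submodule.mul_mem_mul (hx trivial) (hy trivial)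
    rw [Submodule.iSup_mul] at this
    refine (iSup_le fun m => ?_ : _ ≤ ⨆ n, piece R W₀ W₁ n) this
    rw [Submodule.mul_iSup]
    exact iSup_le fun n => (piece_mul m n).trans (le_iSup (piece R W₀ W₁) (m + n))

theorem IsLayer.piece_eq (h : D.IsLayer R W₀ W₁) (n : ℕ) : piece R W₀ W₁ n = D.deg n := by
  classical
  refine le_antisymm (h.piece_le n) fun x hx => ?_
  let _ := D.isInternal.chooseDecomposition
  have key : ∀ y : T, ∀ n, (DirectSum.decompose D.deg y n : T) ∈ piece R W₀ W₁ n := by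
    intro y
    have hy : y ∈ ⨆ n, piece R W₀ W₁ n := by rw [h.iSup_piece]; trivial
    induction hy using Submodule.iSup_induction' with
    | mem m y hy =>
      intro n
      by_cases e : m = n
      · subst e
        rwa [DirectSum.decompose_of_mem_same _ (h.piece_le m hy)]
      · rw [DirectSum.decompose_of_mem_ne _ (h.piece_le m hy) e]
        exact zero_mem _
    | zero => intro n; simp
    | add y z _ _ hy hz => intro n; simpa using add_mem (hy n) (hz n)
  have := key x n
  rwa [DirectSum.decompose_of_mem_same _ hx] at this

theorem IsLayer.deg_zero (h : D.IsLayer R W₀ W₁) :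
    D.deg 0 = Subalgebra.toSubmodule (Algebra.adjoin k ((R : Set T) ∪ W₀)) := by
  rw [← h.piece_eq 0]; simp [piece]

theorem IsLayer.deg_one (h : D.IsLayer R W₀ W₁) : D.deg 1 = D.deg 0 * (W₁ * D.deg 0) := by
  rw [← h.piece_eq 1, h.deg_zero, piece, pow_one]

theorem IsLayer.deg_succ (h : D.IsLayer R W₀ W₁) (n : ℕ) :
    D.deg (n + 1) = D.deg n * D.deg 1 := by
  have := D.gradedMonoid
  refine le_antisymm ?_ (Submodule.mul_le.2 fun a ha b hb => SetLike.mul_mem_graded ha hb)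
  rw [← h.piece_eq (n + 1), piece, pow_succ, ← mul_assoc]
  refine mul_le_mul' (h.piece_eq n).le ?_
  rw [h.deg_one, h.deg_zero]
  intro x hx
  have h1 : (1 : T) ∈ Subalgebra.toSubmodule (Algebra.adjoin k ((R : Set T) ∪ W₀)) :=
    one_mem (Algebra.adjoin k ((R : Set T) ∪ W₀))
  simpa using Submodule.mul_mem_mul h1 hx

/-- `T` is also the tensor algebra of the `A`-`A`-bimodule `V`. -/
theorem IsLayer.exists_lift (h : D.IsLayer R W₀ W₁) (B : Type u) [Ring B] [Algebra k B]
    (ρ : D.A →ₐ[k] B) (θ : D.deg 1 →ₗ[k] B)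
    (hθ : ∀ a v b, θ (D.bimul a v b) = ρ a * θ v * ρ b) :
    ∃ Φ : T →ₐ[k] B, (∀ a : D.A, Φ a = ρ a) ∧ ∀ v : D.deg 1, Φ v = θ v := by
  have hR : R ≤ D.A := fun x hx => h.R_le hx
  let ψ : W₀ →ₗ[k] B :=
    { toFun w := ρ ⟨w, h.W₀_le w.2⟩
      map_add' _ _ := ρ.map_add ⟨_, _⟩ ⟨_, _⟩
      map_smul' c w := map_smul ρ c (⟨w, h.W₀_le w.2⟩ : D.A) }
  obtain ⟨Φ, ⟨a1, a2, a3⟩, -⟩ := h.free B (ρ.comp (Subalgebra.inclusion hR))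
    ψ (θ ∘ₗ Submodule.inclusion h.W₁_le)
    (fun r w w' => ⟨fun e => by
        change ρ _ = ρ _ * ρ _
        rw [← map_mul]; congr 1; exact Subtype.ext e,
      fun e => by
        change ρ _ = ρ _ * ρ _
        rw [← map_mul]; congr 1; exact Subtype.ext e⟩)
    (fun r w w' => ⟨fun e => by
        have := hθ (Subalgebra.inclusion hR r) (Submodule.inclusion h.W₁_le w) 1
        simp only [LinearMap.comp_apply, AlgHom.comp_apply]
        rw [map_one, mul_one] at this
        rw [← this]
        congr 1
        exact Subtype.ext (by simp [bimul, e, Submodule.coe_inclusion]),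
      fun e => by
        have := hθ 1 (Submodule.inclusion h.W₁_le w) (Subalgebra.inclusion hR r)
        simp only [LinearMap.comp_apply, AlgHom.comp_apply]
        rw [map_one, one_mul] at this
        rw [← this]
        congr 1
        exact Subtype.ext (by simp [bimul, e, Submodule.coe_inclusion])⟩)
  have hA : ∀ a : D.A, Φ a = ρ a := by
    rintro ⟨a, ha⟩
    have ha' : a ∈ Algebra.adjoin k ((R : Set T) ∪ W₀) := by
      have := h.deg_zero ▸ mem_A.1 ha
      exact this
    have hle : Algebra.adjoin k ((R : Set T) ∪ W₀) ≤ D.A := h.adjoin_le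
    change Φ a = ρ ⟨a, ha⟩
    have : ∀ a (ha : a ∈ Algebra.adjoin k ((R : Set T) ∪ W₀)), Φ a = ρ ⟨a, hle ha⟩ := by
      intro a ha
      induction ha using Algebra.adjoin_induction with
      | mem x hx =>
        rcases hx with hx | hx
        · exact a1 ⟨x, hx⟩
        · exact a2 ⟨x, hx⟩
      | algebraMap r => exact (Φ.commutes r).trans (ρ.commutes r).symm
      | add x y hx' hy' hx hy =>
        rw [map_add, hx, hy, ← map_add]; rfl
      | mul x y hx' hy' hx hy =>
        rw [map_mul, hx, hy, ← map_mul]; rfl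
    exact this a ha'
  refine ⟨Φ, hA, ?_⟩
  have key : ∀ x (hx : x ∈ D.deg 0 * (W₁ * D.deg 0)),
      ∃ hx' : x ∈ D.deg 1, Φ x = θ ⟨x, hx'⟩ := by
    intro x hx
    induction hx using Submodule.mul_induction_on' with
    | mem_mul_mem a ha y hy =>
      induction hy using Submodule.mul_induction_on' with
      | mem_mul_mem w hw b hb =>
        have e : a * (w * b) = (D.bimul ⟨a, ha⟩ ⟨w, h.W₁_le hw⟩ ⟨b, hb⟩ : D.deg 1) := by
          simp [bimul, mul_assoc]
        refine ⟨e ▸ (D.bimul ⟨a, ha⟩ ⟨w, h.W₁_le hw⟩ ⟨b, hb⟩).2, ?_⟩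
        have : (⟨a * (w * b), e ▸ (D.bimul ⟨a, ha⟩ ⟨w, h.W₁_le hw⟩ ⟨b, hb⟩).2⟩ : D.deg 1)
            = D.bimul ⟨a, ha⟩ ⟨w, h.W₁_le hw⟩ ⟨b, hb⟩ := Subtype.ext e
        rw [this, hθ, map_mul, map_mul, ← mul_assoc]
        congr 1
        · congr 1
          · exact hA ⟨a, ha⟩
          · exact a3 ⟨w, hw⟩
        · exact hA ⟨b, hb⟩
      | add x _ y _ hx hy =>
        obtain ⟨h1, e1⟩ := hx
        obtain ⟨h2, e2⟩ := hy
        refine ⟨by rw [mul_add]; exact add_mem h1 h2, ?_⟩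
        have e : (⟨a * (x + y), by rw [mul_add]; exact add_mem h1 h2⟩ : D.deg 1) =
          ⟨a * x, h1⟩ + ⟨a * y, h2⟩ := Subtype.ext (mul_add _ _ _)
        rw [e, map_add, ← e1, ← e2, mul_add, map_add]
    | add x _ y _ hx hy =>
      obtain ⟨h1, e1⟩ := hx
      obtain ⟨h2, e2⟩ := hy
      refine ⟨add_mem h1 h2, ?_⟩
      rw [map_add, e1, e2, ← map_add]
      rfl
  intro v
  exact (key v (h.deg_one ▸ v.2)).2

/-- `f` is a morphism of `A`-`A`-bimodules `V → Hom_k(M, N)`. -/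
def IsBimod {D : WeakDitalgebra k T} {M N : Type u} [AddCommGroup M] [Module k M]
    [AddCommGroup N] [Module k N] (ρM : D.A →ₐ[k] Module.End k M) (ρN : D.A →ₐ[k] Module.End k N)
    (f : D.deg 1 →ₗ[k] M →ₗ[k] N) : Prop :=
  ∀ a v b, f (D.bimul a v b) = ρN a ∘ₗ f v ∘ₗ ρM b

variable {M N L K : Type u} [AddCommGroup M] [Module k M] [AddCommGroup N] [Module k N]
  [AddCommGroup L] [Module k L] [AddCommGroup K] [Module k K]
  {ρM : D.A →ₐ[k] Module.End k M} {ρN : D.A →ₐ[k] Module.End k N}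
  {ρL : D.A →ₐ[k] Module.End k L} {ρK : D.A →ₐ[k] Module.End k K}
  {f : D.deg 1 →ₗ[k] M →ₗ[k] N} {g : D.deg 1 →ₗ[k] N →ₗ[k] L} {p : D.deg 1 →ₗ[k] L →ₗ[k] K}

theorem IsLayer.exists_triple (h : D.IsLayer R W₀ W₁) (hf : IsBimod ρM ρN f)
    (hg : IsBimod ρN ρL g) (hp : IsBimod ρL ρK p) :
    ∃ φ : T →ₗ[k] M →ₗ[k] K, ∀ u v w : D.deg 1, φ (u * v * w) = p u ∘ₗ g v ∘ₗ f w := by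
  let ρ : D.A →ₐ[k] Module.End k (M × N × L × K) := AlgHom.ofLinearMap
    { toFun a := (ρM a).prodMap ((ρN a).prodMap ((ρL a).prodMap (ρK a)))
      map_add' a b := LinearMap.ext fun ⟨m, n, l, q⟩ => by simp
      map_smul' a b := LinearMap.ext fun ⟨m, n, l, q⟩ => by simp } (LinearMap.ext fun ⟨m, n, l, q⟩ => by simp)
      (fun a b => LinearMap.ext fun ⟨m, n, l, q⟩ => by simp)
  let θ : D.deg 1 →ₗ[k] Module.End k (M × N × L × K) :=
    { toFun v := LinearMap.prod 0 (LinearMap.prod (f v ∘ₗ LinearMap.fst k _ _)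
        (LinearMap.prod (g v ∘ₗ LinearMap.fst k _ _ ∘ₗ LinearMap.snd k _ _)
          (p v ∘ₗ LinearMap.fst k _ _ ∘ₗ LinearMap.snd k _ _ ∘ₗ LinearMap.snd k _ _)))
      map_add' a b := LinearMap.ext fun ⟨m, n, l, q⟩ => by simp
      map_smul' a b := LinearMap.ext fun ⟨m, n, l, q⟩ => by simp }
  obtain ⟨Φ, -, hΦ⟩ := h.exists_lift _ ρ θ (fun a v b => by
    exact LinearMap.ext fun ⟨m, n, l, q⟩ => by simp [θ, ρ, hf a v b, hg a v b, hp a v b])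
  refine ⟨(LinearMap.compRight k (LinearMap.snd k _ _ ∘ₗ LinearMap.snd k _ _ ∘ₗ
    LinearMap.snd k M (N × L × K))) ∘ₗ (LinearMap.lcomp k _ (LinearMap.inl k M (N × L × K))) ∘ₗ
      Φ.toLinearMap, fun u v w => ?_⟩
  ext m
  simp [hΦ, θ]

theorem IsLayer.exists_star (h : D.IsLayer R W₀ W₁) (hf : IsBimod ρM ρN f)
    (hg : IsBimod ρN ρL g) :
    ∃ φ : T →ₗ[k] M →ₗ[k] L, ∀ v w : D.deg 1, φ (v * w) = g v ∘ₗ f w := by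
  let ρ : D.A →ₐ[k] Module.End k (M × N × L) := AlgHom.ofLinearMap
    { toFun a := (ρM a).prodMap ((ρN a).prodMap (ρL a))
      map_add' a b := by ext <;> simp
      map_smul' a b := by ext <;> simp } (by ext <;> simp) (fun a b => by ext <;> simp)
  let θ : D.deg 1 →ₗ[k] Module.End k (M × N × L) :=
    { toFun v := LinearMap.prod 0 (LinearMap.prod (f v ∘ₗ LinearMap.fst k _ _)
        (g v ∘ₗ LinearMap.fst k _ _ ∘ₗ LinearMap.snd k _ _))
      map_add' a b := by ext <;> simp
      map_smul' a b := by ext <;> simp }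
  obtain ⟨Φ, -, hΦ⟩ := h.exists_lift _ ρ θ (fun a v b => by
    ext <;> simp [θ, ρ, hf a v b, hg a v b])
  refine ⟨(LinearMap.compRight k (LinearMap.snd k _ _ ∘ₗ
    LinearMap.snd k M (N × L))) ∘ₗ (LinearMap.lcomp k _ (LinearMap.inl k M (N × L))) ∘ₗ
      Φ.toLinearMap, fun v w => ?_⟩
  ext m
  simp [hΦ, θ]

/-- The map `g * f : T₂ = V ⊗_A V → Hom_k(M, L)`, `(g * f)(v w) = g(v) ∘ f(w)`, for morphisms of
bimodules `f : V → Hom_k(M, N)` and `g : V → Hom_k(N, L)`. -/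
def IsLayer.star (h : D.IsLayer R W₀ W₁) (hf : IsBimod ρM ρN f) (hg : IsBimod ρN ρL g) :
    D.deg 2 →ₗ[k] M →ₗ[k] L :=
  (h.exists_star hf hg).choose ∘ₗ (D.deg 2).subtype

theorem IsLayer.star_mul (h : D.IsLayer R W₀ W₁) (hf : IsBimod ρM ρN f) (hg : IsBimod ρN ρL g)
    (v w : D.deg 1) : h.star hf hg (D.mulVV v w) = g v ∘ₗ f w :=
  (h.exists_star hf hg).choose_spec v w

theorem IsLayer.ext_two (h : D.IsLayer R W₀ W₁) {X : Type u} [AddCommGroup X] [Module k X]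
    {φ ψ : D.deg 2 →ₗ[k] X} (e : ∀ v w, φ (D.mulVV v w) = ψ (D.mulVV v w)) : φ = ψ := by
  have key : ∀ x (hx : x ∈ D.deg 1 * D.deg 1), ∃ hx' : x ∈ D.deg 2, φ ⟨x, hx'⟩ = ψ ⟨x, hx'⟩ := by
    intro x hx
    induction hx using Submodule.mul_induction_on' with
    | mem_mul_mem v hv w hw => exact ⟨(D.mulVV ⟨v, hv⟩ ⟨w, hw⟩).2, e ⟨v, hv⟩ ⟨w, hw⟩⟩
    | add x _ y _ hx hy =>
      obtain ⟨h1, e1⟩ := hx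
      obtain ⟨h2, e2⟩ := hy
      refine ⟨add_mem h1 h2, ?_⟩
      have : (⟨x + y, add_mem h1 h2⟩ : D.deg 2) = ⟨x, h1⟩ + ⟨y, h2⟩ := rfl
      rw [this, map_add, map_add, e1, e2]
  ext x
  exact (key x (h.deg_succ 1 ▸ x.2)).2

theorem δ_one (D : WeakDitalgebra k T) : D.δ 1 = 0 := by
  have := D.gradedMonoid
  have h := D.leibniz (SetLike.one_mem_graded D.deg) 1
  simpa using h

theorem δA_mul (a b : D.A) : D.δA (a * b) = D.bimul 1 (D.δA a) b + D.bimul a (D.δA b) 1 := by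
  apply Subtype.ext
  have := D.leibniz a.2 b
  simpa [bimul, δA] using this

theorem δV_bimul (a : D.A) (v : D.deg 1) (b : D.A) :
    (D.δV (D.bimul a v b) : T) =
      (D.δA a : T) * (v * b) + a * (D.δV v : T) * b - a * v * (D.δA b : T) := by
  have e1 := D.leibniz a.2 (v * b : T)
  have e2 := D.leibniz v.2 (b : T)
  simp only [bimul, δA, δV]
  change D.δ (a * v * b) = D.δ a * (v * b) + a * D.δ v * b - a * v * D.δ b
  rw [mul_assoc, e1, e2]
  simp [mul_add, mul_assoc]
  abel

/-- `D.bimul₂ a x b = a x b` in `T₂`. -/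
def bimul₂ (D : WeakDitalgebra k T) (a : D.A) (v : D.deg 2) (b : D.A) : D.deg 2 :=
  ⟨a * v * b, by
    have := D.gradedMonoid
    have h : (a : T) * v ∈ D.deg (0 + 2) := SetLike.mul_mem_graded a.2 v.2
    have h' : (a : T) * v * b ∈ D.deg (0 + 2 + 0) := SetLike.mul_mem_graded h b.2
    simpa using h'⟩

theorem IsLayer.star_bimul (h : D.IsLayer R W₀ W₁) (hf : IsBimod ρM ρN f)
    (hg : IsBimod ρN ρL g) (a : D.A) (x : D.deg 2) (b : D.A) :
    h.star hf hg (D.bimul₂ a x b) = ρL a ∘ₗ h.star hf hg x ∘ₗ ρM b := by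
  let φ : D.deg 2 →ₗ[k] M →ₗ[k] L :=
    { toFun x := h.star hf hg (D.bimul₂ a x b)
      map_add' x y := by
        rw [← map_add]; congr 1; exact Subtype.ext (by simp [bimul₂, mul_add, add_mul])
      map_smul' c x := by
        rw [RingHom.id_apply, ← map_smul]; congr 1; exact Subtype.ext (by simp [bimul₂]) }
  let ψ : D.deg 2 →ₗ[k] M →ₗ[k] L :=
    { toFun x := ρL a ∘ₗ h.star hf hg x ∘ₗ ρM b
      map_add' x y := by ext; simp
      map_smul' x y := by ext; simp }
  have : φ = ψ := h.ext_two fun v w => by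
    change h.star hf hg (D.bimul₂ a (D.mulVV v w) b) = ρL a ∘ₗ h.star hf hg _ ∘ₗ ρM b
    have e : D.bimul₂ a (D.mulVV v w) b = D.mulVV (D.bimul a v 1) (D.bimul 1 w b) :=
      Subtype.ext (by simp [bimul₂, mulVV, bimul, mul_assoc])
    rw [e, h.star_mul, h.star_mul, hf, hg]
    ext; simp
  exact LinearMap.congr_fun this x

theorem IsLayer.star_δδ (h : D.IsLayer R W₀ W₁) (hf : IsBimod ρM ρN f) (hg : IsBimod ρN ρL g)
    {I : Submodule k T} (hI : D.IsInterlaced I) (hM : ∀ a : D.A, (a : T) ∈ I → ρM a = 0)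
    (hN : ∀ a : D.A, (a : T) ∈ I → ρN a = 0) (hL : ∀ a : D.A, (a : T) ∈ I → ρL a = 0)
    (a : D.A) : h.star hf hg (D.δV (D.δA a)) = 0 := by
  set φ := (h.exists_star hf hg).choose with hφ
  have hs : ∀ v w : D.deg 1, φ (v * w) = g v ∘ₗ f w := (h.exists_star hf hg).choose_spec
  change φ (D.δ (D.δ a)) = 0
  rw [← LinearMap.mem_ker]
  have hm : D.δ (D.δ a) ∈ (D.deg 0).map (D.δ ∘ₗ D.δ) := ⟨a, a.2, rfl⟩
  refine (?_ : _ ≤ LinearMap.ker φ) (hI.δδ_A hm)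
  refine sup_le (sup_le ?_ ?_) ?_
  · rw [pow_two, ← mul_assoc]
    refine Submodule.mul_le.2 fun x hx w hw => ?_
    induction hx using Submodule.mul_induction_on' with
    | mem_mul_mem i hi v hv =>
      have := hs (D.bimul ⟨i, hI.le hi⟩ ⟨v, hv⟩ 1) ⟨w, hw⟩
      rw [hg, hL _ hi] at this
      simpa [bimul] using this
    | add x _ y _ hx hy => rw [add_mul]; exact add_mem hx hy
  · refine Submodule.mul_le.2 fun x hx w hw => ?_
    induction hx using Submodule.mul_induction_on' with
    | mem_mul_mem v hv i hi =>
      have := hs (D.bimul 1 ⟨v, hv⟩ ⟨i, hI.le hi⟩) ⟨w, hw⟩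
      rw [hg, hN _ hi] at this
      simpa [bimul] using this
    | add x _ y _ hx hy => rw [add_mul]; exact add_mem hx hy
  · rw [pow_two, mul_assoc]
    refine Submodule.mul_le.2 fun v hv x hx => ?_
    induction hx using Submodule.mul_induction_on' with
    | mem_mul_mem w hw i hi =>
      have := hs ⟨v, hv⟩ (D.bimul 1 ⟨w, hw⟩ ⟨i, hI.le hi⟩)
      rw [hf, hM _ hi] at this
      simpa [bimul] using this
    | add x _ y _ hx hy => rw [mul_add]; exact add_mem hx hy

theorem triple_δδ (hf : IsBimod ρM ρN f)
    (hg : IsBimod ρN ρL g) (hp : IsBimod ρL ρK p)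
    {I : Submodule k T} (hI : D.IsInterlaced I) (hM : ∀ a : D.A, (a : T) ∈ I → ρM a = 0)
    (hN : ∀ a : D.A, (a : T) ∈ I → ρN a = 0) (hL : ∀ a : D.A, (a : T) ∈ I → ρL a = 0)
    (hK : ∀ a : D.A, (a : T) ∈ I → ρK a = 0)
    {φ : T →ₗ[k] M →ₗ[k] K} (hφ : ∀ u v w : D.deg 1, φ (u * v * w) = p u ∘ₗ g v ∘ₗ f w)
    (v : D.deg 1) : φ (D.δ (D.δ v)) = 0 := by
  rw [← LinearMap.mem_ker]
  have hm : D.δ (D.δ v) ∈ (D.deg 1).map (D.δ ∘ₗ D.δ) := ⟨v, v.2, rfl⟩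
  refine (?_ : _ ≤ LinearMap.ker φ) (hI.δδ_V hm)
  have gen : ∀ P Q S : Submodule k T, (∀ x ∈ P, ∀ y ∈ Q, ∀ z ∈ S, φ (x * y * z) = 0) →
      P * Q * S ≤ LinearMap.ker φ := by
    intro P Q S H
    refine Submodule.mul_le.2 fun x hx w hw => ?_
    induction hx using Submodule.mul_induction_on' with
    | mem_mul_mem a ha b hb => exact H a ha b hb w hw
    | add x _ y _ hx hy => rw [add_mul]; exact add_mem hx hy
  have V1 : ∀ x ∈ I * D.deg 1, ∃ hx : x ∈ D.deg 1, p ⟨x, hx⟩ = 0 := by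
    intro x hx
    induction hx using Submodule.mul_induction_on' with
    | mem_mul_mem i hi v hv =>
      have e : i * v = (D.bimul ⟨i, hI.le hi⟩ ⟨v, hv⟩ 1 : D.deg 1) := by simp [bimul]
      refine ⟨e ▸ (D.bimul ⟨i, hI.le hi⟩ ⟨v, hv⟩ 1).2, ?_⟩
      have : (⟨i * v, e ▸ (D.bimul ⟨i, hI.le hi⟩ ⟨v, hv⟩ 1).2⟩ : D.deg 1) =
        D.bimul ⟨i, hI.le hi⟩ ⟨v, hv⟩ 1 := Subtype.ext e
      rw [this, hp, hK _ hi, LinearMap.zero_comp]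
    | add x _ y _ hx hy =>
      obtain ⟨h1, e1⟩ := hx
      obtain ⟨h2, e2⟩ := hy
      refine ⟨add_mem h1 h2, ?_⟩
      have : (⟨x + y, add_mem h1 h2⟩ : D.deg 1) = ⟨x, h1⟩ + ⟨y, h2⟩ := rfl
      rw [this, map_add, e1, e2, add_zero]
  have V2 : ∀ {M N : Type u} [AddCommGroup M] [Module k M] [AddCommGroup N] [Module k N]
      {ρM : D.A →ₐ[k] Module.End k M} {ρN : D.A →ₐ[k] Module.End k N}
      {f : D.deg 1 →ₗ[k] M →ₗ[k] N} (_ : IsBimod ρM ρN f)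
      (_ : ∀ a : D.A, (a : T) ∈ I → ρM a = 0),
      ∀ x ∈ D.deg 1 * I, ∃ hx : x ∈ D.deg 1, f ⟨x, hx⟩ = 0 := by
    intro M N _ _ _ _ ρM ρN f hf hM x hx
    induction hx using Submodule.mul_induction_on' with
    | mem_mul_mem v hv i hi =>
      have e : v * i = (D.bimul 1 ⟨v, hv⟩ ⟨i, hI.le hi⟩ : D.deg 1) := by simp [bimul]
      refine ⟨e ▸ (D.bimul 1 ⟨v, hv⟩ ⟨i, hI.le hi⟩).2, ?_⟩
      have : (⟨v * i, e ▸ (D.bimul 1 ⟨v, hv⟩ ⟨i, hI.le hi⟩).2⟩ : D.deg 1) =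
        D.bimul 1 ⟨v, hv⟩ ⟨i, hI.le hi⟩ := Subtype.ext e
      rw [this, hf, hM _ hi]
      simp
    | add x _ y _ hx hy =>
      obtain ⟨h1, e1⟩ := hx
      obtain ⟨h2, e2⟩ := hy
      refine ⟨add_mem h1 h2, ?_⟩
      have : (⟨x + y, add_mem h1 h2⟩ : D.deg 1) = ⟨x, h1⟩ + ⟨y, h2⟩ := rfl
      rw [this, map_add, e1, e2, add_zero]
  refine sup_le (sup_le (sup_le ?_ ?_) ?_) ?_
  · have : I * D.deg 1 ^ 3 = I * D.deg 1 * D.deg 1 * D.deg 1 := by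
      simp only [pow_succ, pow_zero, one_mul, mul_assoc]
    rw [this]
    refine gen _ _ _ fun x hx y hy z hz => ?_
    obtain ⟨hx', e⟩ := V1 x hx
    rw [hφ ⟨x, hx'⟩ ⟨y, hy⟩ ⟨z, hz⟩, e, LinearMap.zero_comp]
  · have : D.deg 1 * I * D.deg 1 ^ 2 = D.deg 1 * I * D.deg 1 * D.deg 1 := by
      simp only [pow_succ, pow_zero, one_mul, mul_assoc]
    rw [this]
    refine gen _ _ _ fun x hx y hy z hz => ?_
    obtain ⟨hx', e⟩ := V2 hp hL x hx
    rw [hφ ⟨x, hx'⟩ ⟨y, hy⟩ ⟨z, hz⟩, e, LinearMap.zero_comp]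
  · have : D.deg 1 ^ 2 * I * D.deg 1 = D.deg 1 * (D.deg 1 * I) * D.deg 1 := by
      simp only [pow_succ, pow_zero, one_mul, mul_assoc]
    rw [this]
    refine gen _ _ _ fun x hx y hy z hz => ?_
    obtain ⟨hy', e⟩ := V2 hg hN y hy
    rw [hφ ⟨x, hx⟩ ⟨y, hy'⟩ ⟨z, hz⟩, e, LinearMap.zero_comp, LinearMap.comp_zero]
  · have : D.deg 1 ^ 3 * I = D.deg 1 * D.deg 1 * (D.deg 1 * I) := by
      simp only [pow_succ, pow_zero, one_mul, mul_assoc]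
    rw [this]
    refine gen _ _ _ fun x hx y hy z hz => ?_
    obtain ⟨hz', e⟩ := V2 hf hM z hz
    rw [hφ ⟨x, hx⟩ ⟨y, hy⟩ ⟨z, hz'⟩, e, LinearMap.comp_zero, LinearMap.comp_zero]

end layer

end WeakDitalgebra
/-- A triangular interlaced weak ditalgebra `(𝒜, I)` with triangular layer `(R, W₀ ⊕ W₁)`. -/
structure TriangularInterlacedDitalgebra (k : Type u) [Field k] (T : Type u) [Ring T]
    [Algebra k T] extends WeakDitalgebra k T where
  R : Subalgebra k T
  W₀ : Submodule k T
  W₁ : Submodule k T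
  I : Submodule k T
  isLayer : toWeakDitalgebra.IsLayer R W₀ W₁
  triangularLayer : toWeakDitalgebra.IsTriangularLayer R W₀ W₁
  interlaced : toWeakDitalgebra.IsInterlaced I
  triangularIdeal : toWeakDitalgebra.IsTriangularIdeal I

namespace TriangularInterlacedDitalgebra

variable {k T : Type u} [Field k] [Ring T] [Algebra k T]

/-- `I` as an ideal of the ring `A`. -/
def ideal (𝒜 : TriangularInterlacedDitalgebra k T) : Ideal 𝒜.A where
  carrier := {a | (a : T) ∈ 𝒜.I}
  add_mem' ha hb := 𝒜.I.add_mem ha hb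
  zero_mem' := 𝒜.I.zero_mem
  smul_mem' c _ hx := 𝒜.interlaced.left (Submodule.mul_mem_mul c.2 hx)

instance (𝒜 : TriangularInterlacedDitalgebra k T) : 𝒜.ideal.IsTwoSided :=
  ⟨fun b ha => 𝒜.interlaced.right (Submodule.mul_mem_mul ha b.2)⟩

/-- The quotient algebra `A / I`. -/
abbrev Abar (𝒜 : TriangularInterlacedDitalgebra k T) : Type u := 𝒜.A ⧸ 𝒜.ideal

/-- An object of the category `(𝒜, I)-Mod`: a left `A`-module annihilated by `I`, that is, a
left `A/I`-module. -/
structure Mod (𝒜 : TriangularInterlacedDitalgebra k T) where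
  carrier : Type u
  [addCommGroup : AddCommGroup carrier]
  [moduleField : Module k carrier]
  [module : Module 𝒜.Abar carrier]
  [isScalarTower : IsScalarTower k 𝒜.Abar carrier]

variable {𝒜 : TriangularInterlacedDitalgebra k T}

namespace Mod

attribute [instance] addCommGroup moduleField module isScalarTower

instance : CoeSort (Mod 𝒜) (Type u) := ⟨carrier⟩

/-- The action of `A` on an object. -/
def ρ (M : Mod 𝒜) : 𝒜.A →ₐ[k] Module.End k M :=
  (Algebra.lsmul k k M.carrier).comp (Ideal.Quotient.mkₐ k 𝒜.ideal)

theorem ρ_apply (M : Mod 𝒜) (a : 𝒜.A) (m : M) :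
    M.ρ a m = (Ideal.Quotient.mk 𝒜.ideal a) • m := rfl

theorem ρ_I (M : Mod 𝒜) (a : 𝒜.A) (ha : (a : T) ∈ 𝒜.I) : M.ρ a = 0 := by
  ext m
  rw [ρ_apply, Ideal.Quotient.eq_zero_iff_mem.2 ha, zero_smul]
  rfl

/-- A morphism `f = (f⁰, f¹) : M → N` of `(𝒜, I)-Mod`: `f⁰ ∈ Hom_k(M, N)` and
`f¹ ∈ Hom_{A-A}(V, Hom_k(M, N))` with `a f⁰(m) = f⁰(a m) + f¹(δ(a))(m)`. -/
@[ext]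
structure Hom (M N : Mod 𝒜) where
  f0 : M →ₗ[k] N
  f1 : 𝒜.deg 1 →ₗ[k] M →ₗ[k] N
  bimod : WeakDitalgebra.IsBimod M.ρ N.ρ f1
  comm : ∀ (a : 𝒜.A) (m : M), N.ρ a (f0 m) = f0 (M.ρ a m) + f1 (𝒜.δA a) m

/-- The map `g¹ * f¹ : T₂ = V ⊗_A V → Hom_k(M, L)`, `v w ↦ g¹(v) ∘ f¹(w)`. -/
def Hom.star {M N L : Mod 𝒜} (g : Hom N L) (f : Hom M N) : 𝒜.deg 2 →ₗ[k] M →ₗ[k] L :=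
  𝒜.isLayer.star f.bimod g.bimod

theorem Hom.star_mul {M N L : Mod 𝒜} (g : Hom N L) (f : Hom M N) (v w : 𝒜.deg 1) :
    g.star f (𝒜.mulVV v w) = g.f1 v ∘ₗ f.f1 w := 𝒜.isLayer.star_mul _ _ v w

theorem Hom.star_unique {M N L : Mod 𝒜} (g : Hom N L) (f : Hom M N)
    (φ : 𝒜.deg 2 →ₗ[k] M →ₗ[k] L) (h : ∀ v w, φ (𝒜.mulVV v w) = g.f1 v ∘ₗ f.f1 w) :
    g.star f = φ := 𝒜.isLayer.ext_two fun v w => by rw [star_mul, h]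

/-- The identity morphism `(id, 0)`. -/
def Hom.id (M : Mod 𝒜) : Hom M M where
  f0 := LinearMap.id
  f1 := 0
  bimod a v b := by ext; simp
  comm a m := by simp

/-- The composition `g f = (g⁰ f⁰, (g f)¹)`, where
`(g f)¹(v) = g⁰ f¹(v) + g¹(v) f⁰ + (g¹ * f¹)(δ(v))`. -/
def Hom.comp {M N L : Mod 𝒜} (g : Hom N L) (f : Hom M N) : Hom M L where
  f0 := g.f0 ∘ₗ f.f0
  f1 :=
    { toFun v := g.f0 ∘ₗ f.f1 v + g.f1 v ∘ₗ f.f0 + g.star f (𝒜.δV v)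
      map_add' v w := by ext; simp; abel
      map_smul' c v := by ext; simp }
  bimod a v b := by
    have e : 𝒜.δV (𝒜.bimul a v b) = 𝒜.mulVV (𝒜.δA a) (𝒜.bimul 1 v b) +
        𝒜.bimul₂ a (𝒜.δV v) b - 𝒜.mulVV (𝒜.bimul a v 1) (𝒜.δA b) :=
      Subtype.ext (by
        rw [WeakDitalgebra.δV_bimul]
        simp [WeakDitalgebra.mulVV, WeakDitalgebra.bimul, WeakDitalgebra.bimul₂])
    have e2 : g.star f (𝒜.bimul₂ a (𝒜.δV v) b) = L.ρ a ∘ₗ g.star f (𝒜.δV v) ∘ₗ M.ρ b :=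
      𝒜.isLayer.star_bimul f.bimod g.bimod a _ b
    ext m
    simp only [LinearMap.coe_mk, AddHom.coe_mk, e, map_add, map_sub, star_mul, e2, f.bimod a v b,
      f.bimod 1 v b, g.bimod a v b, g.bimod a v 1, LinearMap.add_apply, LinearMap.sub_apply,
      LinearMap.comp_apply, map_one, Module.End.one_apply]
    have h1 := g.comm a (f.f1 v (M.ρ b m))
    have h2 := f.comm b m
    rw [h1, h2, map_add, map_add]
    abel
  comm a m := by
    have h1 := g.comm a (f.f0 m)
    have h2 := f.comm a m
    have h3 : g.star f (𝒜.δV (𝒜.δA a)) = 0 :=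
      𝒜.isLayer.star_δδ f.bimod g.bimod 𝒜.interlaced M.ρ_I N.ρ_I L.ρ_I a
    simp only [LinearMap.coe_mk, AddHom.coe_mk, LinearMap.add_apply, LinearMap.comp_apply, h3,
      LinearMap.zero_apply, h1, h2, map_add]
    abel

theorem Hom.comp_f1 {M N L : Mod 𝒜} (g : Hom N L) (f : Hom M N) (v : 𝒜.deg 1) :
    (g.comp f).f1 v = g.f0 ∘ₗ f.f1 v + g.f1 v ∘ₗ f.f0 + g.star f (𝒜.δV v) := rfl

theorem Hom.comp_f0 {M N L : Mod 𝒜} (g : Hom N L) (f : Hom M N) :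
    (g.comp f).f0 = g.f0 ∘ₗ f.f0 := rfl

theorem Hom.id_comp {M N : Mod 𝒜} (f : Hom M N) : (Hom.id N).comp f = f := by
  refine Hom.ext (by ext; rfl) (LinearMap.ext fun v => ?_)
  rw [comp_f1, star_unique (Hom.id N) f 0 (fun v w => by ext; simp [Hom.id])]
  ext; simp [Hom.id]

theorem Hom.comp_id {M N : Mod 𝒜} (f : Hom M N) : f.comp (Hom.id M) = f := by
  refine Hom.ext (by ext; rfl) (LinearMap.ext fun v => ?_)
  rw [comp_f1, star_unique f (Hom.id M) 0 (fun v w => by ext; simp [Hom.id])]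
  ext; simp [Hom.id]

theorem Hom.comp_assoc {M N L K : Mod 𝒜} (p : Hom L K) (g : Hom N L) (f : Hom M N) :
    (p.comp g).comp f = p.comp (g.comp f) := by
  refine Hom.ext (by ext; rfl) (LinearMap.ext fun v => ?_)
  obtain ⟨φ, hφ⟩ := 𝒜.isLayer.exists_triple f.bimod g.bimod p.bimod
  have A1 : ∀ (x : 𝒜.deg 2) (w : 𝒜.deg 1), φ (x * w) = p.star g x ∘ₗ f.f1 w := by
    intro x w
    let a : 𝒜.deg 2 →ₗ[k] M →ₗ[k] K :=
      φ ∘ₗ LinearMap.mulRight k (w : T) ∘ₗ (𝒜.deg 2).subtype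
    let b : 𝒜.deg 2 →ₗ[k] M →ₗ[k] K := (LinearMap.lcomp k K (f.f1 w)) ∘ₗ p.star g
    have : a = b := 𝒜.isLayer.ext_two fun u v => by
      change φ (u * v * w) = p.star g (𝒜.mulVV u v) ∘ₗ f.f1 w
      rw [hφ, star_mul]; rfl
    exact LinearMap.congr_fun this x
  have A2 : ∀ (u : 𝒜.deg 1) (x : 𝒜.deg 2), φ (u * x) = p.f1 u ∘ₗ g.star f x := by
    intro u x
    let a : 𝒜.deg 2 →ₗ[k] M →ₗ[k] K :=
      φ ∘ₗ LinearMap.mulLeft k (u : T) ∘ₗ (𝒜.deg 2).subtype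
    let b : 𝒜.deg 2 →ₗ[k] M →ₗ[k] K := (LinearMap.compRight k (p.f1 u)) ∘ₗ g.star f
    have : a = b := 𝒜.isLayer.ext_two fun v w => by
      change φ (u * (v * w)) = p.f1 u ∘ₗ g.star f (𝒜.mulVV v w)
      rw [← mul_assoc, hφ, star_mul]
    exact LinearMap.congr_fun this x
  have A3 : φ (𝒜.δ (𝒜.δ v)) = 0 := WeakDitalgebra.triple_δδ f.bimod g.bimod p.bimod
    𝒜.interlaced M.ρ_I N.ρ_I L.ρ_I K.ρ_I hφ v
  have key : ∀ x : 𝒜.deg 2, p.f0 ∘ₗ g.star f x + p.star (g.comp f) x =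
      p.star g x ∘ₗ f.f0 + (p.comp g).star f x - φ (𝒜.δ x) := by
    let a : 𝒜.deg 2 →ₗ[k] M →ₗ[k] K :=
      (LinearMap.compRight k p.f0) ∘ₗ g.star f + p.star (g.comp f)
    let b : 𝒜.deg 2 →ₗ[k] M →ₗ[k] K :=
      (LinearMap.lcomp k K f.f0) ∘ₗ p.star g + (p.comp g).star f - φ ∘ₗ 𝒜.δ ∘ₗ (𝒜.deg 2).subtype
    have : a = b := 𝒜.isLayer.ext_two fun u w => by
      change p.f0 ∘ₗ g.star f (𝒜.mulVV u w) + p.star (g.comp f) (𝒜.mulVV u w) =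
        p.star g (𝒜.mulVV u w) ∘ₗ f.f0 + (p.comp g).star f (𝒜.mulVV u w) - φ (𝒜.δ (u * w))
      rw [𝒜.leibniz u.2 w, map_add]
      have e1 : φ (𝒜.δ u * w) = p.star g (𝒜.δV u) ∘ₗ f.f1 w := A1 (𝒜.δV u) w
      have e2 : φ ((-1) ^ 1 * (u * 𝒜.δ w)) = - (p.f1 u ∘ₗ g.star f (𝒜.δV w)) := by
        rw [pow_one, neg_one_mul, map_neg]; exact congrArg _ (A2 u (𝒜.δV w))
      rw [e1, e2]
      simp only [star_mul, comp_f1]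
      ext m
      simp
      abel
    exact fun x => LinearMap.congr_fun this x
  have := key (𝒜.δV v)
  have A3' : φ (𝒜.δ (𝒜.δV v)) = 0 := A3
  rw [A3', sub_zero] at this
  simp only [comp_f1]
  ext m
  have := LinearMap.congr_fun this m
  simp only [LinearMap.add_apply, LinearMap.comp_apply] at this
  simp only [LinearMap.add_apply, LinearMap.comp_apply, map_add, comp_f0]
  rw [← sub_eq_zero] at this ⊢
  rw [← neg_eq_zero] at this
  refine Eq.trans ?_ this
  abel

section linear

variable {M N L : Mod 𝒜}

instance : Zero (Hom M N) := ⟨⟨0, 0, fun a v b => by ext; simp, fun a m => by simp⟩⟩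

instance : Add (Hom M N) := ⟨fun f g => ⟨f.f0 + g.f0, f.f1 + g.f1,
  fun a v b => by ext; simp [f.bimod a v b, g.bimod a v b],
  fun a m => by simp [f.comm a m, g.comm a m]; abel⟩⟩

instance : Neg (Hom M N) := ⟨fun f => ⟨-f.f0, -f.f1,
  fun a v b => by ext; simp [f.bimod a v b],
  fun a m => by simp [f.comm a m]; abel⟩⟩

instance : SMul k (Hom M N) := ⟨fun c f => ⟨c • f.f0, c • f.f1,
  fun a v b => by ext; simp [f.bimod a v b],
  fun a m => by simp [f.comm a m]⟩⟩

theorem Hom.add_f0 (f g : Hom M N) : (f + g).f0 = f.f0 + g.f0 := rfl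
theorem Hom.add_f1 (f g : Hom M N) : (f + g).f1 = f.f1 + g.f1 := rfl
theorem Hom.smul_f0 (c : k) (f : Hom M N) : (c • f).f0 = c • f.f0 := rfl
theorem Hom.smul_f1 (c : k) (f : Hom M N) : (c • f).f1 = c • f.f1 := rfl

instance : AddCommGroup (Hom M N) where
  add_assoc f g h := Hom.ext (add_assoc f.f0 g.f0 h.f0) (add_assoc f.f1 g.f1 h.f1)
  zero_add f := Hom.ext (zero_add f.f0) (zero_add f.f1)
  add_zero f := Hom.ext (add_zero f.f0) (add_zero f.f1)
  neg_add_cancel f := Hom.ext (neg_add_cancel f.f0) (neg_add_cancel f.f1)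
  add_comm f g := Hom.ext (add_comm f.f0 g.f0) (add_comm f.f1 g.f1)
  nsmul := nsmulRec
  zsmul := zsmulRec

instance : Module k (Hom M N) where
  one_smul f := Hom.ext (one_smul k f.f0) (one_smul k f.f1)
  mul_smul c d f := Hom.ext (mul_smul c d f.f0) (mul_smul c d f.f1)
  smul_zero c := Hom.ext (smul_zero c) (smul_zero c)
  smul_add c f g := Hom.ext (smul_add c f.f0 g.f0) (smul_add c f.f1 g.f1)
  add_smul c d f := Hom.ext (add_smul c d f.f0) (add_smul c d f.f1)
  zero_smul f := Hom.ext (zero_smul k f.f0) (zero_smul k f.f1)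

theorem Hom.add_comp (g g' : Hom N L) (f : Hom M N) :
    (g + g').comp f = g.comp f + g'.comp f := by
  refine Hom.ext (by ext; rfl) (LinearMap.ext fun v => ?_)
  rw [add_f1, LinearMap.add_apply]
  simp only [comp_f1]
  rw [star_unique (g + g') f (g.star f + g'.star f)
    (fun v w => by ext; simp [star_mul, add_f1])]
  ext; simp [add_f0, add_f1]; abel

theorem Hom.comp_add (g : Hom N L) (f f' : Hom M N) :
    g.comp (f + f') = g.comp f + g.comp f' := by
  refine Hom.ext (by ext; simp [Hom.comp, add_f0]) (LinearMap.ext fun v => ?_)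
  rw [add_f1, LinearMap.add_apply]
  simp only [comp_f1]
  rw [star_unique g (f + f') (g.star f + g.star f')
    (fun v w => by ext; simp [star_mul, add_f1])]
  ext; simp [add_f0, add_f1]; abel

theorem Hom.smul_comp (c : k) (g : Hom N L) (f : Hom M N) :
    (c • g).comp f = c • g.comp f := by
  refine Hom.ext (by ext; rfl) (LinearMap.ext fun v => ?_)
  rw [smul_f1, LinearMap.smul_apply]
  simp only [comp_f1]
  rw [star_unique (c • g) f (c • g.star f) (fun v w => by ext; simp [star_mul, smul_f1])]
  ext; simp [smul_f0, smul_f1]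

theorem Hom.comp_smul (c : k) (g : Hom N L) (f : Hom M N) :
    g.comp (c • f) = c • g.comp f := by
  refine Hom.ext (by ext; simp [Hom.comp, smul_f0]) (LinearMap.ext fun v => ?_)
  rw [smul_f1, LinearMap.smul_apply]
  simp only [comp_f1]
  rw [star_unique g (c • f) (c • g.star f) (fun v w => by ext; simp [star_mul, smul_f1])]
  ext; simp [smul_f0, smul_f1]

end linear

/-- The category `(𝒜, I)-Mod`. -/
instance : Category (Mod 𝒜) where
  Hom := Hom
  id := Hom.id
  comp f g := g.comp f
  id_comp := Hom.comp_id
  comp_id := Hom.id_comp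
  assoc f g p := (Hom.comp_assoc p g f).symm

instance : Preadditive (Mod 𝒜) where
  homGroup M N := inferInstanceAs (AddCommGroup (Hom M N))
  add_comp _ _ _ f f' g := Hom.comp_add g f f'
  comp_add _ _ _ f g g' := Hom.add_comp g g' f

instance : Linear k (Mod 𝒜) where
  homModule M N := inferInstanceAs (Module k (Hom M N))
  smul_comp _ _ _ c f g := Hom.comp_smul c g f
  comp_smul _ _ _ f c g := Hom.smul_comp c g f

theorem ρ_map {M N : Mod 𝒜} (φ : M.carrier →ₗ[𝒜.Abar] N.carrier) (a : 𝒜.A) (m : M) :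
    N.ρ a (φ m) = φ (M.ρ a m) := (map_smul φ _ m).symm

/-- The morphism `L(φ) = (φ, 0)` of `(𝒜, I)-Mod` attached to a morphism `φ` of `A/I`-modules. -/
def ofLinear {M N : Mod 𝒜} (φ : M.carrier →ₗ[𝒜.Abar] N.carrier) : M ⟶ N where
  f0 := φ.restrictScalars k
  f1 := 0
  bimod a v b := by ext; simp
  comm a m := by simpa using ρ_map φ a m

theorem ofLinear_comp {M N L : Mod 𝒜} (φ : M.carrier →ₗ[𝒜.Abar] N.carrier)
    (ψ : N.carrier →ₗ[𝒜.Abar] L.carrier) :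
    ofLinear φ ≫ ofLinear ψ = (ofLinear (ψ ∘ₗ φ) : M ⟶ L) := by
  refine Hom.ext (by ext; rfl) (LinearMap.ext fun v => ?_)
  change (Hom.comp (ofLinear ψ) (ofLinear φ)).f1 v = 0
  rw [Hom.comp_f1, Hom.star_unique (ofLinear ψ) (ofLinear φ) 0
    (fun v w => by ext; simp [ofLinear])]
  ext; simp [ofLinear]

theorem ofLinear_add {M N : Mod 𝒜} (φ ψ : M.carrier →ₗ[𝒜.Abar] N.carrier) :
    (ofLinear (φ + ψ) : M ⟶ N) = ofLinear φ + ofLinear ψ :=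
  Hom.ext rfl (add_zero (0 : 𝒜.deg 1 →ₗ[k] M →ₗ[k] N)).symm

theorem ofLinear_zero {M N : Mod 𝒜} :
    (ofLinear (0 : M.carrier →ₗ[𝒜.Abar] N.carrier) : M ⟶ N) = 0 := rfl

theorem ofLinear_id (M : Mod 𝒜) :
    (ofLinear (LinearMap.id : M.carrier →ₗ[𝒜.Abar] M.carrier) : M ⟶ M) = 𝟙 M := rfl

theorem ofLinear_sum {ι : Type} (s : Finset ι) {M N : Mod 𝒜}
    (φ : ι → M.carrier →ₗ[𝒜.Abar] N.carrier) :
    (ofLinear (∑ i ∈ s, φ i) : M ⟶ N) = ∑ i ∈ s, ofLinear (φ i) := by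
  classical
  induction s using Finset.induction_on with
  | empty => simp [ofLinear_zero]
  | insert i s hi ih => rw [Finset.sum_insert hi, Finset.sum_insert hi, ofLinear_add, ih]

/-- The object of `(𝒜, I)-Mod` given by an `A/I`-module. -/
abbrev of (𝒜 : TriangularInterlacedDitalgebra k T) (M : Type u) [AddCommGroup M] [Module k M]
    [Module 𝒜.Abar M] [IsScalarTower k 𝒜.Abar M] : Mod 𝒜 := ⟨M⟩

/-- Finite direct sums in `(𝒜, I)-Mod` are the direct sums of modules. -/
def bicone {n : ℕ} (M : Fin n → Mod 𝒜) : Bicone M where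
  pt := of 𝒜 (∀ i, M i)
  π i := ofLinear (LinearMap.proj i)
  ι i := ofLinear (LinearMap.single 𝒜.Abar (fun i => (M i).carrier) i)
  ι_π i j := by
    rw [ofLinear_comp]
    split_ifs with h
    · subst h
      rw [LinearMap.proj_comp_single_same]
      rfl
    · rw [LinearMap.proj_comp_single_ne _ _ _ _ (Ne.symm h)]
      rfl

instance : HasFiniteBiproducts (Mod 𝒜) where
  out n :=
    { has_biproduct := fun M => hasBiproduct_of_total (bicone M) (by
        have e : (∑ i, LinearMap.single 𝒜.Abar (fun i => (M i).carrier) i ∘ₗ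
            LinearMap.proj i) = LinearMap.id := by
          refine LinearMap.ext fun x => ?_
          simp only [LinearMap.sum_apply, LinearMap.comp_apply, LinearMap.proj_apply,
            LinearMap.id_apply]
          exact LinearMap.sum_single_apply _ x
        have h1 : ∀ i, (bicone M).π i ≫ (bicone M).ι i =
            ofLinear (M := (bicone M).pt) (N := (bicone M).pt)
              (LinearMap.single 𝒜.Abar (fun i => (M i).carrier) i ∘ₗ LinearMap.proj i) :=
          fun i => ofLinear_comp (N := M i) _ _
        refine (Finset.sum_congr rfl fun i _ => h1 i).trans ?_
        refine (ofLinear_sum (M := (bicone M).pt) (N := (bicone M).pt) Finset.univ _).symm.trans ?_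
        exact (congrArg (ofLinear (M := (bicone M).pt) (N := (bicone M).pt)) e).trans
          (ofLinear_id _)) }

instance : HasBinaryBiproducts (Mod 𝒜) := hasBinaryBiproducts_of_finite_biproducts _

/-- `M → E → N` is a conflation, i.e. belongs to the class `ℰ`: it is isomorphic to a pair
`((φ, 0), (ψ, 0))` with `0 → M' → E' → N' → 0` split exact in `R-Mod`. -/
def IsConflation {M E N : Mod 𝒜} (f : M ⟶ E) (g : E ⟶ N) : Prop :=
  ∃ (M' E' N' : Mod 𝒜) (φ : M'.carrier →ₗ[𝒜.Abar] E'.carrier)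
    (ψ : E'.carrier →ₗ[𝒜.Abar] N'.carrier) (a : M ≅ M') (b : E ≅ E') (c : N ≅ N'),
    f ≫ b.hom = a.hom ≫ ofLinear φ ∧ g ≫ c.hom = b.hom ≫ ofLinear ψ ∧
    Function.Injective φ ∧ Function.Exact φ ψ ∧ Function.Surjective ψ ∧
    ∃ s : N'.carrier →ₗ[k] E'.carrier, (∀ n, ψ (s n) = n) ∧
      ∀ a : 𝒜.A, (a : T) ∈ 𝒜.R → ∀ n, s (N'.ρ a n) = E'.ρ a (s n)

/-- `Q` is projective relative to the exact structure `ℰ` on the category `(𝒜, I)-mod` of finite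
dimensional objects. -/
def IsEProjective (Q : Mod 𝒜) : Prop :=
  ∀ (M E N : Mod 𝒜) (f : M ⟶ E) (g : E ⟶ N), Module.Finite k M → Module.Finite k E →
    Module.Finite k N → IsConflation f g → ∀ h : Q ⟶ N, ∃ h' : Q ⟶ E, h' ≫ g = h

end Mod

/-- The regular module `A/I` as an object of `(𝒜, I)-Mod`. -/
abbrev regular (𝒜 : TriangularInterlacedDitalgebra k T) : Mod 𝒜 := Mod.of 𝒜 𝒜.Abar

/-- The right algebra `Γ = End_{(𝒜, I)}(A/I)ᵒᵖ`. -/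
abbrev Γ (𝒜 : TriangularInterlacedDitalgebra k T) : Type u := (End 𝒜.regular)ᵐᵒᵖ

/-- The endomorphism `(x ↦ x a, 0)` of the regular module. -/
def rightMul (𝒜 : TriangularInterlacedDitalgebra k T) (a : 𝒜.Abar) : 𝒜.regular ⟶ 𝒜.regular :=
  Mod.ofLinear (LinearMap.toSpanSingleton 𝒜.Abar 𝒜.Abar a)

section rightMul

variable (𝒜 : TriangularInterlacedDitalgebra k T)

theorem rightMul_one : 𝒜.rightMul 1 = 𝟙 _ := by
  refine Eq.trans ?_ (Mod.ofLinear_id _)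
  exact congrArg Mod.ofLinear (LinearMap.ext fun x => mul_one (x : 𝒜.Abar))

theorem rightMul_mul (a b : 𝒜.Abar) : 𝒜.rightMul (a * b) = 𝒜.rightMul a ≫ 𝒜.rightMul b := by
  refine Eq.trans ?_ (Mod.ofLinear_comp _ _).symm
  exact congrArg Mod.ofLinear (LinearMap.ext fun x => (mul_assoc (x : 𝒜.Abar) a b).symm)

theorem rightMul_add (a b : 𝒜.Abar) : 𝒜.rightMul (a + b) = 𝒜.rightMul a + 𝒜.rightMul b := by
  refine Eq.trans ?_ (Mod.ofLinear_add _ _)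
  exact congrArg Mod.ofLinear (LinearMap.ext fun x => mul_add (x : 𝒜.Abar) a b)

theorem rightMul_smul (c : k) (a : 𝒜.Abar) : 𝒜.rightMul (c • a) = c • 𝒜.rightMul a :=
  Mod.Hom.ext (LinearMap.ext fun x => mul_smul_comm c (x : 𝒜.Abar) a)
    (smul_zero c).symm

end rightMul

/-- The embedding `A/I ≅ End_{A/I}(A/I)ᵒᵖ → Γ`, sending `a` to the right multiplication by `a`. -/
def toΓ (𝒜 : TriangularInterlacedDitalgebra k T) : 𝒜.Abar →ₐ[k] 𝒜.Γ :=
  AlgHom.ofLinearMap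
    { toFun a := MulOpposite.op (𝒜.rightMul a)
      map_add' a b := congrArg MulOpposite.op (𝒜.rightMul_add a b)
      map_smul' c a := congrArg MulOpposite.op (𝒜.rightMul_smul c a) }
    (congrArg MulOpposite.op 𝒜.rightMul_one)
    (fun a b => congrArg MulOpposite.op (𝒜.rightMul_mul a b))

end TriangularInterlacedDitalgebra
/-! ### Modules over a ring: induction, indecomposable projectives, homological systems -/

/-- The induced left `B`-module `B ⊗_C M` along a morphism of `k`-algebras `ι : C → B`: the
quotient of `B ⊗_k M` by the relations `(b ι(c)) ⊗ m = b ⊗ (c m)`. -/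
def inducedModule {k C B : Type u} [Field k] [Ring C] [Algebra k C] [Ring B] [Algebra k B]
    (ι : C →ₐ[k] B) (M : Type u) [AddCommGroup M] [Module k M] [Module C M]
    [IsScalarTower k C M] : ModuleCat.{u} B :=
  ModuleCat.of B ((B ⊗[k] M) ⧸ Submodule.span B
    {x : B ⊗[k] M | ∃ (b : B) (c : C) (m : M), x = (b * ι c) ⊗ₜ[k] m - b ⊗ₜ[k] (c • m)})

/-- `P` is a complete family of representatives (without repetitions) of the isomorphism classes
of indecomposable projective left `Λ`-modules. -/
structure IsCompleteIndecProj (Λ : Type u) [Ring Λ] {J : Type v} (P : J → ModuleCat.{u} Λ) :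
    Prop where
  finite : ∀ i, Module.Finite Λ (P i)
  projective : ∀ i, Module.Projective Λ (P i)
  indecomposable : ∀ i, Indecomposable (P i)
  eq_of_iso : ∀ i j, Nonempty (P i ≅ P j) → i = j
  complete : ∀ M : ModuleCat.{u} Λ, Module.Projective Λ M → Indecomposable M →
    ∃ i, Nonempty (M ≅ P i)

/-- `M` belongs to `ℱ(Δ)`: it has a finite filtration
`0 = Mₜ ⊆ ⋯ ⊆ M₁ ⊆ M₀ = M` by submodules with each `Mⱼ / Mⱼ₊₁` isomorphic to some `Δᵢ`. -/
def HasDeltaFiltration {Λ : Type u} [Ring Λ] {J : Type v} (Δ : J → ModuleCat.{u} Λ)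
    (M : Type u) [AddCommGroup M] [Module Λ M] : Prop :=
  ∃ (t : ℕ) (F : ℕ → Submodule Λ M), F 0 = ⊤ ∧ F t = ⊥ ∧
    ∀ j < t, F (j + 1) ≤ F j ∧
      ∃ i, Nonempty ((F j ⧸ (F (j + 1)).submoduleOf (F j)) ≃ₗ[Λ] Δ i)

/-- `(J, ≤, Δ)` is a homological system for the finite dimensional `k`-algebra `Λ`. Here `i < j`
means `i ≤ j` and `i ≁ j`. -/
structure IsHomologicalSystem (k : Type u) [Field k] (Λ : Type u) [Ring Λ] [Algebra k Λ]
    {J : Type v} [Preorder J] (Δ : J → ModuleCat.{u} Λ) : Prop where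
  finiteDimensional : Module.Finite k Λ
  finite_index : Finite J
  nonempty_index : Nonempty J
  finite : ∀ i, Module.Finite Λ (Δ i)
  indecomposable : ∀ i, Indecomposable (Δ i)
  eq_of_iso : ∀ i j, Nonempty (Δ i ≅ Δ j) → i = j
  hom : ∀ i j, Nontrivial (Δ i ⟶ Δ j) → i ≤ j
  ext : ∀ i j, Nontrivial (Abelian.Ext (Δ i) (Δ j) 1) → i < j

/-- A homological system is admissible if `Λ ∈ ℱ(Δ)` and the number of isomorphism classes of
indecomposable projective `Λ`-modules is the cardinality of `J`, i.e. these classes are in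
bijection with the finite set `J`. -/
structure IsAdmissibleHomologicalSystem (k : Type u) [Field k] (Λ : Type u) [Ring Λ]
    [Algebra k Λ] {J : Type v} [Preorder J] (Δ : J → ModuleCat.{u} Λ) : Prop
    extends IsHomologicalSystem k Λ Δ where
  filtration : HasDeltaFiltration Δ Λ
  card : ∃ P : J → ModuleCat.{u} Λ, IsCompleteIndecProj Λ P

/-- An admissible homological system is strict if `Extⁿ(Δᵢ, Δⱼ) ≠ 0` implies `i ≤ j` and `i ≁ j`,
for all `n ≥ 1`. -/
structure IsStrictHomologicalSystem (k : Type u) [Field k] (Λ : Type u) [Ring Λ]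
    [Algebra k Λ] {J : Type v} [Preorder J] (Δ : J → ModuleCat.{u} Λ) : Prop
    extends IsAdmissibleHomologicalSystem k Λ Δ where
  ext_all : ∀ n : ℕ, 1 ≤ n → ∀ i j, Nontrivial (Abelian.Ext (Δ i) (Δ j) n) → i < j

namespace TriangularInterlacedDitalgebra

variable {k T : Type u} [Field k] [Ring T] [Algebra k T] {J : Type v}

/-- The triangular interlaced weak ditalgebra is `J`-strict, with `R = S = ⨁ᵢ k eᵢ` for the family
`e` of orthogonal idempotents. In a preorder, `i < j` means that the class of `i` is strictly
smaller than the class of `j`. -/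
structure IsStrict (𝒜 : TriangularInterlacedDitalgebra k T) [Fintype J] [Preorder J]
    (e : J → 𝒜.A) : Prop where
  idempotents : CompleteOrthogonalIdempotents e
  ne_zero : ∀ i, e i ≠ 0
  R_eq : Subalgebra.toSubmodule 𝒜.R = Submodule.span k (Set.range fun i => (e i : T))
  finite_W₀ : Module.Finite k 𝒜.W₀
  finite_W₁ : Module.Finite k 𝒜.W₁
  W₁_le : ∀ i j, (∃ w ∈ 𝒜.W₁, (e j : T) * w * e i ≠ 0) → i ≤ j
  W₀_lt : ∀ i j, (∃ w ∈ 𝒜.W₀, (e j : T) * w * e i ≠ 0) → i < j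
  I_le : 𝒜.I ≤ (((Ring.jacobson 𝒜.A).restrictScalars k).map 𝒜.A.val.toLinearMap) ^ 2

variable (𝒜 : TriangularInterlacedDitalgebra k T) (e : J → 𝒜.A)

/-- `i ≺ j`: there is a nontrivial path from `i` to `j` in the quiver with `dim eⱼ W₀ eᵢ` arrows
from `i` to `j`. -/
def Precedes (i j : J) : Prop :=
  Relation.TransGen (fun i j => ∃ w ∈ 𝒜.W₀, (e j : T) * w * e i ≠ 0) i j

/-- The projective `A/I`-module `(A/I) eᵢ`. -/
def proj (i : J) : 𝒜.Mod :=
  Mod.of 𝒜 (Submodule.span 𝒜.Abar {Ideal.Quotient.mk 𝒜.ideal (e i)})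

/-- The simple `A/I`-module `Sᵢ = (A/I) eᵢ / rad((A/I) eᵢ)`. -/
def simple (i : J) : 𝒜.Mod :=
  Mod.of 𝒜 ((proj 𝒜 e i).carrier ⧸ Module.jacobson 𝒜.Abar (proj 𝒜 e i).carrier)

/-- `Q` is a complete family of representatives of the indecomposable `ℰ`-projective objects of
`(𝒜, I)-mod`, indexed so that `(A/I) eᵢ ≅ Qᵢ ⊕ ⨁_{i ≺ j} mᵢⱼ Qⱼ` in `(𝒜, I)-mod`. -/
structure IsIndecEProjFamily (Q : J → 𝒜.Mod) : Prop where
  finite : ∀ i, Module.Finite k (Q i).carrier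
  indecomposable : ∀ i, Indecomposable (Q i)
  projective : ∀ i, (Q i).IsEProjective
  eq_of_iso : ∀ i j, Nonempty (Q i ≅ Q j) → i = j
  complete : ∀ M : 𝒜.Mod, Module.Finite k M.carrier → M.IsEProjective → Indecomposable M →
    ∃ i, Nonempty (M ≅ Q i)
  decomposition : ∀ i, ∃ (n : ℕ) (σ : Fin n → J), (∀ l, 𝒜.Precedes e i (σ l)) ∧
    Nonempty (proj 𝒜 e i ≅ Q i ⊞ ⨁ fun l => Q (σ l))

/-- The left `Γ`-module `Γ ⊗_{A/I} M`. -/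
def induced (M : 𝒜.Mod) : ModuleCat.{u} 𝒜.Γ := inducedModule 𝒜.toΓ M.carrier

end TriangularInterlacedDitalgebra

end

/-!
Write `B = A/I`. The proof compares `(𝒜, I)-Mod` with left `Γ`-modules through the functor
`G = Hom(B, -)` and reads all the assertions off properties of `(𝒜, I)-mod`.

*Idempotents split in `(𝒜, I)-Mod`.* A bimodule map `W₁ → End_k(M)` can be prescribed freely as the
second component of a morphism `M → M'` which is the identity on vector spaces: triangularity of the
layer yields the action of `A` on `M'`, and triangularity of `I` makes it factor through `B`
(`Mod.exists_transport`). Moving along the filtration of `W₁`, such changes of structure turn a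
morphism with bijective first component into an isomorphism (`Mod.isIso_of_bijective`), and make the
second component of an idempotent vanish (`Mod.exists_iso_idempotent`). Hence finite-dimensional
indecomposable objects have no idempotents other than `0` and `1`, and their endomorphisms are
nilpotent or invertible (`Indecomposable.nilpotentOrIso`).

*The functor `G`.* A morphism out of `B` is given by the image of `1` and an arbitrary `R`-bimodule
map on `W₁` (`Mod.exists_regular_hom`). As `R` is semisimple, `B` lifts along all surjections, so
that `G` is exact on exact sequences of `B`-modules (`homΓ_shortExact`), and `Γ ⊗_B M ≅ G(M)` for
finite-dimensional `M` by a presentation by free modules (`inducedIso`). Moreover `G` is fully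
faithful on finite-dimensional objects (`homΓ_full`, `homΓ_faithful`).

*Relative projectives.* The object `B eᵢ` is a retract of `B`, hence `ℰ`-projective. As
`eᵢ B eᵢ = k eᵢ`, exactly one indecomposable summand `Qᵢ` of `B eᵢ` meets the vertex `i`, and
everything else is supported on successors of `i`. If `j` is minimal in the support of an
`ℰ`-projective object `X`, then `X` and `Qⱼ` both map onto `Sⱼ`, and lifting these maps to one
another splits `Qⱼ` off `X` (`ProjDecomposition.exists_retract`). The same lifting argument over a
simple quotient identifies any indecomposable projective `Γ`-module with some `G(Qⱼ)`
(`isCompleteIndecProj_homΓ`).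

*The homological system.* Nonzero morphisms in `(𝒜, I)-Mod` go up in the preorder
(`exists_inSupp_le`), which gives the condition on `Hom`. For the extension groups, apply `G` to
`0 → rad(B eₗ) → B eₗ → Sₗ → 0`. Unless `l < j`, every morphism `rad(B eₗ) → Sⱼ` has zero first
component and extends to `B eₗ` (`exists_extension`), so that `Ext¹(G Sₗ, G Sⱼ) = 0`; the higher
groups vanish by dimension shift, because `rad(B eₗ)` has a filtration by simple modules
`Sᵢ` with `l < i` (`ext_eq_zero`). Finally a filtration of `B` with simple factors is carried by `G` to
a filtration of `Γ` (`homΓ_hasDeltaFiltration`).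
-/

noncomputable section

/-! ### Representations and bimodule maps determined on the layer -/

theorem Submodule.mul_mul_le {k T : Type*} [CommSemiring k] [Semiring T] [Algebra k T]
    {P F Q K : Submodule k T} (H : ∀ p ∈ P, ∀ f ∈ F, ∀ q ∈ Q, p * f * q ∈ K) :
    P * F * Q ≤ K :=
  Submodule.mul_le.2 fun _ hx q hq =>
    Submodule.mul_induction_on hx (fun p hp f hf => H p hp f hf q hq)
      fun x y hx hy => by rw [add_mul]; exact add_mem hx hy

namespace WeakDitalgebra

variable {k T : Type u} [Field k] [Ring T] [Algebra k T]
variable {D : WeakDitalgebra k T} {R : Subalgebra k T} {W₀ W₁ : Submodule k T}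

theorem IsLayer.eq_top_of_mem (h : D.IsLayer R W₀ W₁) (S : Subalgebra k D.A)
    (hR : ∀ r : D.A, (r : T) ∈ R → r ∈ S) (hW : ∀ w : D.A, (w : T) ∈ W₀ → w ∈ S) (a : D.A) :
    a ∈ S := by
  have h1 : Algebra.adjoin k ((R : Set T) ∪ W₀) ≤ S.map D.A.val := by
    refine Algebra.adjoin_le ?_
    rintro x (hx | hx)
    · exact ⟨⟨x, h.R_le hx⟩, hR _ hx, rfl⟩
    · exact ⟨⟨x, h.W₀_le hx⟩, hW _ hx, rfl⟩
  have h2 : (a : T) ∈ Subalgebra.toSubmodule (Algebra.adjoin k ((R : Set T) ∪ W₀)) := by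
    rw [← h.deg_zero]; exact a.2
  obtain ⟨b, hb, e⟩ := h1 h2
  rwa [← Subtype.ext (a1 := b) (a2 := a) e]

theorem IsLayer.algHom_ext (h : D.IsLayer R W₀ W₁) {B : Type*} [Ring B] [Algebra k B]
    {ρ ρ' : D.A →ₐ[k] B} (hR : ∀ r : D.A, (r : T) ∈ R → ρ r = ρ' r)
    (hW : ∀ w : D.A, (w : T) ∈ W₀ → ρ w = ρ' w) : ρ = ρ' :=
  AlgHom.ext fun a => h.eq_top_of_mem (AlgHom.equalizer ρ ρ') hR hW a

/-- `A` is the tensor algebra `T_R(W₀)`: a representation of `R` and a compatible action of `W₀`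
extend to a representation of `A`. -/
theorem IsLayer.exists_rep (h : D.IsLayer R W₀ W₁) {B : Type u} [Ring B] [Algebra k B]
    (σ : R →ₐ[k] B) (ψ : W₀ →ₗ[k] B) (hψ : IsBimoduleMap σ ψ) :
    ∃ ρ : D.A →ₐ[k] B, (∀ r : R, ρ ⟨r, h.R_le r.2⟩ = σ r) ∧
      ∀ w : W₀, ρ ⟨w, h.W₀_le w.2⟩ = ψ w := by
  obtain ⟨Φ, ⟨h1, h2, -⟩, -⟩ := h.free B σ ψ 0 hψ
    (fun r w w' => ⟨fun _ => by simp, fun _ => by simp⟩)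
  exact ⟨Φ.comp D.A.val, h1, h2⟩

variable {M N : Type u} [AddCommGroup M] [Module k M] [AddCommGroup N] [Module k N]

/-- `ψ : W₁ → Hom_k(M, N)` is a morphism of `R`-`R`-bimodules. -/
def IsRBimod (R : Subalgebra k T) {W₁ : Submodule k T} (ρM : D.A →ₐ[k] Module.End k M)
    (ρN : D.A →ₐ[k] Module.End k N) (ψ : W₁ →ₗ[k] M →ₗ[k] N) : Prop :=
  ∀ r : D.A, (r : T) ∈ R → ∀ w w' : W₁,
    ((w' : T) = r * w → ψ w' = ρN r ∘ₗ ψ w) ∧ ((w' : T) = w * r → ψ w' = ψ w ∘ₗ ρM r)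

/-- `V` is the free bimodule `A ⊗_R W₁ ⊗_R A`: a morphism of `R`-`R`-bimodules
`W₁ → Hom_k(M, N)` extends to a morphism of `A`-`A`-bimodules on `V`. -/
theorem IsLayer.exists_bimod (h : D.IsLayer R W₀ W₁) (ρM : D.A →ₐ[k] Module.End k M)
    (ρN : D.A →ₐ[k] Module.End k N) (ψ : W₁ →ₗ[k] M →ₗ[k] N) (hψ : IsRBimod R ρM ρN ψ) :
    ∃ f : D.deg 1 →ₗ[k] M →ₗ[k] N, IsBimod ρM ρN f ∧
      ∀ w : W₁, f ⟨w, h.W₁_le w.2⟩ = ψ w := by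
  -- the matrix algebra trick: `A` acts diagonally on `M × N` and `W₁` off the diagonal
  let ρ : D.A →ₐ[k] Module.End k (M × N) := AlgHom.ofLinearMap
    { toFun a := (ρM a).prodMap (ρN a)
      map_add' a b := by ext <;> simp
      map_smul' a b := by ext <;> simp } (by ext <;> simp) (fun a b => by ext <;> simp)
  let ψ₁ : W₁ →ₗ[k] Module.End k (M × N) :=
    { toFun w := LinearMap.inr k M N ∘ₗ ψ w ∘ₗ LinearMap.fst k M N
      map_add' a b := by ext <;> simp
      map_smul' a b := by ext <;> simp }
  let ψ₀ : W₀ →ₗ[k] Module.End k (M × N) :=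
    { toFun w := ρ ⟨w, h.W₀_le w.2⟩
      map_add' _ _ := ρ.map_add ⟨_, _⟩ ⟨_, _⟩
      map_smul' c w := map_smul ρ c (⟨w, h.W₀_le w.2⟩ : D.A) }
  have hR : R ≤ D.A := fun x hx => h.R_le hx
  obtain ⟨Φ, ⟨h1, h2, h3⟩, -⟩ := h.free _ (ρ.comp (Subalgebra.inclusion hR)) ψ₀ ψ₁
    (fun r w w' => ⟨fun e => by
        change ρ _ = ρ _ * ρ _
        rw [← map_mul]; congr 1; exact Subtype.ext e,
      fun e => by
        change ρ _ = ρ _ * ρ _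
        rw [← map_mul]; congr 1; exact Subtype.ext e⟩)
    (fun r w w' => ⟨fun e => by
        have := (hψ (Subalgebra.inclusion hR r) r.2 w w').1 e
        ext m <;> simp [ψ₁, ρ, this],
      fun e => by
        have := (hψ (Subalgebra.inclusion hR r) r.2 w w').2 e
        ext m <;> simp [ψ₁, ρ, this]⟩)
  have hΦ : Φ.comp D.A.val = ρ := h.algHom_ext (fun r hr => h1 ⟨r, hr⟩) (fun w hw => h2 ⟨w, hw⟩)
  have hA : ∀ a : D.A, Φ a = ρ a := fun a => DFunLike.congr_fun hΦ a
  refine ⟨(LinearMap.compRight k (LinearMap.snd k M N)) ∘ₗ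
    (LinearMap.lcomp k _ (LinearMap.inl k M N)) ∘ₗ Φ.toLinearMap ∘ₗ (D.deg 1).subtype,
    fun a v b => ?_, fun w => ?_⟩
  · ext m
    simp [bimul, hA, ρ]
  · ext m
    simp [h3, ψ₁]

theorem IsBimod.zero (ρM : D.A →ₐ[k] Module.End k M) (ρN : D.A →ₐ[k] Module.End k N) :
    IsBimod ρM ρN 0 := fun a v b => by ext; simp

/-- Two bimodule maps which agree on `F`, and whose target and source actions agree on `P` and `Q`,
agree on `P F Q`. -/
theorem IsBimod.eq_on {ρM ρM' : D.A →ₐ[k] Module.End k M} {ρN ρN' : D.A →ₐ[k] Module.End k N}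
    {f f' : D.deg 1 →ₗ[k] M →ₗ[k] N} (hf : IsBimod ρM ρN f) (hf' : IsBimod ρM' ρN' f')
    {P F Q : Submodule k T} (hP : P ≤ D.deg 0) (hF : F ≤ D.deg 1) (hQ : Q ≤ D.deg 0)
    (hPe : ∀ a : D.A, (a : T) ∈ P → ρN a = ρN' a) (hQe : ∀ a : D.A, (a : T) ∈ Q → ρM a = ρM' a)
    (hFe : ∀ v : D.deg 1, (v : T) ∈ F → f v = f' v) (v : D.deg 1) (hv : (v : T) ∈ P * F * Q) :
    f v = f' v := by
  have : P * F * Q ≤ (LinearMap.eqLocus f f').map (D.deg 1).subtype := by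
    refine Submodule.mul_mul_le fun p hp x hx q hq => ?_
    refine ⟨D.bimul ⟨p, hP hp⟩ ⟨x, hF hx⟩ ⟨q, hQ hq⟩, ?_, rfl⟩
    change f _ = f' _
    rw [hf, hf', hPe ⟨p, hP hp⟩ hp, hQe ⟨q, hQ hq⟩ hq, hFe ⟨x, hF hx⟩ hx]
  obtain ⟨w, hw, e⟩ := this hv
  rw [← Subtype.ext (a1 := w) (a2 := v) e]
  exact hw

theorem IsBimod.eq_zero_on {ρM : D.A →ₐ[k] Module.End k M} {ρN : D.A →ₐ[k] Module.End k N}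
    {f : D.deg 1 →ₗ[k] M →ₗ[k] N} (hf : IsBimod ρM ρN f)
    {F : Submodule k T} (hF : F ≤ D.deg 1)
    (hFe : ∀ v : D.deg 1, (v : T) ∈ F → f v = 0) (v : D.deg 1)
    (hv : (v : T) ∈ D.deg 0 * F * D.deg 0) : f v = 0 :=
  hf.eq_on (IsBimod.zero ρM ρN) le_rfl hF le_rfl (fun _ _ => rfl) (fun _ _ => rfl) hFe v hv

/-- A morphism of bimodules on `V` is determined by its restriction to `W₁`. -/
theorem IsLayer.bimod_ext (h : D.IsLayer R W₀ W₁) {ρM : D.A →ₐ[k] Module.End k M}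
    {ρN : D.A →ₐ[k] Module.End k N} {f f' : D.deg 1 →ₗ[k] M →ₗ[k] N} (hf : IsBimod ρM ρN f)
    (hf' : IsBimod ρM ρN f') (e : ∀ v : D.deg 1, (v : T) ∈ W₁ → f v = f' v) : f = f' :=
  LinearMap.ext fun v => hf.eq_on hf' le_rfl h.W₁_le le_rfl (fun _ _ => rfl) (fun _ _ => rfl) e v
    (by rw [mul_assoc, ← h.deg_one]; exact v.2)

/-- An `A`-bimodule map restricts to an `R`-bimodule map on any subspace of `V`. -/
theorem IsBimod.isRBimod {ρM : D.A →ₐ[k] Module.End k M}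
    {ρN : D.A →ₐ[k] Module.End k N} {f : D.deg 1 →ₗ[k] M →ₗ[k] N} (hf : IsBimod ρM ρN f)
    (hW : W₁ ≤ D.deg 1) : IsRBimod R ρM ρN (f ∘ₗ Submodule.inclusion hW) := by
  refine fun r _ w w' => ⟨fun e => ?_, fun e => ?_⟩
  · have := hf r (Submodule.inclusion hW w) 1
    rw [map_one] at this
    refine (congrArg f (Subtype.ext ?_)).trans this
    simpa [bimul] using e
  · have := hf 1 (Submodule.inclusion hW w) r
    rw [map_one] at this
    refine (congrArg f (Subtype.ext ?_)).trans this
    simpa [bimul] using e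

theorem δA_R (h : D.IsLayer R W₀ W₁) (r : D.A) (hr : (r : T) ∈ R) : D.δA r = 0 :=
  Subtype.ext (h.δ_R r hr)

end WeakDitalgebra

/-! ### Change of module structure, isomorphisms, and splitting of idempotents -/

namespace WeakDitalgebra

variable {k T : Type u} [Field k] [Ring T] [Algebra k T]
variable {D : WeakDitalgebra k T} {R : Subalgebra k T} {W₀ W₁ : Submodule k T}
variable {M : Type u} [AddCommGroup M] [Module k M]

/-- The `n`-th approximation to the action of `A` on `M` for which `(id, f)` becomes a morphism,
where `f` restricts to `ψ` on `W₁`: the element `w ∈ W₀` acts in the next step as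
`w + f(δ w)`. -/
theorem IsLayer.exists_approx (h : D.IsLayer R W₀ W₁) (ρ : D.A →ₐ[k] Module.End k M)
    (ψ : W₁ →ₗ[k] M →ₗ[k] M) (hψ : IsRBimod R ρ ρ ψ) :
    ∃ (σ : ℕ → D.A →ₐ[k] Module.End k M) (f : ℕ → D.deg 1 →ₗ[k] M →ₗ[k] M),
      (∀ n, ∀ r : D.A, (r : T) ∈ R → σ n r = ρ r) ∧ (∀ n, IsBimod ρ (σ n) (f n)) ∧
      (∀ n, ∀ w : W₁, f n ⟨w, h.W₁_le w.2⟩ = ψ w) ∧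
      ∀ n, ∀ w : D.A, (w : T) ∈ W₀ → σ (n + 1) w = ρ w + f n (D.δA w) := by
  let X := {p : (D.A →ₐ[k] Module.End k M) × (D.deg 1 →ₗ[k] M →ₗ[k] M) //
    (∀ r : D.A, (r : T) ∈ R → p.1 r = ρ r) ∧ IsBimod ρ p.1 p.2 ∧
      ∀ w : W₁, p.2 ⟨w, h.W₁_le w.2⟩ = ψ w}
  have ext : ∀ σ : D.A →ₐ[k] Module.End k M, (∀ r : D.A, (r : T) ∈ R → σ r = ρ r) →
      ∃ x : X, x.1.1 = σ := by
    intro σ hσ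
    obtain ⟨f, hf, hf'⟩ := h.exists_bimod ρ σ ψ fun r hr w w' => by
      rw [hσ r hr]; exact hψ r hr w w'
    exact ⟨⟨⟨σ, f⟩, hσ, hf, hf'⟩, rfl⟩
  have step : ∀ x : X, ∃ y : X,
      ∀ w : D.A, (w : T) ∈ W₀ → y.1.1 w = ρ w + x.1.2 (D.δA w) := by
    rintro ⟨⟨σ, f⟩, hσ, hf, hf'⟩
    have hR : R ≤ D.A := fun x hx => h.R_le hx
    let ψ₀ : W₀ →ₗ[k] Module.End k M :=
      { toFun w := ρ ⟨w, h.W₀_le w.2⟩ + f (D.δA ⟨w, h.W₀_le w.2⟩)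
        map_add' w w' := by
          have : (⟨(w + w' : W₀), h.W₀_le (w + w').2⟩ : D.A) =
            ⟨w, h.W₀_le w.2⟩ + ⟨w', h.W₀_le w'.2⟩ := rfl
          rw [this]
          simp only [map_add]; abel
        map_smul' c w := by
          have : (⟨(c • w : W₀), h.W₀_le (c • w).2⟩ : D.A) = c • ⟨w, h.W₀_le w.2⟩ := rfl
          rw [this]
          simp only [map_smul, RingHom.id_apply, smul_add] }
    have e1 : ∀ (r a : D.A), (r : T) ∈ R →
        f (D.δA (r * a)) = ρ r ∘ₗ f (D.δA a) := by
      intro r a hr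
      rw [δA_mul, δA_R h r hr, map_add, hf, hf, hσ r hr]
      ext; simp
    have e2 : ∀ (r a : D.A), (r : T) ∈ R →
        f (D.δA (a * r)) = f (D.δA a) ∘ₗ ρ r := by
      intro r a hr
      rw [δA_mul, δA_R h r hr, map_add, hf, hf]
      ext; simp
    obtain ⟨σ', h1, h2⟩ := h.exists_rep (ρ.comp (Subalgebra.inclusion hR)) ψ₀
      (fun r w w' => ⟨fun e => by
        have e' : (⟨w', h.W₀_le w'.2⟩ : D.A) = ⟨r, hR r.2⟩ * ⟨w, h.W₀_le w.2⟩ := Subtype.ext e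
        change ρ _ + f (D.δA _) = ρ ⟨r, hR r.2⟩ * (ρ _ + f (D.δA _))
        rw [e', map_mul, e1 _ _ r.2, mul_add]; rfl,
      fun e => by
        have e' : (⟨w', h.W₀_le w'.2⟩ : D.A) = ⟨w, h.W₀_le w.2⟩ * ⟨r, hR r.2⟩ := Subtype.ext e
        change ρ _ + f (D.δA _) = (ρ _ + f (D.δA _)) * ρ ⟨r, hR r.2⟩
        rw [e', map_mul, e2 _ _ r.2, add_mul]; rfl⟩)
    obtain ⟨y, hy⟩ := ext σ' fun r hr => h1 ⟨r, hr⟩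
    exact ⟨y, fun w hw => by rw [hy]; exact h2 ⟨w, hw⟩⟩
  choose nxt hnxt using step
  obtain ⟨x₀, -⟩ := ext ρ fun _ _ => rfl
  let x : ℕ → X := fun n => nxt^[n] x₀
  refine ⟨fun n => (x n).1.1, fun n => (x n).1.2, fun n => (x n).2.1, fun n => (x n).2.2.1,
    fun n => (x n).2.2.2, fun n w hw => ?_⟩
  have : x (n + 1) = nxt (x n) := Function.iterate_succ_apply' _ _ _
  simp only [this]
  exact hnxt (x n) w hw

/-- For a triangular layer, an arbitrary `R`-bimodule map `ψ` on `W₁` is the restriction of the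
second component of a morphism `(id, f)` from `M` to a unique new `A`-module structure on `M`.
The approximations become stationary because `δ(W₀^{i+1}) ⊆ Aᵢ W₁ Aᵢ`. -/
theorem IsLayer.exists_transport (h : D.IsLayer R W₀ W₁) (ht : D.IsTriangularLayer R W₀ W₁)
    (ρ : D.A →ₐ[k] Module.End k M)
    (ψ : W₁ →ₗ[k] M →ₗ[k] M) (hψ : IsRBimod R ρ ρ ψ) :
    ∃ (σ : D.A →ₐ[k] Module.End k M) (f : D.deg 1 →ₗ[k] M →ₗ[k] M),
      IsBimod ρ σ f ∧ (∀ w : W₁, f ⟨w, h.W₁_le w.2⟩ = ψ w) ∧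
      ∀ a : D.A, σ a = ρ a + f (D.δA a) := by
  obtain ⟨σ, f, hσ, hf, hfψ, hs⟩ := h.exists_approx ρ ψ hψ
  obtain ⟨⟨r, F, hF, hF0, hFr, -, hFδ⟩, -⟩ := ht
  have key : ∀ n ≤ r, ∀ w : D.A, (w : T) ∈ F n → σ (n + 1) w = σ n w := by
    intro n
    induction n with
    | zero =>
      intro _ w hw
      rw [hF0, Submodule.mem_bot] at hw
      have : w = 0 := Subtype.ext hw
      rw [this, map_zero, map_zero]
    | succ n ih =>
      intro hn w hw
      have hW : F (n + 1) ≤ W₀ := hFr ▸ hF hn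
      rw [hs _ w (hW hw), hs _ w (hW hw)]
      congr 1
      have hle : Subalgebra.toSubmodule (Algebra.adjoin k ((R : Set T) ∪ F n)) ≤ D.deg 0 := by
        refine le_trans (?_ : _ ≤ Subalgebra.toSubmodule (Algebra.adjoin k ((R : Set T) ∪ W₀)))
          h.adjoin_le
        exact Algebra.adjoin_mono (Set.union_subset_union_right _ ((hF n.le_succ).trans hW))
      have agree : ∀ a : D.A,
          (a : T) ∈ Subalgebra.toSubmodule (Algebra.adjoin k ((R : Set T) ∪ F n)) →
          σ (n + 1) a = σ n a := by
        intro a ha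
        have : Algebra.adjoin k ((R : Set T) ∪ F n) ≤
            (AlgHom.equalizer (σ (n + 1)) (σ n)).map D.A.val := by
          refine Algebra.adjoin_le ?_
          rintro x (hx | hx)
          · refine ⟨⟨x, h.R_le hx⟩, ?_, rfl⟩
            exact (hσ _ _ hx).trans (hσ n _ hx).symm
          · exact ⟨⟨x, h.W₀_le (hW (hF n.le_succ hx))⟩, ih (by omega) _ hx, rfl⟩
        obtain ⟨b, hb, e⟩ := this ha
        rw [← Subtype.ext (a1 := b) (a2 := a) e]
        exact hb
      refine (hf (n + 1)).eq_on (hf n) hle h.W₁_le hle agree (fun _ _ => rfl) (fun v hv => ?_)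
        _ (hFδ n (by omega) ⟨w, hw, rfl⟩)
      exact (hfψ (n + 1) ⟨v, hv⟩).trans (hfψ n ⟨v, hv⟩).symm
  refine ⟨σ r, f r, hf r, hfψ r, fun a => ?_⟩
  -- the right-hand side is multiplicative, since `δ` is a derivation
  let S : Subalgebra k D.A :=
    { carrier := {a | σ r a = ρ a + f r (D.δA a)}
      mul_mem' {a b} ha hb := by
        change σ r (a * b) = ρ (a * b) + f r (D.δA (a * b))
        have ha' : σ r a = ρ a + f r (D.δA a) := ha
        have hb' : σ r b = ρ b + f r (D.δA b) := hb
        rw [δA_mul, map_add, hf, hf, map_mul, map_mul, map_one, map_one]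
        have e : f r (D.δA a) ∘ₗ ρ b = f r (D.δA a) * ρ b := rfl
        have e' : f r (D.δA b) ∘ₗ (1 : Module.End k M) = f r (D.δA b) := LinearMap.comp_id _
        have e'' : (1 : Module.End k M) ∘ₗ f r (D.δA a) ∘ₗ ρ b = f r (D.δA a) * ρ b := rfl
        have e3 : σ r a ∘ₗ f r (D.δA b) = σ r a * f r (D.δA b) := rfl
        rw [e', e'', e3, hb', mul_add, ← add_assoc]
        nth_rewrite 1 [ha']
        rw [add_mul]
      add_mem' {a b} ha hb := by
        change σ r (a + b) = ρ (a + b) + f r (D.δA (a + b))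
        have ha' : σ r a = ρ a + f r (D.δA a) := ha
        have hb' : σ r b = ρ b + f r (D.δA b) := hb
        rw [map_add, ha', hb']
        simp only [map_add]; abel
      algebraMap_mem' c := by
        change σ r (algebraMap k _ c) = ρ (algebraMap k _ c) + f r (D.δA (algebraMap k _ c))
        have : D.δA (algebraMap k D.A c) = 0 :=
          δA_R h _ (R.algebraMap_mem c)
        rw [this, map_zero, add_zero, AlgHom.commutes, AlgHom.commutes] }
  refine h.eq_top_of_mem S (fun x hx => ?_) (fun x hx => ?_) a
  · change σ r x = ρ x + f r (D.δA x)
    rw [δA_R h x hx, map_zero, add_zero, hσ r x hx]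
  · change σ r x = ρ x + f r (D.δA x)
    rw [← hs r x hx, key r le_rfl x (hFr ▸ hx)]

end WeakDitalgebra

namespace TriangularInterlacedDitalgebra

variable {k T : Type u} [Field k] [Ring T] [Algebra k T]
variable {𝒜 : TriangularInterlacedDitalgebra k T}

namespace Mod

/-- The vector space underlying `M` with the new action `σ` of `A`, which annihilates `I`. -/
def ofRep (M : Mod 𝒜) (σ : 𝒜.A →ₐ[k] Module.End k M)
    (hσ : ∀ a : 𝒜.A, (a : T) ∈ 𝒜.I → σ a = 0) : Mod 𝒜 :=
  letI τ : 𝒜.Abar →ₐ[k] Module.End k M := Ideal.Quotient.liftₐ 𝒜.ideal σ hσ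
  letI : Module 𝒜.Abar M.carrier := Module.compHom M.carrier τ.toRingHom
  { carrier := M.carrier
    isScalarTower := ⟨fun c a m => by
      change τ (c • a) m = c • τ a m
      rw [map_smul]; rfl⟩ }

theorem hom_comp_f0 {M N L : Mod 𝒜} (f : M ⟶ N) (g : N ⟶ L) :
    Hom.f0 (f ≫ g) = Hom.f0 g ∘ₗ Hom.f0 f := rfl

theorem hom_comp_f1 {M N L : Mod 𝒜} (f : M ⟶ N) (g : N ⟶ L) (v : 𝒜.deg 1) :
    Hom.f1 (f ≫ g) v = Hom.f0 g ∘ₗ Hom.f1 f v + Hom.f1 g v ∘ₗ Hom.f0 f +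
      Hom.star g f (𝒜.δV v) := rfl

theorem id_f0 (M : Mod 𝒜) : Hom.f0 (𝟙 M) = LinearMap.id := rfl

theorem ofLinear_f0 {M N : Mod 𝒜} (φ : M.carrier →ₗ[𝒜.Abar] N.carrier) :
    Hom.f0 (ofLinear φ) = φ.restrictScalars k := rfl

theorem ofLinear_f1 {M N : Mod 𝒜} (φ : M.carrier →ₗ[𝒜.Abar] N.carrier) :
    Hom.f1 (ofLinear φ) = 0 := rfl

theorem hom_add_f0 {M N : Mod 𝒜} (f g : M ⟶ N) : Hom.f0 (f + g) = Hom.f0 f + Hom.f0 g := rfl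

theorem hom_add_f1 {M N : Mod 𝒜} (f g : M ⟶ N) : Hom.f1 (f + g) = Hom.f1 f + Hom.f1 g := rfl

theorem hom_zero_f0 {M N : Mod 𝒜} : Hom.f0 (0 : M ⟶ N) = 0 := rfl

theorem hom_ext {M N : Mod 𝒜} {f g : M ⟶ N} (h0 : Hom.f0 f = Hom.f0 g)
    (h1 : Hom.f1 f = Hom.f1 g) : f = g := Hom.ext h0 h1

/-- As `δ` vanishes on `R`, first components of morphisms are `R`-linear. -/
theorem hom_f0_R {M N : Mod 𝒜} (f : M ⟶ N) (r : 𝒜.A) (hr : (r : T) ∈ 𝒜.R) (m : M) :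
    N.ρ r (f.f0 m) = f.f0 (M.ρ r m) := by
  rw [f.comm, WeakDitalgebra.δA_R 𝒜.isLayer r hr]
  simp

/-- A morphism is determined by its first component and the restriction of the second one to `W₁`. -/
theorem hom_ext_W₁ {M N : Mod 𝒜} {f g : M ⟶ N} (h0 : Hom.f0 f = Hom.f0 g)
    (h1 : ∀ v : 𝒜.deg 1, (v : T) ∈ 𝒜.W₁ → Hom.f1 f v = Hom.f1 g v) : f = g :=
  hom_ext h0 (𝒜.isLayer.bimod_ext f.bimod g.bimod h1)

/-- A morphism with vanishing second component is a morphism of `A/I`-modules. -/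
theorem eq_ofLinear {M N : Mod 𝒜} (f : M ⟶ N) (h : Hom.f1 f = 0) :
    ∃ φ : M.carrier →ₗ[𝒜.Abar] N.carrier, f = ofLinear φ ∧ ∀ m, φ m = f.f0 m := by
  refine ⟨{ toFun := f.f0, map_add' := map_add _, map_smul' := ?_ }, ?_, fun m => rfl⟩
  · intro a m
    obtain ⟨a, rfl⟩ := Ideal.Quotient.mk_surjective a
    have := f.comm a m
    rw [h] at this
    simpa [ρ_apply] using this.symm
  · exact hom_ext rfl h

/-- The term `(g * f)(δ v)` of a composition vanishes as soon as `f` vanishes on `F` and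
`δ v ∈ A F A F A`. -/
theorem star_eq_zero {M N L : Mod 𝒜} (g : N ⟶ L) (f : M ⟶ N) {F : Submodule k T}
    (hF : F ≤ 𝒜.deg 1) (hf : ∀ v : 𝒜.deg 1, (v : T) ∈ F → Hom.f1 f v = 0) (x : 𝒜.deg 2)
    (hx : (x : T) ∈ 𝒜.deg 0 * F * 𝒜.deg 0 * F * 𝒜.deg 0) : Hom.star g f x = 0 := by
  have mul_le : ∀ i j, 𝒜.deg i * 𝒜.deg j ≤ 𝒜.deg (i + j) := fun i j =>
    Submodule.mul_le.2 fun a ha b hb =>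
      letI := 𝒜.gradedMonoid; SetLike.mul_mem_graded ha hb
  have hX : 𝒜.deg 0 * F ≤ 𝒜.deg 1 := (mul_le_mul_right hF _).trans (mul_le 0 1)
  have hY : 𝒜.deg 0 * F * 𝒜.deg 0 ≤ 𝒜.deg 1 := (mul_le_mul_left hX _).trans (mul_le 1 0)
  have e : 𝒜.deg 0 * F * 𝒜.deg 0 * F * 𝒜.deg 0 = 𝒜.deg 0 * F * (𝒜.deg 0 * F * 𝒜.deg 0) := by
    simp only [mul_assoc]
  rw [e] at hx
  have : 𝒜.deg 0 * F * (𝒜.deg 0 * F * 𝒜.deg 0) ≤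
      (LinearMap.ker (Hom.star g f)).map (𝒜.deg 2).subtype := by
    refine Submodule.mul_le.2 fun p hp q hq =>
      ⟨𝒜.mulVV ⟨p, hX hp⟩ ⟨q, hY hq⟩, ?_, rfl⟩
    change Hom.star g f _ = 0
    rw [Hom.star_mul, f.bimod.eq_zero_on hF hf ⟨q, hY hq⟩ hq, LinearMap.comp_zero]
  obtain ⟨y, hy, ey⟩ := this hx
  rw [← Subtype.ext (a1 := y) (a2 := x) ey]
  exact hy

/-- Every `R`-bimodule map `ψ : W₁ → End_k(M)` is realised by an isomorphism of vector spaces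
`M → M'` underlying a morphism. That `I` annihilates `M'` uses the triangularity of `I`. -/
theorem exists_transport (M : Mod 𝒜) (ψ : 𝒜.W₁ →ₗ[k] M →ₗ[k] M)
    (hψ : WeakDitalgebra.IsRBimod 𝒜.R M.ρ M.ρ ψ) :
    ∃ (M' : Mod 𝒜) (f : M ⟶ M'), Function.Bijective (Hom.f0 f) ∧
      ∀ w : 𝒜.W₁, Hom.f1 f ⟨w, 𝒜.isLayer.W₁_le w.2⟩ = Hom.f0 f ∘ₗ ψ w := by
  obtain ⟨σ, f, hf, hfψ, hc⟩ := 𝒜.isLayer.exists_transport 𝒜.triangularLayer M.ρ ψ hψ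
  have hI : ∀ a : 𝒜.A, (a : T) ∈ 𝒜.I → σ a = 0 := by
    obtain ⟨t, H, hH, hH0, hHt, hHδ⟩ := 𝒜.triangularIdeal
    have key : ∀ n ≤ t, ∀ a : 𝒜.A, (a : T) ∈ H n → σ a = 0 := by
      intro n
      induction n with
      | zero =>
        intro _ a ha
        rw [hH0, Submodule.mem_bot] at ha
        rw [Subtype.ext (a1 := a) (a2 := 0) ha, map_zero]
      | succ n ih =>
        intro hn a ha
        have hle : ∀ m ≤ t, H m ≤ 𝒜.I := fun m hm => hHt ▸ hH hm
        rw [hc, M.ρ_I a (hle _ hn ha), zero_add]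
        have hV : 𝒜.deg 0 * H n * 𝒜.deg 1 ⊔ 𝒜.deg 1 * H n * 𝒜.deg 0 ≤
            (LinearMap.ker f).map (𝒜.deg 1).subtype := by
          refine sup_le ?_ ?_
          · refine Submodule.mul_mul_le fun p hp x hx v hv => ?_
            have hx' : x ∈ 𝒜.deg 0 := 𝒜.interlaced.le (hle n (by omega) hx)
            refine ⟨𝒜.bimul (⟨p, hp⟩ * ⟨x, hx'⟩) ⟨v, hv⟩ 1, ?_, by simp [WeakDitalgebra.bimul]⟩
            change f _ = 0
            rw [hf, map_mul, ih (by omega) ⟨x, hx'⟩ hx, mul_zero, LinearMap.zero_comp]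
          · refine Submodule.mul_mul_le fun v hv x hx p hp => ?_
            have hxI := hle n (by omega) hx
            have hx' : x ∈ 𝒜.deg 0 := 𝒜.interlaced.le hxI
            refine ⟨𝒜.bimul 1 ⟨v, hv⟩ (⟨x, hx'⟩ * ⟨p, hp⟩), ?_,
              by simp [WeakDitalgebra.bimul, mul_assoc]⟩
            change f _ = 0
            rw [hf, map_mul, M.ρ_I ⟨x, hx'⟩ hxI, zero_mul, LinearMap.comp_zero,
              LinearMap.comp_zero]
        obtain ⟨v, hv, e⟩ := hV (hHδ n (by omega) ⟨a, ha, rfl⟩)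
        rw [← Subtype.ext (a1 := v) (a2 := 𝒜.δA a) e]
        exact hv
    exact fun a ha => key t le_rfl a (hHt ▸ ha)
  refine ⟨ofRep M σ hI, ⟨LinearMap.id, f, hf, fun a m => ?_⟩, Function.bijective_id, fun w => ?_⟩
  · change σ a m = M.ρ a m + f (𝒜.δA a) m
    rw [hc]; rfl
  · exact hfψ w

theorem bijective_f0_of_isIso {M N : Mod 𝒜} (f : M ⟶ N) [IsIso f] :
    Function.Bijective (Hom.f0 f) := by
  have h1 : Hom.f0 (inv f) ∘ₗ Hom.f0 f = LinearMap.id := by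
    rw [← hom_comp_f0, IsIso.hom_inv_id, id_f0]
  have h2 : Hom.f0 f ∘ₗ Hom.f0 (inv f) = LinearMap.id := by
    rw [← hom_comp_f0, IsIso.inv_hom_id, id_f0]
  exact ⟨Function.LeftInverse.injective (LinearMap.congr_fun h1),
    Function.RightInverse.surjective (LinearMap.congr_fun h2)⟩

theorem isIso_ofLinear {M N : Mod 𝒜} (φ : M.carrier →ₗ[𝒜.Abar] N.carrier)
    (h : Function.Bijective φ) : IsIso (ofLinear φ : M ⟶ N) := by
  let e := LinearEquiv.ofBijective φ h
  refine ⟨ofLinear e.symm.toLinearMap, ?_, ?_⟩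
  · rw [ofLinear_comp, ← ofLinear_id]
    congr 1
    ext x
    exact e.symm_apply_apply x
  · rw [ofLinear_comp, ← ofLinear_id]
    congr 1
    ext x
    exact e.apply_symm_apply x

theorem isIso_ofLinear_of_eq {M N : Mod 𝒜} (f : M ⟶ N) (h : Function.Bijective (Hom.f0 f))
    (h1 : Hom.f1 f = 0) : IsIso f := by
  obtain ⟨φ, rfl, hφ⟩ := eq_ofLinear f h1
  exact isIso_ofLinear φ h

/-- A morphism with bijective first component has a left inverse. By `exists_transport` one can
compose it with a morphism killing its second component on one more term of the filtration of
`W₁`; in the end only an isomorphism of `A/I`-modules is left. -/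
theorem exists_leftInverse {M N : Mod 𝒜} (h : M ⟶ N) (hb : Function.Bijective (Hom.f0 h)) :
    ∃ g : N ⟶ M, h ≫ g = 𝟙 M := by
  obtain ⟨-, s, F, hF, hF0, hFs, -, hFδ⟩ := 𝒜.triangularLayer
  have hFV : ∀ i ≤ s, F i ≤ 𝒜.deg 1 := fun i hi => (hFs ▸ hF hi).trans 𝒜.isLayer.W₁_le
  suffices key : ∀ d ≤ s, ∀ (N : Mod 𝒜) (h : M ⟶ N), Function.Bijective (Hom.f0 h) →
      (∀ v : 𝒜.deg 1, (v : T) ∈ F (s - d) → Hom.f1 h v = 0) → ∃ g : N ⟶ M, h ≫ g = 𝟙 M by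
    refine key s le_rfl N h hb fun v hv => ?_
    rw [Nat.sub_self, hF0, Submodule.mem_bot] at hv
    rw [Subtype.ext (a1 := v) (a2 := 0) hv, map_zero]
  intro d
  induction d with
  | zero =>
    intro _ N h hb hv
    have h1 : Hom.f1 h = 0 := 𝒜.isLayer.bimod_ext h.bimod
      (WeakDitalgebra.IsBimod.zero M.ρ N.ρ) fun v hv' => hv v (by rw [Nat.sub_zero, hFs]; exact hv')
    have := isIso_ofLinear_of_eq h hb h1
    exact ⟨inv h, IsIso.hom_inv_id h⟩
  | succ d ih =>
    intro hd N h hb hv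
    let e := LinearEquiv.ofBijective (Hom.f0 h) hb
    have he : ∀ n, Hom.f0 h (e.symm n) = n := e.apply_symm_apply
    have he' : ∀ n, e.symm (Hom.f0 h n) = n := e.symm_apply_apply
    have heR : ∀ r : 𝒜.A, (r : T) ∈ 𝒜.R → ∀ n, e.symm (N.ρ r n) = M.ρ r (e.symm n) := by
      intro r hr n
      apply e.injective
      rw [e.apply_symm_apply]
      have := hom_f0_R h r hr (e.symm n)
      rwa [he] at this
    let ψ : 𝒜.W₁ →ₗ[k] N →ₗ[k] N :=
      - (LinearMap.lcomp k N.carrier e.symm.toLinearMap) ∘ₗ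
        (Hom.f1 h ∘ₗ Submodule.inclusion 𝒜.isLayer.W₁_le)
    have hψ : WeakDitalgebra.IsRBimod 𝒜.R N.ρ N.ρ ψ := by
      intro r hr w w'
      have := h.bimod.isRBimod (R := 𝒜.R) 𝒜.isLayer.W₁_le r hr w w'
      refine ⟨fun e1 => ?_, fun e1 => ?_⟩
      · have := this.1 e1
        ext n
        simpa [ψ] using LinearMap.congr_fun this (e.symm n)
      · have := this.2 e1
        ext n
        have := LinearMap.congr_fun this (e.symm n)
        simpa [ψ, heR r hr] using this
    obtain ⟨M', g, hg, hgψ⟩ := exists_transport N ψ hψ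
    obtain ⟨q, hq⟩ := ih (by omega) M' (h ≫ g) (hg.comp hb) fun v hv' => by
      have hlt : s - d = s - (d + 1) + 1 := by omega
      rw [hlt] at hv'
      have hvW : (v : T) ∈ 𝒜.W₁ := hFs ▸ hF (by omega) hv'
      rw [hom_comp_f1, star_eq_zero g h (hFV _ (by omega)) hv _
        (hFδ _ (by omega) ⟨v, hv', rfl⟩), hgψ ⟨v, hvW⟩]
      ext m
      have e1 : ψ ⟨v, hvW⟩ (Hom.f0 h m) = - Hom.f1 h v m := by
        change - Hom.f1 h v (e.symm (Hom.f0 h m)) = _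
        rw [he']
      simp [e1]
    exact ⟨g ≫ q, by rw [← Category.assoc, hq]⟩

theorem isIso_of_bijective {M N : Mod 𝒜} (f : M ⟶ N) (hb : Function.Bijective (Hom.f0 f)) :
    IsIso f := by
  obtain ⟨g, hg⟩ := exists_leftInverse f hb
  have h0 : Hom.f0 g ∘ₗ Hom.f0 f = LinearMap.id := by rw [← hom_comp_f0, hg, id_f0]
  have hgb : Function.Bijective (Hom.f0 g) := by
    constructor
    · intro x y hxy
      obtain ⟨x, rfl⟩ := hb.2 x
      obtain ⟨y, rfl⟩ := hb.2 y
      rw [← LinearMap.comp_apply, ← LinearMap.comp_apply, h0] at hxy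
      exact congrArg _ hxy
    · exact Function.RightInverse.surjective (LinearMap.congr_fun h0)
  obtain ⟨f', hf'⟩ := exists_leftInverse g hgb
  have : f = f' := by
    rw [← Category.comp_id f, ← hf', ← Category.assoc, hg, Category.id_comp]
  exact ⟨g, hg, this ▸ hf'⟩

/-- Up to isomorphism, the second component of an idempotent vanishes: it is removed successively
on the terms of the filtration of `W₁`. If `e¹ = 0` on `W₁^i`, then
`e¹ = e⁰ e¹ + e¹ e⁰` on `W₁^{i+1}`, and there conjugation by a morphism `h` with `h⁰ = id` and
`h¹ = e⁰ e¹ - e¹ e⁰` makes `e¹` vanish. -/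
theorem exists_iso_idempotent (M : Mod 𝒜) (e : M ⟶ M) (he : e ≫ e = e) :
    ∃ (N : Mod 𝒜) (h : M ≅ N), Hom.f1 (h.inv ≫ e ≫ h.hom) = 0 := by
  obtain ⟨-, s, F, hF, hF0, hFs, -, hFδ⟩ := 𝒜.triangularLayer
  have hFV : ∀ i ≤ s, F i ≤ 𝒜.deg 1 := fun i hi => (hFs ▸ hF hi).trans 𝒜.isLayer.W₁_le
  suffices key : ∀ i ≤ s, ∃ (N : Mod 𝒜) (h : M ≅ N),
      ∀ v : 𝒜.deg 1, (v : T) ∈ F i → Hom.f1 (h.inv ≫ e ≫ h.hom) v = 0 by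
    obtain ⟨N, h, hv⟩ := key s le_rfl
    exact ⟨N, h, 𝒜.isLayer.bimod_ext (Hom.bimod _)
      (WeakDitalgebra.IsBimod.zero N.ρ N.ρ) fun v hv' => hv v (hFs ▸ hv')⟩
  intro i
  induction i with
  | zero =>
    intro _
    refine ⟨M, Iso.refl M, fun v hv => ?_⟩
    rw [hF0, Submodule.mem_bot] at hv
    rw [Subtype.ext (a1 := v) (a2 := 0) hv, map_zero]
  | succ i ih =>
    intro hi
    obtain ⟨N, h, hv⟩ := ih (by omega)
    set ε : N ⟶ N := h.inv ≫ e ≫ h.hom with hε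
    have hεε : ε ≫ ε = ε := by
      simp only [hε, Category.assoc, Iso.hom_inv_id_assoc]
      rw [← Category.assoc e e, he]
    have h00 : ∀ n, Hom.f0 ε (Hom.f0 ε n) = Hom.f0 ε n :=
      LinearMap.congr_fun (congrArg Hom.f0 hεε)
    have hεR := hom_f0_R ε
    let ψ : 𝒜.W₁ →ₗ[k] N →ₗ[k] N :=
      ((LinearMap.compRight k (Hom.f0 ε)) - (LinearMap.lcomp k N.carrier (Hom.f0 ε))) ∘ₗ
        (Hom.f1 ε ∘ₗ Submodule.inclusion 𝒜.isLayer.W₁_le)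
    have hψ' : ∀ w n, ψ w n = Hom.f0 ε (Hom.f1 ε ⟨w, 𝒜.isLayer.W₁_le w.2⟩ n) -
      Hom.f1 ε ⟨w, 𝒜.isLayer.W₁_le w.2⟩ (Hom.f0 ε n) := fun w n => rfl
    have hψ : WeakDitalgebra.IsRBimod 𝒜.R N.ρ N.ρ ψ := by
      intro r hr w w'
      have := ε.bimod.isRBimod (R := 𝒜.R) 𝒜.isLayer.W₁_le r hr w w'
      refine ⟨fun e1 => ?_, fun e1 => ?_⟩
      · have h1 : ∀ n, Hom.f1 ε ⟨w', 𝒜.isLayer.W₁_le w'.2⟩ n =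
            N.ρ r (Hom.f1 ε ⟨w, 𝒜.isLayer.W₁_le w.2⟩ n) := LinearMap.congr_fun (this.1 e1)
        ext n
        rw [hψ', LinearMap.comp_apply, hψ', h1, h1, map_sub, hεR r hr]
      · have h1 : ∀ n, Hom.f1 ε ⟨w', 𝒜.isLayer.W₁_le w'.2⟩ n =
            Hom.f1 ε ⟨w, 𝒜.isLayer.W₁_le w.2⟩ (N.ρ r n) := LinearMap.congr_fun (this.2 e1)
        ext n
        rw [hψ', LinearMap.comp_apply, hψ', h1, h1, hεR r hr]
    obtain ⟨N', g, hg, hgψ⟩ := exists_transport N ψ hψ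
    have := isIso_of_bijective g hg
    refine ⟨N', h ≪≫ asIso g, fun v hv' => ?_⟩
    have e1 : (h ≪≫ asIso g).inv ≫ e ≫ (h ≪≫ asIso g).hom = inv g ≫ ε ≫ g := by
      simp [hε]
    rw [e1]
    set ε' := inv g ≫ ε ≫ g with hε'
    have hgε : g ≫ ε' = ε ≫ g := by simp [hε']
    have hvW : (v : T) ∈ 𝒜.W₁ := hFs ▸ hF hi hv'
    have hδ := hFδ i (by omega) ⟨v, hv', rfl⟩
    have hgv : ∀ v : 𝒜.deg 1, (v : T) ∈ F i → Hom.f1 g v = 0 := by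
      intro v hv'
      have hvW : (v : T) ∈ 𝒜.W₁ := hFs ▸ hF (by omega) hv'
      have := hgψ ⟨v, hvW⟩
      refine this.trans ?_
      ext n
      rw [LinearMap.comp_apply, hψ']
      have := hv v hv'
      have h2 : ∀ n, Hom.f1 ε ⟨v, 𝒜.isLayer.W₁_le hvW⟩ n = 0 := LinearMap.congr_fun this
      simp [h2]
    have A : ∀ n, Hom.f0 ε (Hom.f1 ε v n) + Hom.f1 ε v (Hom.f0 ε n) = Hom.f1 ε v n := by
      intro n
      have := congrArg (fun f => Hom.f1 f v n) hεε
      simpa [hom_comp_f1, star_eq_zero ε ε (hFV i (by omega)) hv (𝒜.δV v) hδ] using this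
    have A0 : ∀ n, Hom.f0 ε (Hom.f1 ε v (Hom.f0 ε n)) = 0 := by
      intro n
      have := A (Hom.f0 ε n)
      rw [h00] at this
      simpa using this
    have B : ∀ n, Hom.f0 ε' (Hom.f1 g v n) + Hom.f1 ε' v (Hom.f0 g n) =
        Hom.f0 g (Hom.f1 ε v n) + Hom.f1 g v (Hom.f0 ε n) := by
      intro n
      have := congrArg (fun f => Hom.f1 f v n) hgε
      simpa [hom_comp_f1, star_eq_zero ε' g (hFV i (by omega)) hgv (𝒜.δV v) hδ,
        star_eq_zero g ε (hFV i (by omega)) hv (𝒜.δV v) hδ] using this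
    have C0 : ∀ n, Hom.f0 ε' (Hom.f0 g n) = Hom.f0 g (Hom.f0 ε n) :=
      LinearMap.congr_fun (congrArg Hom.f0 hgε)
    have hgv' : ∀ n, Hom.f1 g v n =
        Hom.f0 g (Hom.f0 ε (Hom.f1 ε v n) - Hom.f1 ε v (Hom.f0 ε n)) :=
      LinearMap.congr_fun (hgψ ⟨v, hvW⟩)
    ext n'
    obtain ⟨n, rfl⟩ := hg.2 n'
    have := B n
    rw [hgv', hgv', C0] at this
    rw [LinearMap.zero_apply]
    have e3 := eq_sub_of_add_eq' this
    rw [e3]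
    have e4 := eq_sub_of_add_eq (A n)
    have e5 := congrArg (Hom.f0 g) e4
    rw [map_sub] at e5
    simp only [map_sub, h00, A0, map_zero]
    rw [e5]
    abel

/-- An idempotent with vanishing second component splits through its image. -/
instance : IsIdempotentComplete (Mod 𝒜) where
  idempotents_split M p hp := by
    obtain ⟨N, h, h1⟩ := exists_iso_idempotent M p hp
    obtain ⟨φ, hφ, -⟩ := eq_ofLinear _ h1
    have hφφ : φ ∘ₗ φ = φ := by
      have : (ofLinear (φ ∘ₗ φ) : N ⟶ N) = ofLinear φ := by
        rw [← ofLinear_comp, ← hφ]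
        simp only [Category.assoc, Iso.hom_inv_id_assoc]
        rw [← Category.assoc p p, hp]
      ext x
      exact LinearMap.congr_fun (congrArg Hom.f0 this) x
    refine ⟨of 𝒜 (LinearMap.range φ), ofLinear (LinearMap.range φ).subtype ≫ h.inv,
      h.hom ≫ ofLinear φ.rangeRestrict, ?_, ?_⟩
    · simp only [Category.assoc, Iso.inv_hom_id_assoc]
      rw [ofLinear_comp]
      refine Eq.trans ?_ (ofLinear_id _)
      congr 1
      ext ⟨x, y, rfl⟩
      exact LinearMap.congr_fun hφφ y
    · have : (ofLinear φ.rangeRestrict : N ⟶ of 𝒜 (LinearMap.range φ)) ≫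
          (ofLinear (LinearMap.range φ).subtype : of 𝒜 (LinearMap.range φ) ⟶ N) = ofLinear φ :=
        ofLinear_comp _ _
      rw [Category.assoc, ← Category.assoc (ofLinear _) (ofLinear _), this, ← hφ]
      simp

end Mod

end TriangularInterlacedDitalgebra

/-! ### Endomorphisms of indecomposable objects -/

/-- Fitting's lemma for a finite-dimensional algebra without nontrivial idempotents. -/
theorem isNilpotent_or_isUnit_of_idempotents {k E : Type*} [Field k] [Ring E] [Algebra k E]
    [Module.Finite k E] (h : ∀ p : E, p * p = p → p = 0 ∨ p = 1) (x : E) :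
    IsNilpotent x ∨ IsUnit x := by
  obtain ⟨n, hn⟩ := Filter.eventually_atTop.1
    (LinearMap.eventually_isCompl_ker_pow_range_pow (LinearMap.mulLeft k x))
  have hc := hn (n + 1) n.le_succ
  rw [LinearMap.pow_mulLeft] at hc
  obtain ⟨a, ha, b, hb, hab⟩ := Submodule.mem_sup.1 (hc.sup_eq_top ▸ Submodule.mem_top (x := (1 : E)))
  obtain ⟨c, rfl⟩ := hb
  rw [LinearMap.mem_ker, LinearMap.mulLeft_apply] at ha
  rw [LinearMap.mulLeft_apply] at hab
  have haa : a * a = a := by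
    have e : a - a * a = x ^ (n + 1) * c * a := by
      have := congrArg (· * a) hab
      simp only [add_mul, one_mul] at this
      rw [← eq_sub_iff_add_eq'] at this
      exact this.symm
    have h1 : a - a * a ∈ LinearMap.ker (LinearMap.mulLeft k (x ^ (n + 1))) := by
      rw [LinearMap.mem_ker, LinearMap.mulLeft_apply, mul_sub, ← mul_assoc, ha, zero_mul, sub_zero]
    have h2 : a - a * a ∈ LinearMap.range (LinearMap.mulLeft k (x ^ (n + 1))) :=
      ⟨c * a, by rw [e, LinearMap.mulLeft_apply, mul_assoc]⟩
    have := hc.disjoint.le_bot ⟨h1, h2⟩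
    exact (sub_eq_zero.1 this).symm
  rcases h a haa with rfl | rfl
  · right
    rw [zero_add, pow_succ', mul_assoc] at hab
    have hs : Function.Surjective (LinearMap.mulLeft k x) := fun y =>
      ⟨x ^ n * c * y, by rw [LinearMap.mulLeft_apply, ← mul_assoc, hab, one_mul]⟩
    have hi := LinearMap.injective_iff_surjective.2 hs
    refine ⟨⟨x, x ^ n * c, hab, hi ?_⟩, rfl⟩
    rw [LinearMap.mulLeft_apply, LinearMap.mulLeft_apply, ← mul_assoc, hab, one_mul, mul_one]
  · left
    exact ⟨n + 1, by rwa [mul_one] at ha⟩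

namespace CategoryTheory

variable {C : Type*} [Category C] [Preadditive C]

/-- Every endomorphism of `X` is nilpotent or invertible. -/
def NilpotentOrIso (X : C) : Prop := ∀ f : End X, IsNilpotent f ∨ IsUnit f

theorem NilpotentOrIso.idempotent {X : C} (h : NilpotentOrIso X) (p : X ⟶ X) (hp : p ≫ p = p) :
    p = 0 ∨ p = 𝟙 X := by
  rcases h p with ⟨n, hn⟩ | hu
  · left
    have : ∀ n : ℕ, (show End X from p) ^ (n + 1) = p := by
      intro n
      induction n with
      | zero => exact pow_one _
      | succ n ih => rw [pow_succ, ih]; exact hp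
    rw [← this n, pow_succ, hn, zero_mul]
  · right
    let q : End X := p
    have : q * q = q * 1 := by rw [mul_one]; exact hp
    exact IsUnit.mul_left_cancel (a := q) hu this

theorem NilpotentOrIso.of_idempotents (k : Type*) [Field k] [Linear k C] {X : C}
    [Module.Finite k (End X)] (h : ∀ p : X ⟶ X, p ≫ p = p → p = 0 ∨ p = 𝟙 X) :
    NilpotentOrIso X :=
  isNilpotent_or_isUnit_of_idempotents (k := k) (E := End X) h

/-- If an endomorphism of `Y` factoring through `X` acts as the identity after composition with
some nonzero `ϖ : Y ⟶ Z`, then `Y` is a retract of `X`. -/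
theorem NilpotentOrIso.exists_retract {X Y Z : C} (h : NilpotentOrIso Y) (s : Y ⟶ X) (t : X ⟶ Y)
    (ϖ : Y ⟶ Z) (hϖ : ϖ ≠ 0) (e : s ≫ t ≫ ϖ = ϖ) : ∃ t' : X ⟶ Y, s ≫ t' = 𝟙 Y := by
  rcases h (s ≫ t) with ⟨n, hn⟩ | hu
  · exfalso
    apply hϖ
    have : ∀ n : ℕ, ((show End Y from s ≫ t) ^ n : Y ⟶ Y) ≫ ϖ = ϖ := by
      intro n
      induction n with
      | zero => exact Category.id_comp _
      | succ n ih =>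
        rw [pow_succ']
        change (((show End Y from s ≫ t) ^ n : Y ⟶ Y) ≫ (s ≫ t)) ≫ ϖ = ϖ
        rw [Category.assoc, Category.assoc, e, ih]
    rw [← this n, hn]
    exact zero_comp
  · obtain ⟨v, hv⟩ := hu.exists_left_inv
    exact ⟨t ≫ v, by rw [← Category.assoc]; exact hv⟩

section

variable [HasBinaryBiproducts C]

/-- A retract with a complementary retract gives a biproduct decomposition. -/
def isoBiprodOfSplit {X Y Z : C} (s : Y ⟶ X) (t : X ⟶ Y) (h : s ≫ t = 𝟙 Y) (i : Z ⟶ X) (p : X ⟶ Z)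
    (h' : i ≫ p = 𝟙 Z) (e : t ≫ s + p ≫ i = 𝟙 X) : X ≅ Y ⊞ Z :=
  have e1 : s ≫ p = 0 := by
    have := congrArg (fun f => s ≫ f ≫ p) e
    simp only [Preadditive.add_comp, Preadditive.comp_add, Category.assoc, h', Category.comp_id,
      Category.id_comp, reassoc_of% h] at this
    simpa using this
  have e2 : i ≫ t = 0 := by
    have := congrArg (fun f => i ≫ f ≫ t) e
    simp only [Preadditive.add_comp, Preadditive.comp_add, Category.assoc, h, Category.comp_id,
      Category.id_comp, reassoc_of% h'] at this
    simpa using this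
  { hom := biprod.lift t p
    inv := biprod.desc s i
    hom_inv_id := by rw [biprod.lift_desc, e]
    inv_hom_id := by
      ext <;> simp [h, h', e1, e2] }

theorem exists_iso_biprod_of_retract [IsIdempotentComplete C] {X Y : C} (s : Y ⟶ X) (t : X ⟶ Y)
    (h : s ≫ t = 𝟙 Y) : ∃ Z : C, Nonempty (X ≅ Y ⊞ Z) := by
  have hp : (t ≫ s) ≫ (t ≫ s) = t ≫ s := by simp [reassoc_of% h]
  obtain ⟨Z, i, p, h1, h2⟩ := IsIdempotentComplete.idempotents_split X (𝟙 X - t ≫ s)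
    (Idempotents.idem_of_id_sub_idem _ hp)
  exact ⟨Z, ⟨isoBiprodOfSplit s t h i p h1 (by rw [h2]; abel)⟩⟩

theorem Indecomposable.idempotent [IsIdempotentComplete C] {X : C} (hX : Indecomposable X)
    (p : X ⟶ X) (hp : p ≫ p = p) : p = 0 ∨ p = 𝟙 X := by
  obtain ⟨Y, s, t, h, e⟩ := IsIdempotentComplete.idempotents_split X p hp
  obtain ⟨Z, i, q, h', e'⟩ := IsIdempotentComplete.idempotents_split X (𝟙 X - p)
    (Idempotents.idem_of_id_sub_idem _ hp)
  rcases hX.2 Y Z (isoBiprodOfSplit s t h i q h' (by rw [e, e']; abel)) with hz | hz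
  · left
    rw [← e, hz.eq_zero_of_src s, comp_zero]
  · right
    rw [hz.eq_zero_of_src i, comp_zero] at e'
    exact (sub_eq_zero.1 e'.symm).symm

theorem Indecomposable.nilpotentOrIso (k : Type*) [Field k] [Linear k C] [IsIdempotentComplete C]
    {X : C} (hX : Indecomposable X) [Module.Finite k (End X)] : NilpotentOrIso X :=
  NilpotentOrIso.of_idempotents k hX.idempotent

theorem NilpotentOrIso.indecomposable {X : C} (h : NilpotentOrIso X) (hX : ¬ IsZero X) :
    Indecomposable X := by
  refine ⟨hX, fun Y Z a => ?_⟩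
  rcases h.idempotent (a.hom ≫ biprod.fst ≫ biprod.inl ≫ a.inv) (by simp) with e | e
  · left
    rw [IsZero.iff_id_eq_zero]
    have := congrArg (fun f => biprod.inl ≫ a.inv ≫ f ≫ a.hom ≫ biprod.fst) e
    simpa using this
  · right
    rw [IsZero.iff_id_eq_zero]
    have := congrArg (fun f => biprod.inr ≫ a.inv ≫ f ≫ a.hom ≫ biprod.snd) e
    simpa using this.symm

/-- Two indecomposable objects with compatible maps between them over a common nonzero map to `Z`
are isomorphic. -/
theorem NilpotentOrIso.nonempty_iso [IsIdempotentComplete C] {X Y Z : C} (h : NilpotentOrIso Y)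
    (hX : Indecomposable X) (s : Y ⟶ X) (t : X ⟶ Y) (ϖ : Y ⟶ Z) (hϖ : ϖ ≠ 0)
    (e : s ≫ t ≫ ϖ = ϖ) : Nonempty (X ≅ Y) := by
  obtain ⟨t', ht⟩ := h.exists_retract s t ϖ hϖ e
  rcases hX.idempotent (t' ≫ s) (by simp [reassoc_of% ht]) with h0 | h1
  · exfalso
    apply hϖ
    have : s ≫ (t' ≫ s) ≫ t' = 𝟙 Y := by simp [ht]
    rw [h0, zero_comp, comp_zero] at this
    rw [← Category.id_comp ϖ, ← this, zero_comp]
  · exact ⟨⟨t', s, h1, ht⟩⟩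

/-- Splitting off the first summand of a finite biproduct. -/
def biproductFinSucc [HasFiniteBiproducts C] {n : ℕ} (f : Fin (n + 1) → C) :
    (⨁ f) ≅ f 0 ⊞ ⨁ fun l => f (Fin.succ l) :=
  isoBiprodOfSplit (biproduct.ι f 0) (biproduct.π f 0) (by simp)
    (biproduct.desc fun l => biproduct.ι f (Fin.succ l))
    (biproduct.lift fun l => biproduct.π f (Fin.succ l))
    (by
      ext i j
      by_cases h : j = i
      · subst h; simp
      · simp [biproduct.ι_π_ne f (fun e => h (Fin.succ_injective _ e)), biproduct.ι_π_ne _ h])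
    (by
      rw [biproduct.lift_desc, ← biproduct.total, Fin.sum_univ_succ])

end

end CategoryTheory

/-! ### Morphisms out of the regular object -/

namespace TriangularInterlacedDitalgebra

variable {k T : Type u} [Field k] [Ring T] [Algebra k T] {J : Type v}
variable {𝒜 : TriangularInterlacedDitalgebra k T}

namespace Mod

/-- Second components of morphisms vanish on `δ(I) ⊆ I V + V I`. -/
theorem bimod_δA_I {M N : Mod 𝒜} {f : 𝒜.deg 1 →ₗ[k] M →ₗ[k] N}
    (hf : WeakDitalgebra.IsBimod M.ρ N.ρ f) (a : 𝒜.A) (ha : (a : T) ∈ 𝒜.I) : f (𝒜.δA a) = 0 := by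
  have hV : 𝒜.I * 𝒜.deg 1 ⊔ 𝒜.deg 1 * 𝒜.I ≤ (LinearMap.ker f).map (𝒜.deg 1).subtype := by
    refine sup_le ?_ ?_
    · refine Submodule.mul_le.2 fun x hx v hv => ?_
      have hx' : x ∈ 𝒜.A := 𝒜.interlaced.le hx
      refine ⟨𝒜.bimul ⟨x, hx'⟩ ⟨v, hv⟩ 1, ?_, by simp [WeakDitalgebra.bimul]⟩
      change f _ = 0
      rw [hf, N.ρ_I ⟨x, hx'⟩ hx, LinearMap.zero_comp]
    · refine Submodule.mul_le.2 fun v hv x hx => ?_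
      have hx' : x ∈ 𝒜.A := 𝒜.interlaced.le hx
      refine ⟨𝒜.bimul 1 ⟨v, hv⟩ ⟨x, hx'⟩, ?_, by simp [WeakDitalgebra.bimul]⟩
      change f _ = 0
      rw [hf, M.ρ_I ⟨x, hx'⟩ hx, LinearMap.comp_zero, LinearMap.comp_zero]
  obtain ⟨v, hv, e⟩ := hV (𝒜.interlaced.δ_I ⟨a, ha, rfl⟩)
  rw [← Subtype.ext (a1 := v) (a2 := 𝒜.δA a) e]
  exact hv

theorem regular_ρ (a : 𝒜.A) (x : 𝒜.regular) :
    𝒜.regular.ρ a x = (Ideal.Quotient.mk 𝒜.ideal a * x : 𝒜.Abar) := rfl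

/-- The first component of a morphism out of `A/I` is determined by its value at `1` and the second
component. -/
theorem regular_f0 {N : Mod 𝒜} (h : 𝒜.regular ⟶ N) (a : 𝒜.A) :
    Hom.f0 h (Ideal.Quotient.mk 𝒜.ideal a) =
      N.ρ a (Hom.f0 h (1 : 𝒜.Abar)) - Hom.f1 h (𝒜.δA a) (1 : 𝒜.Abar) := by
  have := h.comm a (1 : 𝒜.Abar)
  rw [this, regular_ρ, mul_one, add_sub_cancel_right]

theorem regular_hom_ext {N : Mod 𝒜} {h h' : 𝒜.regular ⟶ N}
    (h0 : Hom.f0 h (1 : 𝒜.Abar) = Hom.f0 h' (1 : 𝒜.Abar))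
    (h1 : ∀ v : 𝒜.deg 1, (v : T) ∈ 𝒜.W₁ → Hom.f1 h v = Hom.f1 h' v) : h = h' := by
  have e : Hom.f1 h = Hom.f1 h' := 𝒜.isLayer.bimod_ext h.bimod h'.bimod h1
  refine hom_ext (LinearMap.ext fun x => ?_) e
  obtain ⟨a, rfl⟩ := Ideal.Quotient.mk_surjective (I := 𝒜.ideal) x
  rw [regular_f0, regular_f0, h0, e]

/-- A morphism `h` out of the regular object is given by the element `h⁰(1)` and by an arbitrary
morphism `h¹` of `R`-bimodules on `W₁`. -/
theorem exists_regular_hom {N : Mod 𝒜} (n : N) (ψ : 𝒜.W₁ →ₗ[k] 𝒜.Abar →ₗ[k] N)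
    (hψ : WeakDitalgebra.IsRBimod 𝒜.R 𝒜.regular.ρ N.ρ ψ) :
    ∃ h : 𝒜.regular ⟶ N, Hom.f0 h (1 : 𝒜.Abar) = n ∧
      ∀ w : 𝒜.W₁, Hom.f1 h ⟨w, 𝒜.isLayer.W₁_le w.2⟩ = ψ w := by
  obtain ⟨f, hf, hfψ⟩ := 𝒜.isLayer.exists_bimod 𝒜.regular.ρ N.ρ ψ hψ
  let g : 𝒜.A →ₗ[k] N :=
    (LinearMap.applyₗ n ∘ₗ N.ρ.toLinearMap) - (LinearMap.applyₗ (1 : 𝒜.Abar) ∘ₗ f ∘ₗ 𝒜.δA)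
  have hg : ∀ a, g a = N.ρ a n - f (𝒜.δA a) (1 : 𝒜.Abar) := fun a => rfl
  have hgI : ∀ a : 𝒜.A, a ∈ 𝒜.ideal → g a = 0 := fun a ha => by
    rw [hg, N.ρ_I a ha, bimod_δA_I hf a ha]; simp
  obtain ⟨s, hs⟩ := LinearMap.exists_rightInverse_of_surjective
    (Ideal.Quotient.mkₐ k 𝒜.ideal).toLinearMap
    (LinearMap.range_eq_top.2 (Ideal.Quotient.mk_surjective (I := 𝒜.ideal)))
  have hf0 : ∀ a : 𝒜.A, (g ∘ₗ s) (Ideal.Quotient.mk 𝒜.ideal a) = g a := by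
    intro a
    rw [LinearMap.comp_apply, ← sub_eq_zero, ← map_sub]
    apply hgI
    rw [← Ideal.Quotient.eq_zero_iff_mem, map_sub, sub_eq_zero]
    exact LinearMap.congr_fun hs (Ideal.Quotient.mk 𝒜.ideal a)
  refine ⟨⟨g ∘ₗ s, f, hf, fun a x => ?_⟩, ?_, hfψ⟩
  · obtain ⟨b, rfl⟩ := Ideal.Quotient.mk_surjective (I := 𝒜.ideal) x
    rw [regular_ρ, ← map_mul, hf0, hf0, hg, hg, WeakDitalgebra.δA_mul, map_add, hf, hf]
    have e1 : 𝒜.regular.ρ b (1 : 𝒜.Abar) = Ideal.Quotient.mk 𝒜.ideal b := mul_one _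
    simp only [map_sub, map_mul, map_one, LinearMap.add_apply, LinearMap.comp_apply,
      Module.End.mul_apply, Module.End.one_apply, e1]
    abel
  · have e : ((g ∘ₗ s) (1 : 𝒜.Abar)) = g 1 := hf0 1
    change (g ∘ₗ s) (1 : 𝒜.Abar) = n
    rw [e, hg, WeakDitalgebra.δA_R 𝒜.isLayer 1 (one_mem 𝒜.R)]
    simp

theorem star_ofLinear_left {M N L : Mod 𝒜} (φ : N.carrier →ₗ[𝒜.Abar] L.carrier) (f : M ⟶ N) :
    Hom.star (ofLinear φ) f = 0 :=
  Hom.star_unique (ofLinear φ) f 0 fun _ _ => LinearMap.ext fun _ => rfl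

theorem star_ofLinear_right {M N L : Mod 𝒜} (φ : M.carrier →ₗ[𝒜.Abar] N.carrier) (f : N ⟶ L) :
    Hom.star f (ofLinear φ) = 0 :=
  Hom.star_unique f (ofLinear φ) 0 fun v _ => LinearMap.ext fun _ => (map_zero (Hom.f1 f v)).symm

theorem comp_ofLinear_f1 {M N L : Mod 𝒜} (f : M ⟶ N) (φ : N.carrier →ₗ[𝒜.Abar] L.carrier)
    (v : 𝒜.deg 1) (m : M) : Hom.f1 (f ≫ ofLinear φ) v m = φ (Hom.f1 f v m) := by
  rw [hom_comp_f1, star_ofLinear_left,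
    ofLinear_f1]
  simp [ofLinear_f0]

theorem ofLinear_comp_f1 {M N L : Mod 𝒜} (φ : M.carrier →ₗ[𝒜.Abar] N.carrier) (f : N ⟶ L)
    (v : 𝒜.deg 1) (m : M) : Hom.f1 (ofLinear φ ≫ f) v m = Hom.f1 f v (φ m) := by
  rw [hom_comp_f1, star_ofLinear_right,
    ofLinear_f1]
  simp [ofLinear_f0]

/-- `s` is a section of `φ` commuting with the action of `R`. -/
def IsRSection {E N : Mod 𝒜} (φ : E.carrier →ₗ[𝒜.Abar] N.carrier) (s : N →ₗ[k] E) : Prop :=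
  (∀ n, φ (s n) = n) ∧ ∀ a : 𝒜.A, (a : T) ∈ 𝒜.R → ∀ n, s (N.ρ a n) = E.ρ a (s n)

/-- The object `A/I` has the lifting property for maps that split over `R`. -/
theorem exists_lift_regular {E N : Mod 𝒜} (φ : E.carrier →ₗ[𝒜.Abar] N.carrier) (s : N →ₗ[k] E)
    (hs : IsRSection φ s) (h : 𝒜.regular ⟶ N) : ∃ h' : 𝒜.regular ⟶ E, h' ≫ ofLinear φ = h := by
  let ψ : 𝒜.W₁ →ₗ[k] 𝒜.Abar →ₗ[k] E :=
    (LinearMap.compRight k s) ∘ₗ (Hom.f1 h ∘ₗ Submodule.inclusion 𝒜.isLayer.W₁_le)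
  have hψ' : ∀ w x, ψ w x = s (Hom.f1 h ⟨w, 𝒜.isLayer.W₁_le w.2⟩ x) := fun _ _ => rfl
  have hψ : WeakDitalgebra.IsRBimod 𝒜.R 𝒜.regular.ρ E.ρ ψ := by
    intro r hr w w'
    have := h.bimod.isRBimod (R := 𝒜.R) 𝒜.isLayer.W₁_le r hr w w'
    refine ⟨fun e1 => ?_, fun e1 => ?_⟩
    · have h1 : ∀ x, Hom.f1 h ⟨w', 𝒜.isLayer.W₁_le w'.2⟩ x =
          N.ρ r (Hom.f1 h ⟨w, 𝒜.isLayer.W₁_le w.2⟩ x) := LinearMap.congr_fun (this.1 e1)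
      refine LinearMap.ext fun x => ?_
      rw [hψ', h1, LinearMap.comp_apply, hψ', hs.2 r hr]
    · have h1 : ∀ x, Hom.f1 h ⟨w', 𝒜.isLayer.W₁_le w'.2⟩ x =
          Hom.f1 h ⟨w, 𝒜.isLayer.W₁_le w.2⟩ (𝒜.regular.ρ r x) := LinearMap.congr_fun (this.2 e1)
      refine LinearMap.ext fun x => ?_
      rw [hψ', h1, LinearMap.comp_apply, hψ']
  obtain ⟨h', h0, h1⟩ := exists_regular_hom (s (Hom.f0 h (1 : 𝒜.Abar))) ψ hψ
  refine ⟨h', regular_hom_ext ?_ fun v hv => ?_⟩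
  · change φ (Hom.f0 h' (1 : 𝒜.Abar)) = _
    rw [h0, hs.1]
  · refine LinearMap.ext fun x => ?_
    have h2 : Hom.f1 h' v x = ψ ⟨v, hv⟩ x := LinearMap.congr_fun (h1 ⟨v, hv⟩) x
    rw [comp_ofLinear_f1, h2, hψ', hs.1]

/-- A morphism whose components take values in the image of an injective `φ` factors through
`(φ, 0)`. -/
theorem exists_factor_of_range {M K E : Mod 𝒜} (φ : K.carrier →ₗ[𝒜.Abar] E.carrier)
    (hφ : Function.Injective φ) (f : M ⟶ E) (h0 : ∀ m, Hom.f0 f m ∈ LinearMap.range φ)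
    (h1 : ∀ v m, Hom.f1 f v m ∈ LinearMap.range φ) : ∃ f' : M ⟶ K, f' ≫ ofLinear φ = f := by
  choose g0 hg0 using h0
  choose g1 hg1 using h1
  let f' : Hom M K :=
    { f0 :=
        { toFun := g0
          map_add' x y := hφ (by rw [map_add, hg0, hg0, hg0, map_add])
          map_smul' c x := hφ (by
            rw [RingHom.id_apply, LinearMap.map_smul_of_tower, hg0, hg0, map_smul]) }
      f1 :=
        { toFun v :=
            { toFun := g1 v
              map_add' x y := hφ (by rw [map_add, hg1, hg1, hg1, map_add])
              map_smul' c x := hφ (by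
                rw [RingHom.id_apply, LinearMap.map_smul_of_tower, hg1, hg1, map_smul]) }
          map_add' v w := LinearMap.ext fun x => hφ (by
            change φ (g1 (v + w) x) = φ (g1 v x + g1 w x)
            rw [map_add, hg1, hg1, hg1, map_add]; rfl)
          map_smul' c v := LinearMap.ext fun x => hφ (by
            change φ (g1 (c • v) x) = φ (c • g1 v x)
            rw [LinearMap.map_smul_of_tower, hg1, hg1, map_smul]; rfl) }
      bimod a v b := LinearMap.ext fun x => hφ (by
        change φ (g1 _ x) = φ (K.ρ a (g1 v (M.ρ b x)))
        rw [hg1, ← ρ_map, hg1, f.bimod]; rfl)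
      comm a m := hφ (by
        change φ (K.ρ a (g0 m)) = φ (g0 (M.ρ a m) + g1 _ m)
        rw [map_add, ← ρ_map, hg0, hg0, hg1, f.comm]) }
  exact ⟨f', hom_ext (LinearMap.ext hg0)
    (LinearMap.ext fun v => LinearMap.ext fun m =>
      (comp_ofLinear_f1 (f := f') φ v m).trans (hg1 v m))⟩

/-- The morphism `(x ↦ x m, 0)` from the regular object. -/
def ofElement {M : Mod 𝒜} (m : M) : 𝒜.regular ⟶ M :=
  ofLinear (LinearMap.toSpanSingleton 𝒜.Abar M.carrier m)

variable {M N : Mod 𝒜}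

theorem ofElement_f0 (m : M) (b : 𝒜.Abar) : Hom.f0 (ofElement m) b = b • m := rfl

theorem ofElement_add (m m' : M) : ofElement (m + m') = ofElement m + ofElement m' := by
  rw [ofElement, ofElement, ofElement, ← ofLinear_add]
  exact congrArg ofLinear (LinearMap.ext fun x => smul_add (x : 𝒜.Abar) m m')

theorem ofElement_smul (c : k) (m : M) : ofElement (c • m) = c • ofElement m :=
  hom_ext (LinearMap.ext fun x => by
    change (x : 𝒜.Abar) • c • m = c • (x : 𝒜.Abar) • m
    obtain ⟨a, rfl⟩ := Ideal.Quotient.mk_surjective (I := 𝒜.ideal) x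
    exact map_smul (M.ρ a) c m) (smul_zero c).symm

theorem ofElement_comp_ofLinear (m : M) (φ : M.carrier →ₗ[𝒜.Abar] N.carrier) :
    ofElement m ≫ ofLinear φ = ofElement (φ m) := by
  rw [ofElement, ofLinear_comp, ofElement]
  exact congrArg ofLinear (LinearMap.ext fun x => map_smul φ (x : 𝒜.Abar) m)

theorem rightMul_comp_ofElement (b : 𝒜.Abar) (m : M) :
    𝒜.rightMul b ≫ ofElement m = ofElement (b • m) := ofElement_comp_ofLinear _ _

theorem ofElement_comp_f0 (m : M) (f : M ⟶ N) :
    Hom.f0 (ofElement m ≫ f) (1 : 𝒜.Abar) = Hom.f0 f m := by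
  rw [hom_comp_f0, LinearMap.comp_apply, ofElement_f0, one_smul]

theorem ofElement_comp_f1 (m : M) (f : M ⟶ N) (v : 𝒜.deg 1) :
    Hom.f1 (ofElement m ≫ f) v (1 : 𝒜.Abar) = Hom.f1 f v m := by
  rw [ofElement, ofLinear_comp_f1, LinearMap.toSpanSingleton_apply, one_smul]

end Mod

/-! ### The idempotents of a strict ditalgebra -/

variable [Fintype J] [Preorder J] {e : J → 𝒜.A}

theorem IsStrict.e_mem_R (h : 𝒜.IsStrict e) (i : J) : (e i : T) ∈ 𝒜.R := by
  have : (e i : T) ∈ Subalgebra.toSubmodule 𝒜.R := by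
    rw [h.R_eq]; exact Submodule.subset_span ⟨i, rfl⟩
  exact this

namespace Mod

theorem sum_ρ (h : 𝒜.IsStrict e) (M : Mod 𝒜) (m : M) : ∑ i, M.ρ (e i) m = m := by
  rw [← LinearMap.sum_apply, ← map_sum, h.idempotents.complete, map_one]
  rfl

theorem ρ_ρ_same (h : 𝒜.IsStrict e) (M : Mod 𝒜) (i : J) (m : M) :
    M.ρ (e i) (M.ρ (e i) m) = M.ρ (e i) m := by
  rw [← Module.End.mul_apply, ← map_mul, h.idempotents.idem i]

theorem ρ_ρ_ne (h : 𝒜.IsStrict e) (M : Mod 𝒜) {i j : J} (hij : i ≠ j) (m : M) :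
    M.ρ (e i) (M.ρ (e j) m) = 0 := by
  rw [← Module.End.mul_apply, ← map_mul, h.idempotents.ortho hij, map_zero]
  rfl

theorem comm_R_of_comm_e (h : 𝒜.IsStrict e) {M N : Mod 𝒜} (f : M →ₗ[k] N)
    (hf : ∀ i m, f (M.ρ (e i) m) = N.ρ (e i) (f m)) (a : 𝒜.A) (ha : (a : T) ∈ 𝒜.R) (m : M) :
    f (M.ρ a m) = N.ρ a (f m) := by
  have ha' : (a : T) ∈ Submodule.span k (Set.range fun i => (e i : T)) := by
    rw [← h.R_eq]; exact ha
  obtain ⟨c, hc⟩ := (Submodule.mem_span_range_iff_exists_fun k).1 ha'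
  have : a = ∑ i, c i • e i := by
    apply Subtype.ext
    rw [← hc]
    simp
  subst this
  simp only [map_sum, map_smul, LinearMap.sum_apply, LinearMap.smul_apply, hf]

/-- As `R` is semisimple, every surjection of `A/I`-modules splits over `R`. -/
theorem exists_rSection (h : 𝒜.IsStrict e) {E N : Mod 𝒜} (φ : E.carrier →ₗ[𝒜.Abar] N.carrier)
    (hφ : Function.Surjective φ) : ∃ s : N →ₗ[k] E, IsRSection φ s := by
  classical
  obtain ⟨s₀, hs₀⟩ := LinearMap.exists_rightInverse_of_surjective (φ.restrictScalars k)
    (LinearMap.range_eq_top.2 hφ)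
  have hs₀' : ∀ n, φ (s₀ n) = n := LinearMap.congr_fun hs₀
  let s : N →ₗ[k] E := ∑ i, (E.ρ (e i)) ∘ₗ s₀ ∘ₗ (N.ρ (e i))
  have hs : ∀ n, s n = ∑ i, E.ρ (e i) (s₀ (N.ρ (e i) n)) := fun n => by simp [s]
  refine ⟨s, fun n => ?_, comm_R_of_comm_e h s fun i n => ?_⟩
  · rw [hs, map_sum]
    refine Eq.trans (Finset.sum_congr rfl fun i _ => ?_) (sum_ρ h N n)
    rw [← ρ_map, hs₀', ρ_ρ_same h]
  · rw [hs, hs, map_sum]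
    refine Finset.sum_congr rfl fun j _ => ?_
    by_cases hj : j = i
    · subst hj
      rw [ρ_ρ_same h, ρ_ρ_same h]
    · rw [ρ_ρ_ne h _ hj, ρ_ρ_ne h _ (Ne.symm hj), map_zero, map_zero]

theorem exists_lift_of_surjective (h : 𝒜.IsStrict e) {E N : Mod 𝒜}
    (φ : E.carrier →ₗ[𝒜.Abar] N.carrier) (hφ : Function.Surjective φ) (f : 𝒜.regular ⟶ N) :
    ∃ f' : 𝒜.regular ⟶ E, f' ≫ ofLinear φ = f := by
  obtain ⟨s, hs⟩ := exists_rSection h φ hφ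
  exact exists_lift_regular φ s hs f

theorem regular_isEProjective : 𝒜.regular.IsEProjective := by
  rintro M E N f g - - - ⟨M', E', N', φ, ψ, a, b, c, h1, h2, -, -, -, s, hs⟩ h
  obtain ⟨h', e'⟩ := exists_lift_regular ψ s hs (h ≫ c.hom)
  refine ⟨h' ≫ b.inv, ?_⟩
  rw [← cancel_mono c.hom, Category.assoc, Category.assoc, h2, Iso.inv_hom_id_assoc, e']

theorem IsEProjective.of_retract {P Q : Mod 𝒜} (hP : P.IsEProjective) (s : Q ⟶ P) (t : P ⟶ Q)
    (hst : s ≫ t = 𝟙 Q) : Q.IsEProjective := by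
  intro M E N f g hM hE hN hfg h
  obtain ⟨h', e'⟩ := hP M E N f g hM hE hN hfg (t ≫ h)
  exact ⟨s ≫ h', by rw [Category.assoc, e', ← Category.assoc, hst, Category.id_comp]⟩

/-- An `ℰ`-projective object lifts along surjective morphisms of finite-dimensional
`A/I`-modules. -/
theorem IsEProjective.exists_lift (h : 𝒜.IsStrict e) {Q E N : Mod 𝒜} (hQ : Q.IsEProjective)
    [hE : Module.Finite k E] (ψ : E.carrier →ₗ[𝒜.Abar] N.carrier)
    (hψ : Function.Surjective ψ) (f : Q ⟶ N) : ∃ f' : Q ⟶ E, f' ≫ ofLinear ψ = f := by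
  obtain ⟨s, hs⟩ := exists_rSection h ψ hψ
  have hN : Module.Finite k N := Module.Finite.of_surjective (ψ.restrictScalars k) hψ
  have hK : Module.Finite k (LinearMap.ker ψ) :=
    Module.Finite.of_injective ((LinearMap.ker ψ).subtype.restrictScalars k)
      Subtype.val_injective
  refine hQ (of 𝒜 (LinearMap.ker ψ)) E N (ofLinear (LinearMap.ker ψ).subtype) (ofLinear ψ)
    hK hE hN ⟨_, _, _, (LinearMap.ker ψ).subtype, ψ, Iso.refl _, Iso.refl _, Iso.refl _, ?_, ?_,
      Subtype.val_injective, LinearMap.exact_subtype_ker_map ψ, hψ, s, hs⟩ f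
  · simp
  · simp

end Mod

end TriangularInterlacedDitalgebra

/-! ### The functor `Hom(A/I, -)` and induction to the right algebra -/

namespace TriangularInterlacedDitalgebra

variable {k T : Type u} [Field k] [Ring T] [Algebra k T] {J : Type v}
variable {𝒜 : TriangularInterlacedDitalgebra k T}

open TriangularInterlacedDitalgebra.Mod

/-- The functor `Hom(A/I, -)` from `(𝒜, I)-Mod` to left `Γ`-modules. -/
abbrev homΓ (𝒜 : TriangularInterlacedDitalgebra k T) : 𝒜.Mod ⥤ ModuleCat.{u} 𝒜.Γ :=
  preadditiveCoyonedaObj 𝒜.regular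

theorem smul_hom {M : Mod 𝒜} (γ : 𝒜.Γ) (h : 𝒜.regular ⟶ M) : γ • h = γ.unop ≫ h := rfl

instance (M : Mod 𝒜) : IsScalarTower k 𝒜.Γ (𝒜.regular ⟶ M) :=
  ⟨fun c γ h => by
    rw [smul_hom, smul_hom, MulOpposite.unop_smul]
    exact Linear.smul_comp _ _ _ _ _ _⟩

/-- The `Γ`-linear map `γ ⊗ m ↦ γ ≫ (x ↦ x m)` before passing to the quotient. -/
def tensorToHom (M : Mod 𝒜) : 𝒜.Γ ⊗[k] M.carrier →ₗ[𝒜.Γ] (𝒜.regular ⟶ M) :=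
  haveI : SMulCommClass 𝒜.Γ k (𝒜.regular ⟶ M) := IsScalarTower.to_smulCommClass'
  TensorProduct.AlgebraTensorModule.lift
    (LinearMap.toSpanSingleton 𝒜.Γ (M.carrier →ₗ[k] (𝒜.regular ⟶ M))
      { toFun := ofElement
        map_add' := ofElement_add
        map_smul' := ofElement_smul })

theorem tensorToHom_tmul (M : Mod 𝒜) (γ : 𝒜.Γ) (m : M) :
    tensorToHom M (γ ⊗ₜ m) = γ.unop ≫ ofElement m := rfl

/-- The submodule of relations defining the induced module. -/
def relations (M : Mod 𝒜) : Submodule 𝒜.Γ (𝒜.Γ ⊗[k] M.carrier) :=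
  Submodule.span 𝒜.Γ {x | ∃ (b : 𝒜.Γ) (c : 𝒜.Abar) (m : M.carrier),
    x = (b * 𝒜.toΓ c) ⊗ₜ[k] m - b ⊗ₜ[k] (c • m)}

theorem relations_le (M : Mod 𝒜) : relations M ≤ LinearMap.ker (tensorToHom M) := by
  refine Submodule.span_le.2 ?_
  rintro _ ⟨b, c, m, rfl⟩
  rw [SetLike.mem_coe, LinearMap.mem_ker, map_sub, tensorToHom_tmul, tensorToHom_tmul, sub_eq_zero,
    ← rightMul_comp_ofElement, ← Category.assoc]
  rfl

/-- The comparison map `Γ ⊗_{A/I} M → Hom(A/I, M)`. -/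
def inducedToHom (M : Mod 𝒜) : ((𝒜.Γ ⊗[k] M.carrier) ⧸ relations M) →ₗ[𝒜.Γ] (𝒜.regular ⟶ M) :=
  (relations M).liftQ (tensorToHom M) (relations_le M)

theorem inducedToHom_mk_tmul (M : Mod 𝒜) (γ : 𝒜.Γ) (m : M) :
    inducedToHom M (Submodule.Quotient.mk (γ ⊗ₜ m)) = γ.unop ≫ ofElement m := rfl

/-- The map `Γ ⊗_{A/I} φ` on generators. -/
def tensorMap {M N : Mod 𝒜} (φ : M.carrier →ₗ[𝒜.Abar] N.carrier) :
    𝒜.Γ ⊗[k] M.carrier →ₗ[𝒜.Γ] 𝒜.Γ ⊗[k] N.carrier :=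
  TensorProduct.AlgebraTensorModule.map LinearMap.id (φ.restrictScalars k)

theorem tensorMap_tmul {M N : Mod 𝒜} (φ : M.carrier →ₗ[𝒜.Abar] N.carrier) (γ : 𝒜.Γ) (m : M) :
    tensorMap φ (γ ⊗ₜ m) = γ ⊗ₜ φ m := rfl

theorem relations_le_comap {M N : Mod 𝒜} (φ : M.carrier →ₗ[𝒜.Abar] N.carrier) :
    relations M ≤ (relations N).comap (tensorMap φ) := by
  refine Submodule.span_le.2 ?_
  rintro _ ⟨b, c, m, rfl⟩
  rw [SetLike.mem_coe, Submodule.mem_comap, map_sub, tensorMap_tmul, tensorMap_tmul, map_smul]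
  exact Submodule.subset_span ⟨b, c, φ m, rfl⟩

/-- The map `Γ ⊗_{A/I} φ`. -/
def inducedMap {M N : Mod 𝒜} (φ : M.carrier →ₗ[𝒜.Abar] N.carrier) :
    ((𝒜.Γ ⊗[k] M.carrier) ⧸ relations M) →ₗ[𝒜.Γ] ((𝒜.Γ ⊗[k] N.carrier) ⧸ relations N) :=
  (relations M).mapQ (relations N) (tensorMap φ) (relations_le_comap φ)

theorem inducedMap_mk_tmul {M N : Mod 𝒜} (φ : M.carrier →ₗ[𝒜.Abar] N.carrier) (γ : 𝒜.Γ) (m : M) :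
    inducedMap φ (Submodule.Quotient.mk (γ ⊗ₜ m)) = Submodule.Quotient.mk (γ ⊗ₜ φ m) := rfl

theorem induced_induction {M : Mod 𝒜} {p : ((𝒜.Γ ⊗[k] M.carrier) ⧸ relations M) → Prop}
    (h0 : p 0) (hadd : ∀ x y, p x → p y → p (x + y))
    (ht : ∀ γ m, p (Submodule.Quotient.mk (γ ⊗ₜ m))) (x) : p x := by
  obtain ⟨x, rfl⟩ := Submodule.Quotient.mk_surjective _ x
  induction x using TensorProduct.induction_on with
  | zero => exact h0
  | tmul γ m => exact ht γ m
  | add x y hx hy => exact hadd _ _ hx hy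

theorem inducedMap_surjective {M N : Mod 𝒜} (φ : M.carrier →ₗ[𝒜.Abar] N.carrier)
    (hφ : Function.Surjective φ) : Function.Surjective (inducedMap φ) := by
  intro y
  induction y using induced_induction with
  | h0 => exact ⟨0, map_zero _⟩
  | hadd x y hx hy =>
    obtain ⟨a, rfl⟩ := hx
    obtain ⟨b, rfl⟩ := hy
    exact ⟨a + b, map_add _ _ _⟩
  | ht γ n =>
    obtain ⟨m, rfl⟩ := hφ n
    exact ⟨_, inducedMap_mk_tmul φ γ m⟩

theorem inducedMap_comp_zero {M N L : Mod 𝒜} (φ : M.carrier →ₗ[𝒜.Abar] N.carrier)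
    (ψ : N.carrier →ₗ[𝒜.Abar] L.carrier) (h : ∀ m, ψ (φ m) = 0) (x) :
    inducedMap ψ (inducedMap φ x) = 0 := by
  induction x using induced_induction with
  | h0 => rw [map_zero, map_zero]
  | hadd x y hx hy => rw [map_add, map_add, hx, hy, add_zero]
  | ht γ m =>
    rw [inducedMap_mk_tmul, inducedMap_mk_tmul, h, TensorProduct.tmul_zero]
    rfl

theorem inducedToHom_naturality {M N : Mod 𝒜} (φ : M.carrier →ₗ[𝒜.Abar] N.carrier) (x) :
    inducedToHom N (inducedMap φ x) = inducedToHom M x ≫ ofLinear φ := by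
  induction x using induced_induction with
  | h0 => rw [map_zero, map_zero, map_zero, zero_comp]
  | hadd x y hx hy => rw [map_add, map_add, hx, hy, map_add, Preadditive.add_comp]
  | ht γ m =>
    rw [inducedMap_mk_tmul, inducedToHom_mk_tmul, inducedToHom_mk_tmul, Category.assoc,
      ofElement_comp_ofLinear]

theorem single_eq_smul_single_one {B : Type*} [Ring B] {n : ℕ} (i : Fin n) (b : B) :
    (Pi.single i b : Fin n → B) = b • Pi.single i 1 := by
  rw [← Pi.single_smul, smul_eq_mul, mul_one]

/-- The free module of rank `n`. -/
abbrev free (𝒜 : TriangularInterlacedDitalgebra k T) (n : ℕ) : Mod 𝒜 := of 𝒜 (Fin n → 𝒜.Abar)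

theorem free_hom_eq {n : ℕ} (h : 𝒜.regular ⟶ free 𝒜 n) :
    h = ∑ i, (h ≫ (ofLinear (LinearMap.proj i) : free 𝒜 n ⟶ 𝒜.regular)) ≫
      ofElement (M := free 𝒜 n) (Pi.single i 1) := by
  have h1 : ∀ i : Fin n, (ofLinear (LinearMap.proj i) : free 𝒜 n ⟶ 𝒜.regular) ≫
      ofElement (M := free 𝒜 n) (Pi.single i 1) =
      ofLinear (M := free 𝒜 n) (N := free 𝒜 n)
        (LinearMap.single 𝒜.Abar (fun _ => 𝒜.Abar) i ∘ₗ LinearMap.proj i) := by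
    intro i
    refine (ofLinear_comp (N := 𝒜.regular) _ _).trans (congrArg ofLinear ?_)
    refine LinearMap.ext fun x => ?_
    exact (single_eq_smul_single_one i ((x : Fin n → 𝒜.Abar) i)).symm
  have e : (∑ i, LinearMap.single 𝒜.Abar (fun _ : Fin n => 𝒜.Abar) i ∘ₗ
      LinearMap.proj i) = LinearMap.id := by
    refine LinearMap.ext fun x => ?_
    simp only [LinearMap.sum_apply, LinearMap.comp_apply, LinearMap.proj_apply,
      LinearMap.id_apply]
    exact LinearMap.sum_single_apply _ x
  simp only [Category.assoc, h1]
  rw [← Preadditive.comp_sum, ← ofLinear_sum (M := free 𝒜 n) (N := free 𝒜 n)]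
  conv_rhs => rw [e]
  exact (Category.comp_id h).symm

theorem inducedToHom_injective_free (n : ℕ) : Function.Injective (inducedToHom (free 𝒜 n)) := by
  let β : (𝒜.regular ⟶ free 𝒜 n) →+ ((𝒜.Γ ⊗[k] (free 𝒜 n).carrier) ⧸ relations (free 𝒜 n)) :=
    { toFun h := ∑ i, Submodule.Quotient.mk (p := relations (free 𝒜 n))
        ((MulOpposite.op (h ≫ (ofLinear (LinearMap.proj i) : free 𝒜 n ⟶ 𝒜.regular)) : 𝒜.Γ) ⊗ₜ[k]
          (Pi.single i 1 : Fin n → 𝒜.Abar))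
      map_zero' := Finset.sum_eq_zero fun i _ => by
        rw [zero_comp, MulOpposite.op_zero, TensorProduct.zero_tmul]; rfl
      map_add' h h' := by
        rw [← Finset.sum_add_distrib]
        refine Finset.sum_congr rfl fun i _ => ?_
        rw [Preadditive.add_comp, MulOpposite.op_add, TensorProduct.add_tmul]; rfl }
  have hβ : ∀ x, β (inducedToHom (free 𝒜 n) x) = x := by
    intro x
    induction x using induced_induction with
    | h0 => rw [map_zero, map_zero]
    | hadd x y hx hy => rw [map_add, map_add, hx, hy]
    | ht γ x =>
      have key : ∀ i : Fin n, Submodule.Quotient.mk (p := relations (free 𝒜 n))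
          ((MulOpposite.op ((γ.unop ≫ ofElement x) ≫
            (ofLinear (LinearMap.proj i) : free 𝒜 n ⟶ 𝒜.regular)) : 𝒜.Γ) ⊗ₜ[k]
            (Pi.single i 1 : Fin n → 𝒜.Abar)) =
          Submodule.Quotient.mk (γ ⊗ₜ[k] (Pi.single i (x i) : Fin n → 𝒜.Abar)) := by
        intro i
        have e1 : (MulOpposite.op ((γ.unop ≫ ofElement x) ≫
            (ofLinear (LinearMap.proj i) : free 𝒜 n ⟶ 𝒜.regular)) : 𝒜.Γ) =
            γ * 𝒜.toΓ (x i) := by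
          rw [Category.assoc, ofElement_comp_ofLinear]
          rfl
        have e2 : (Pi.single i (x i) : Fin n → 𝒜.Abar) = x i • Pi.single i 1 :=
          single_eq_smul_single_one i _
        rw [e1, e2, Submodule.Quotient.eq]
        exact Submodule.subset_span ⟨γ, x i, _, rfl⟩
      have e3 : γ ⊗ₜ[k] (x : Fin n → 𝒜.Abar) =
          ∑ i, γ ⊗ₜ[k] (Pi.single i (x i) : Fin n → 𝒜.Abar) := by
        rw [← TensorProduct.tmul_sum, Finset.univ_sum_single]
      rw [inducedToHom_mk_tmul]
      change (∑ i : Fin n, _) = _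
      rw [Finset.sum_congr rfl fun i _ => key i, e3]
      exact (map_sum (relations (free 𝒜 n)).mkQ _ _).symm
  exact Function.LeftInverse.injective hβ

/-- The surjection `(A/I)ⁿ → M` given by `n` elements of `M`. -/
def freeMap {n : ℕ} {M : Mod 𝒜} (x : Fin n → M) :
    (free 𝒜 n).carrier →ₗ[𝒜.Abar] M.carrier := Fintype.linearCombination 𝒜.Abar x

theorem freeMap_single {n : ℕ} {M : Mod 𝒜} (x : Fin n → M) (i : Fin n) :
    freeMap x (Pi.single i 1 : Fin n → 𝒜.Abar) = x i := by
  change Fintype.linearCombination 𝒜.Abar x (Pi.single i 1) = x i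
  rw [Fintype.linearCombination_apply_single, one_smul]

theorem exists_freeMap_surjective (M : Mod 𝒜) [Module.Finite k M] :
    ∃ (n : ℕ) (x : Fin n → M), Function.Surjective (freeMap x) := by
  have : Module.Finite 𝒜.Abar M.carrier := Module.Finite.of_restrictScalars_finite k _ _
  obtain ⟨n, x, hx⟩ := Module.Finite.exists_fin (R := 𝒜.Abar) (M := M.carrier)
  refine ⟨n, x, ?_⟩
  rw [← LinearMap.range_eq_top]
  refine (Fintype.range_linearCombination _ _).trans hx

variable [Fintype J] [Preorder J] {e : J → 𝒜.A}

/-- A morphism out of the regular object is a `Γ`-linear combination of the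
morphisms `x ↦ x m`. -/
theorem hom_mem_span (h : 𝒜.IsStrict e) (M : Mod 𝒜) [Module.Finite k M] (f : 𝒜.regular ⟶ M) :
    ∃ (n : ℕ) (γ : Fin n → 𝒜.Γ) (x : Fin n → M), f = ∑ i, γ i • ofElement (x i) := by
  obtain ⟨n, x, hx⟩ := exists_freeMap_surjective M
  obtain ⟨f', rfl⟩ := exists_lift_of_surjective h (freeMap x) hx f
  refine ⟨n, fun i => MulOpposite.op
    (f' ≫ (ofLinear (LinearMap.proj i) : free 𝒜 n ⟶ 𝒜.regular)), x, ?_⟩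
  conv_lhs => rw [free_hom_eq f', Preadditive.sum_comp]
  refine Finset.sum_congr rfl fun i _ => ?_
  rw [Category.assoc, ofElement_comp_ofLinear, freeMap_single]
  rfl

theorem inducedToHom_surjective (h : 𝒜.IsStrict e) (M : Mod 𝒜) [Module.Finite k M] :
    Function.Surjective (inducedToHom M) := by
  intro f
  obtain ⟨n, γ, x, rfl⟩ := hom_mem_span h M f
  refine ⟨∑ i, Submodule.Quotient.mk (γ i ⊗ₜ x i), ?_⟩
  rw [map_sum]
  rfl

theorem exists_factor_ker {M E N : Mod 𝒜} (ψ : E.carrier →ₗ[𝒜.Abar] N.carrier) (f : M ⟶ E)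
    (hf : f ≫ ofLinear ψ = 0) :
    ∃ f' : M ⟶ of 𝒜 (LinearMap.ker ψ), f' ≫ ofLinear (LinearMap.ker ψ).subtype = f := by
  refine exists_factor_of_range (K := of 𝒜 (LinearMap.ker ψ)) (LinearMap.ker ψ).subtype
    Subtype.val_injective f ?_ ?_
  · intro m
    rw [Submodule.range_subtype, LinearMap.mem_ker]
    exact LinearMap.congr_fun (congrArg Hom.f0 hf) m
  · intro v m
    rw [Submodule.range_subtype, LinearMap.mem_ker, ← comp_ofLinear_f1, hf]
    rfl

/-- Injectivity of the comparison map, by a diagram chase along a presentation of `M`. -/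
theorem inducedToHom_injective (h : 𝒜.IsStrict e) [Module.Finite k 𝒜.Abar] (M : Mod 𝒜)
    [Module.Finite k M] : Function.Injective (inducedToHom M) := by
  rw [← LinearMap.ker_eq_bot, LinearMap.ker_eq_bot']
  intro x hx
  obtain ⟨n, m, hm⟩ := exists_freeMap_surjective M
  obtain ⟨y, rfl⟩ := inducedMap_surjective (freeMap m) hm x
  rw [inducedToHom_naturality] at hx
  obtain ⟨z, hz⟩ := exists_factor_ker _ _ hx
  have : Module.Finite k (LinearMap.ker (freeMap m)) :=
    Module.Finite.of_injective ((LinearMap.ker (freeMap m)).subtype.restrictScalars k)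
      Subtype.val_injective
  obtain ⟨w, rfl⟩ := inducedToHom_surjective h (of 𝒜 (LinearMap.ker (freeMap m))) z
  rw [← inducedToHom_naturality] at hz
  rw [← inducedToHom_injective_free n hz]
  exact inducedMap_comp_zero (M := of 𝒜 (LinearMap.ker (freeMap m)))
    (LinearMap.ker (freeMap m)).subtype (freeMap m) (fun x => x.2) w

/-- `Γ ⊗_{A/I} M ≅ Hom(A/I, M)` for finite-dimensional `M`. -/
def inducedIso (h : 𝒜.IsStrict e) [Module.Finite k 𝒜.Abar] (M : Mod 𝒜) [Module.Finite k M] :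
    𝒜.induced M ≅ (homΓ 𝒜).obj M :=
  (LinearEquiv.ofBijective (inducedToHom M)
    ⟨inducedToHom_injective h M, inducedToHom_surjective h M⟩).toModuleIso

/-! ### Exactness and full faithfulness -/

/-- A morphism `f` is recovered from its compositions with the maps `x ↦ x m`. -/
theorem homΓ_faithful {M N : Mod 𝒜} {f g : M ⟶ N} (h : (homΓ 𝒜).map f = (homΓ 𝒜).map g) :
    f = g := by
  have h' : ∀ m : M, ofElement m ≫ f = ofElement m ≫ g := fun m =>
    LinearMap.congr_fun (congrArg ModuleCat.Hom.hom h) (ofElement m)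
  refine hom_ext (LinearMap.ext fun m => ?_) (LinearMap.ext fun v => LinearMap.ext fun m => ?_)
  · rw [← ofElement_comp_f0, h', ofElement_comp_f0]
  · rw [← ofElement_comp_f1, h', ofElement_comp_f1]

/-- Every `Γ`-linear map `θ : Hom(A/I, M) → Hom(A/I, N)` is induced by the morphism whose value
at `m` is read off from `θ(x ↦ x m)` at `1`. -/
theorem homΓ_full (h : 𝒜.IsStrict e) {M N : Mod 𝒜} [Module.Finite k M]
    (θ : (homΓ 𝒜).obj M ⟶ (homΓ 𝒜).obj N) : ∃ f : M ⟶ N, (homΓ 𝒜).map f = θ := by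
  let t : (𝒜.regular ⟶ M) →ₗ[𝒜.Γ] (𝒜.regular ⟶ N) := θ.hom
  have tk : ∀ (c : k) x, t (c • x) = c • t x := fun c x => by
    rw [← algebraMap_smul 𝒜.Γ c x, map_smul, algebraMap_smul]
  have tb : ∀ (b : 𝒜.Abar) (m : M), t (ofElement (b • m)) = 𝒜.rightMul b ≫ t (ofElement m) := by
    intro b m
    rw [← rightMul_comp_ofElement]
    exact map_smul t (MulOpposite.op (𝒜.rightMul b) : 𝒜.Γ) _
  have r0 : ∀ (b : 𝒜.Abar) (g : 𝒜.regular ⟶ N),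
      Hom.f0 (𝒜.rightMul b ≫ g) (1 : 𝒜.Abar) = Hom.f0 g b := by
    intro b g
    rw [hom_comp_f0]
    exact congrArg (Hom.f0 g) (one_mul b)
  have r1 : ∀ (b : 𝒜.Abar) (g : 𝒜.regular ⟶ N) (v : 𝒜.deg 1),
      Hom.f1 (𝒜.rightMul b ≫ g) v (1 : 𝒜.Abar) = Hom.f1 g v b := by
    intro b g v
    rw [rightMul, ofLinear_comp_f1]
    exact congrArg (Hom.f1 g v) (one_mul b)
  let f : Hom M N :=
    { f0 :=
        { toFun m := Hom.f0 (t (ofElement m)) (1 : 𝒜.Abar)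
          map_add' m m' := by rw [ofElement_add, map_add, hom_add_f0]; rfl
          map_smul' c m := by rw [ofElement_smul, tk]; rfl }
      f1 :=
        { toFun v :=
            { toFun m := Hom.f1 (t (ofElement m)) v (1 : 𝒜.Abar)
              map_add' m m' := by rw [ofElement_add, map_add, hom_add_f1]; rfl
              map_smul' c m := by rw [ofElement_smul, tk]; rfl }
          map_add' v w := LinearMap.ext fun m =>
            LinearMap.congr_fun (map_add (Hom.f1 (t (ofElement m))) v w) (1 : 𝒜.Abar)
          map_smul' c v := LinearMap.ext fun m =>
            LinearMap.congr_fun (map_smul (Hom.f1 (t (ofElement m))) c v) (1 : 𝒜.Abar) }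
      bimod a v b := LinearMap.ext fun m => by
        change Hom.f1 (t (ofElement m)) (𝒜.bimul a v b) (1 : 𝒜.Abar) =
          N.ρ a (Hom.f1 (t (ofElement (Ideal.Quotient.mk 𝒜.ideal b • m))) v (1 : 𝒜.Abar))
        rw [tb, r1, (t (ofElement m)).bimod]
        exact congrArg (fun x => N.ρ a (Hom.f1 (t (ofElement m)) v x))
          (mul_one (Ideal.Quotient.mk 𝒜.ideal b))
      comm a m := by
        change N.ρ a (Hom.f0 (t (ofElement m)) (1 : 𝒜.Abar)) =
          Hom.f0 (t (ofElement (Ideal.Quotient.mk 𝒜.ideal a • m))) (1 : 𝒜.Abar) +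
            Hom.f1 (t (ofElement m)) (𝒜.δA a) (1 : 𝒜.Abar)
        rw [tb, r0, regular_f0, sub_add_cancel] }
  refine ⟨f, ModuleCat.hom_ext (LinearMap.ext fun (g : 𝒜.regular ⟶ M) => ?_)⟩
  have key : ∀ m : M, ofElement m ≫ (show M ⟶ N from f) = t (ofElement m) := fun m =>
    regular_hom_ext (ofElement_comp_f0 m f) fun v _ => by
      refine LinearMap.ext fun x => ?_
      obtain ⟨b, rfl⟩ := Ideal.Quotient.mk_surjective (I := 𝒜.ideal) x
      have e1 : Hom.f1 (ofElement m ≫ (show M ⟶ N from f)) v (Ideal.Quotient.mk 𝒜.ideal b) =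
          Hom.f1 f v (Ideal.Quotient.mk 𝒜.ideal b • m) := ofLinear_comp_f1 _ _ _ _
      rw [e1]
      change Hom.f1 (t (ofElement (Ideal.Quotient.mk 𝒜.ideal b • m))) v (1 : 𝒜.Abar) = _
      rw [tb, r1]
  obtain ⟨n, γ, x, rfl⟩ := hom_mem_span h M g
  change (∑ i, γ i • ofElement (x i)) ≫ (show M ⟶ N from f) = t (∑ i, γ i • ofElement (x i))
  rw [map_sum, Preadditive.sum_comp]
  refine Finset.sum_congr rfl fun i _ => ?_
  rw [map_smul, ← key, smul_hom, smul_hom, Category.assoc]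

/-- The functor `Hom(A/I, -)` is exact on surjections of `A/I`-modules. -/
theorem homΓ_shortExact (h : 𝒜.IsStrict e) {E N : Mod 𝒜} (ψ : E.carrier →ₗ[𝒜.Abar] N.carrier)
    (hψ : Function.Surjective ψ) :
    (ShortComplex.mk ((homΓ 𝒜).map (ofLinear (LinearMap.ker ψ).subtype :
        of 𝒜 (LinearMap.ker ψ) ⟶ E)) ((homΓ 𝒜).map (ofLinear ψ)) (by
      rw [← Functor.map_comp, ofLinear_comp, LinearMap.comp_ker_subtype, ofLinear_zero,
        Functor.map_zero])).ShortExact where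
  exact := by
    rw [ShortComplex.moduleCat_exact_iff]
    intro f hf
    exact exists_factor_ker ψ f hf
  mono_f := by
    rw [ModuleCat.mono_iff_injective]
    intro (f : 𝒜.regular ⟶ _) (g : 𝒜.regular ⟶ _) hfg
    have hfg' : f ≫ ofLinear (LinearMap.ker ψ).subtype =
      g ≫ (ofLinear (LinearMap.ker ψ).subtype : of 𝒜 (LinearMap.ker ψ) ⟶ E) := hfg
    refine hom_ext (LinearMap.ext fun m => Subtype.ext ?_)
      (LinearMap.ext fun v => LinearMap.ext fun m => Subtype.ext ?_)
    · exact LinearMap.congr_fun (congrArg Hom.f0 hfg') m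
    · have := LinearMap.congr_fun (LinearMap.congr_fun (congrArg Hom.f1 hfg') v) m
      rwa [comp_ofLinear_f1, comp_ofLinear_f1] at this
  epi_g := by
    rw [ModuleCat.epi_iff_surjective]
    exact fun f => exists_lift_of_surjective h ψ hψ f

end TriangularInterlacedDitalgebra

/-! ### The algebra `A` and the simple modules of a strict ditalgebra -/

theorem Subalgebra.adjoin_le_of_mul_le {k T : Type*} [CommSemiring k] [Semiring T] [Algebra k T]
    {s : Set T} {Y : Submodule k T} (h1 : (1 : T) ∈ Y) (h : ∀ y ∈ Y, ∀ x ∈ s, y * x ∈ Y) :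
    Subalgebra.toSubmodule (Algebra.adjoin k s) ≤ Y := by
  let S : Subalgebra k T :=
    { carrier := {a | ∀ y ∈ Y, y * a ∈ Y}
      mul_mem' {a b} ha hb y hy := by rw [← mul_assoc]; exact hb _ (ha _ hy)
      add_mem' {a b} ha hb y hy := by rw [mul_add]; exact add_mem (ha _ hy) (hb _ hy)
      algebraMap_mem' c y hy := by
        rw [← Algebra.commutes, ← Algebra.smul_def]; exact Y.smul_mem c hy }
  have : Algebra.adjoin k s ≤ S := Algebra.adjoin_le fun x hx y hy => h y hy x hx
  intro a ha
  simpa using this ha 1 h1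

namespace TriangularInterlacedDitalgebra

variable {k T : Type u} [Field k] [Ring T] [Algebra k T] {J : Type v}
variable {𝒜 : TriangularInterlacedDitalgebra k T}
open TriangularInterlacedDitalgebra.Mod

section generators

variable {e : J → 𝒜.A}

/-- The generator of the projective module `(A/I) eᵢ`. -/
def projGen (e : J → 𝒜.A) (i : J) : (proj 𝒜 e i).carrier :=
  ⟨Ideal.Quotient.mk 𝒜.ideal (e i), Submodule.mem_span_singleton_self _⟩

theorem exists_ρ_projGen (i : J) (x : (proj 𝒜 e i).carrier) :
    ∃ a : 𝒜.A, x = (proj 𝒜 e i).ρ a (projGen e i) := by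
  obtain ⟨b, hb⟩ := Submodule.mem_span_singleton.1 x.2
  obtain ⟨a, rfl⟩ := Ideal.Quotient.mk_surjective (I := 𝒜.ideal) b
  exact ⟨a, Subtype.ext hb.symm⟩

theorem eq_top_of_projGen_mem {i : J} {P : Submodule 𝒜.Abar (proj 𝒜 e i).carrier}
    (hP : projGen e i ∈ P) : P = ⊤ := by
  rw [eq_top_iff]
  intro x _
  obtain ⟨a, rfl⟩ := exists_ρ_projGen i x
  exact P.smul_mem (Ideal.Quotient.mk 𝒜.ideal a) hP

/-- The projection `(A/I) eᵢ → Sᵢ`. -/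
def toSimple (e : J → 𝒜.A) (i : J) :
    (proj 𝒜 e i).carrier →ₗ[𝒜.Abar] (simple 𝒜 e i).carrier :=
  Submodule.mkQ (Module.jacobson 𝒜.Abar (proj 𝒜 e i).carrier)

theorem toSimple_surjective (e : J → 𝒜.A) (i : J) : Function.Surjective (toSimple e i) :=
  Submodule.mkQ_surjective _

/-- The generator of the simple module `Sᵢ`. -/
def simpleGen (e : J → 𝒜.A) (i : J) : (simple 𝒜 e i).carrier := toSimple e i (projGen e i)

end generators

variable [Fintype J] [Preorder J] {e : J → 𝒜.A}

/-- Paths are strictly increasing. -/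
theorem Precedes.lt (h : 𝒜.IsStrict e) {i j : J} (hij : 𝒜.Precedes e i j) : i < j := by
  induction hij with
  | single h' => exact h.W₀_lt _ _ h'
  | tail _ h' ih => exact ih.trans (h.W₀_lt _ _ h')

namespace IsStrict

theorem sum_e (h : 𝒜.IsStrict e) : ∑ i, (e i : T) = 1 := by
  have := congrArg (Subalgebra.val _) h.idempotents.complete
  rwa [map_sum, map_one] at this

theorem eq_sum_mul (h : 𝒜.IsStrict e) (x : T) : x = ∑ j, ∑ i, (e j : T) * x * e i := by
  simp_rw [← Finset.mul_sum, h.sum_e, mul_one, ← Finset.sum_mul, h.sum_e, one_mul]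

theorem mul_eq_sum (h : 𝒜.IsStrict e) (x y : T) : x * y = ∑ l, x * e l * (e l * y) := by
  have hl : ∀ l, x * e l * (e l * y) = x * (e l : T) * y := by
    intro l
    have : (e l : T) * e l = e l := congrArg Subtype.val (h.idempotents.idem l)
    rw [mul_assoc, ← mul_assoc (e l : T), this, ← mul_assoc]
  simp_rw [hl, ← Finset.sum_mul, ← Finset.mul_sum, h.sum_e, mul_one]

/-- `eⱼ A eᵢ` vanishes unless there is a path from `i` to `j`, and `eᵢ A eᵢ = k eᵢ`. -/
theorem exists_smul (h : 𝒜.IsStrict e) (a : 𝒜.A) (i j : J) (hij : ¬ 𝒜.Precedes e i j) :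
    ∃ c : k, e j * a * e i = c • (e j * e i) := by
  classical
  let S : Subalgebra k 𝒜.A :=
    { carrier := {a | ∀ i j, ¬ 𝒜.Precedes e i j → ∃ c : k, e j * a * e i = c • (e j * e i)}
      mul_mem' {a b} ha hb i j hij := by
        have key : ∀ l, ∃ c : k, (e j * a * e l) * (e l * b * e i) = c • (e j * e i) := by
          intro l
          by_cases hl : 𝒜.Precedes e i l
          · have hlj : ¬ 𝒜.Precedes e l j := fun h' => hij (hl.trans h')
            obtain ⟨c, hc⟩ := ha l j hlj
            by_cases hjl : j = l
            · subst hjl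
              exact absurd hl hij
            · refine ⟨0, ?_⟩
              rw [hc, h.idempotents.ortho hjl]; simp
          · obtain ⟨c, hc⟩ := hb i l hl
            by_cases hil : l = i
            · subst hil
              obtain ⟨c', hc'⟩ := ha l j hij
              refine ⟨c * c', ?_⟩
              rw [hc, hc', h.idempotents.idem l, mul_smul_comm, smul_mul_assoc, mul_assoc,
                h.idempotents.idem l, smul_smul]
            · refine ⟨0, ?_⟩
              rw [hc, h.idempotents.ortho hil]; simp
        choose c hc using key
        refine ⟨∑ l, c l, ?_⟩
        rw [Finset.sum_smul, ← Finset.sum_congr rfl fun l _ => hc l]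
        apply Subtype.ext
        have := h.mul_eq_sum ((e j : T) * a) (b * e i)
        push_cast
        simp only [mul_assoc] at this ⊢
        exact this
      add_mem' {a b} ha hb i j hij := by
        obtain ⟨c, hc⟩ := ha i j hij
        obtain ⟨c', hc'⟩ := hb i j hij
        exact ⟨c + c', by rw [mul_add, add_mul, hc, hc', add_smul]⟩
      algebraMap_mem' c i j _ :=
        ⟨c, by rw [Algebra.algebraMap_eq_smul_one, mul_smul_comm, mul_one, smul_mul_assoc]⟩ }
  refine 𝒜.isLayer.eq_top_of_mem S (fun r hr => ?_) (fun w hw i j hij => ⟨0, ?_⟩) a i j hij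
  · have hr' : (r : T) ∈ Submodule.span k (Set.range fun i => (e i : T)) := by
      rw [← h.R_eq]; exact hr
    obtain ⟨c, hc⟩ := (Submodule.mem_span_range_iff_exists_fun k).1 hr'
    have : r = ∑ i, c i • e i := by
      apply Subtype.ext
      rw [← hc]
      simp
    rw [this]
    refine Subalgebra.sum_mem _ fun l _ => Subalgebra.smul_mem _ ?_ _
    intro i j _
    by_cases hil : l = i
    · subst hil
      exact ⟨1, by rw [mul_assoc, h.idempotents.idem l, one_smul]⟩
    · exact ⟨0, by rw [mul_assoc, h.idempotents.ortho hil, mul_zero, zero_smul]⟩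
  · rw [zero_smul]
    by_contra hne
    exact hij (Relation.TransGen.single ⟨w, hw, fun h0 => hne (Subtype.ext h0)⟩)

open Classical in
/-- A product of `n` elements of `W₀` only connects vertices at distance at least `n`; the distance is
measured by the numbers of vertices below the end points. -/
theorem mul_pow_W₀_mul (h : 𝒜.IsStrict e) (n : ℕ) (i j : J)
    (hij : (Finset.univ.filter (· < j)).card < (Finset.univ.filter (· < i)).card + n)
    (x : T) (hx : x ∈ 𝒜.W₀ ^ n) : (e j : T) * x * e i = 0 := by
  induction n generalizing i j x with
  | zero =>
    rw [pow_zero, Submodule.mem_one] at hx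
    obtain ⟨c, rfl⟩ := hx
    have hne : j ≠ i := by rintro rfl; simp at hij
    have : (e j : T) * e i = 0 := congrArg Subtype.val (h.idempotents.ortho hne)
    rw [← Algebra.commutes, mul_assoc, this, mul_zero]
  | succ n ih =>
    rw [pow_succ] at hx
    induction hx using Submodule.mul_induction_on' with
    | mem_mul_mem y hy w hw =>
      rw [← mul_assoc, mul_assoc, h.mul_eq_sum]
      refine Finset.sum_eq_zero fun l _ => ?_
      by_cases hl : (e l : T) * w * e i = 0
      · rw [← mul_assoc (e l : T), hl, mul_zero]
      · have hlt : i < l := h.W₀_lt i l ⟨w, hw, hl⟩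
        have hcard : (Finset.univ.filter (· < i)).card < (Finset.univ.filter (· < l)).card := by
          refine Finset.card_lt_card ⟨fun x hx => ?_, fun hs => ?_⟩
          · simp only [Finset.mem_filter, Finset.mem_univ, true_and] at hx ⊢
            exact hx.trans hlt
          · have : i ∈ Finset.univ.filter (· < i) := hs (by simpa using hlt)
            simp at this
        rw [ih l j (by omega) y hy, zero_mul]
    | add x _ y _ hx hy => rw [mul_add, add_mul, hx, hy, add_zero]

theorem pow_W₀_eq_bot (h : 𝒜.IsStrict e) : 𝒜.W₀ ^ (Fintype.card J + 1) = ⊥ := by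
  classical
  rw [eq_bot_iff]
  intro x hx
  rw [Submodule.mem_bot, h.eq_sum_mul x]
  refine Finset.sum_eq_zero fun j _ => Finset.sum_eq_zero fun i _ => ?_
  refine h.mul_pow_W₀_mul _ i j ?_ x hx
  have : (Finset.univ.filter (· < j)).card ≤ Fintype.card J := Finset.card_le_univ _
  omega

theorem W₀_mul_R_le (𝒜 : TriangularInterlacedDitalgebra k T) :
    𝒜.W₀ * Subalgebra.toSubmodule 𝒜.R ≤ 𝒜.W₀ :=
  Submodule.mul_le.2 fun w hw r hr => (𝒜.isLayer.W₀_bimod r hr w hw).2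

theorem R_mul_W₀_le (𝒜 : TriangularInterlacedDitalgebra k T) :
    Subalgebra.toSubmodule 𝒜.R * 𝒜.W₀ ≤ 𝒜.W₀ :=
  Submodule.mul_le.2 fun r hr w hw => (𝒜.isLayer.W₀_bimod r hr w hw).1

/-- `A = T_R(W₀)` is finite-dimensional, since `W₀` is nilpotent. -/
theorem finite_A (h : 𝒜.IsStrict e) : Module.Finite k 𝒜.A := by
  classical
  set N := Fintype.card J
  let Y : Submodule k T := Subalgebra.toSubmodule 𝒜.R ⊔ ⨆ m : Fin (N + 1), 𝒜.W₀ ^ (m + 1 : ℕ)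
  have hle : ∀ m : ℕ, 𝒜.W₀ ^ (m + 1) ≤ Y := by
    intro m
    by_cases hm : m < N + 1
    · exact le_sup_of_le_right (le_iSup (fun m : Fin (N + 1) => 𝒜.W₀ ^ (m + 1 : ℕ)) ⟨m, hm⟩)
    · obtain ⟨d, rfl⟩ := Nat.exists_eq_add_of_le (not_lt.1 hm)
      have : 𝒜.W₀ ^ (N + 1 + d + 1) = ⊥ := by
        rw [add_assoc (N + 1), pow_add, h.pow_W₀_eq_bot, Submodule.bot_mul]
      rw [this]
      exact bot_le
  have hW : Y * 𝒜.W₀ ≤ Y := by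
    rw [Submodule.sup_mul, Submodule.iSup_mul]
    refine sup_le ?_ (iSup_le fun m => ?_)
    · exact (R_mul_W₀_le 𝒜).trans (by simpa using hle 0)
    · rw [← pow_succ]; exact hle _
  have hR : Y * Subalgebra.toSubmodule 𝒜.R ≤ Y := by
    rw [Submodule.sup_mul, Submodule.iSup_mul]
    refine sup_le ?_ (iSup_le fun m => ?_)
    · rw [(Subalgebra.isIdempotentElem_toSubmodule 𝒜.R).eq]
      exact le_sup_left
    · rw [pow_succ, mul_assoc]
      refine (mul_le_mul_right (W₀_mul_R_le 𝒜) _).trans ?_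
      rw [← pow_succ]; exact hle _
  have hA : 𝒜.deg 0 ≤ Y := by
    rw [𝒜.isLayer.deg_zero]
    refine Subalgebra.adjoin_le_of_mul_le (le_sup_left (a := Subalgebra.toSubmodule 𝒜.R)
      (one_mem 𝒜.R)) ?_
    rintro y hy x (hx | hx)
    · exact hR (Submodule.mul_mem_mul hy hx)
    · exact hW (Submodule.mul_mem_mul hy hx)
  have hY : Y.FG := by
    refine Submodule.FG.sup ?_ (Submodule.fg_iSup _ fun m => Submodule.FG.pow ?_ _)
    · rw [h.R_eq]; exact Submodule.fg_span (Set.finite_range _)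
    · exact Module.Finite.iff_fg.1 h.finite_W₀
  have : Module.Finite k Y := Module.Finite.iff_fg.2 hY
  exact Module.Finite.of_injective (Submodule.inclusion hA) (Submodule.inclusion_injective hA)

theorem finite_Abar (h : 𝒜.IsStrict e) : Module.Finite k 𝒜.Abar := by
  have := h.finite_A
  exact Module.Finite.of_surjective (Ideal.Quotient.mkₐ k 𝒜.ideal).toLinearMap
    (Ideal.Quotient.mk_surjective (I := 𝒜.ideal))

/-- Morphisms between finite-dimensional objects form finite-dimensional spaces. -/
theorem finite_hom (h : 𝒜.IsStrict e) (M N : Mod 𝒜) [Module.Finite k M] [Module.Finite k N] :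
    Module.Finite k (M ⟶ N) := by
  have := h.finite_W₁
  let Φ : (M ⟶ N) →ₗ[k] (M →ₗ[k] N) × (𝒜.W₁ →ₗ[k] M →ₗ[k] N) :=
    { toFun f := (Hom.f0 f, Hom.f1 f ∘ₗ Submodule.inclusion 𝒜.isLayer.W₁_le)
      map_add' f g := rfl
      map_smul' c f := rfl }
  refine Module.Finite.of_injective Φ fun f g hfg => ?_
  rw [Prod.ext_iff] at hfg
  exact hom_ext_W₁ hfg.1 fun v hv => LinearMap.congr_fun hfg.2 ⟨v, hv⟩

theorem finite_End (h : 𝒜.IsStrict e) (M : Mod 𝒜) [Module.Finite k M] :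
    Module.Finite k (End M) := h.finite_hom M M

theorem finite_Γ (h : 𝒜.IsStrict e) : Module.Finite k 𝒜.Γ := by
  have := h.finite_Abar
  have : Module.Finite k (End 𝒜.regular) := h.finite_End _
  exact Module.Finite.equiv (MulOpposite.opLinearEquiv k (M := End 𝒜.regular))

/-- The idempotents remain nonzero in `A/I`, because `I` lies in the radical. -/
theorem mk_e_ne_zero (h : 𝒜.IsStrict e) (i : J) : Ideal.Quotient.mk 𝒜.ideal (e i) ≠ 0 := by
  intro h0
  rw [Ideal.Quotient.eq_zero_iff_mem] at h0
  have h1 : (((Ring.jacobson 𝒜.A).restrictScalars k).map 𝒜.A.val.toLinearMap) ^ 2 ≤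
      ((Ring.jacobson 𝒜.A).restrictScalars k).map 𝒜.A.val.toLinearMap := by
    rw [pow_two]
    refine Submodule.mul_le.2 ?_
    rintro _ ⟨a, ha, rfl⟩ _ ⟨b, hb, rfl⟩
    exact ⟨a * b, Ideal.mul_mem_left _ a hb, rfl⟩
  obtain ⟨a, ha, e1⟩ := h1 (h.I_le h0)
  have e2 : a = e i := Subtype.ext e1
  subst e2
  have ha' : e i ∈ Ideal.jacobson (⊥ : Ideal 𝒜.A) := by
    rw [Ideal.jacobson_bot]; exact ha
  obtain ⟨z, hz⟩ := Ideal.mem_jacobson_iff.1 ha' (-1)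
  rw [Ideal.mem_bot, sub_eq_zero] at hz
  apply h.ne_zero i
  have := congrArg (· * e i) hz
  simp only [add_mul, mul_assoc, one_mul] at this
  rw [h.idempotents.idem i, neg_mul, one_mul, mul_neg, neg_add_cancel] at this
  exact this.symm

end IsStrict

/-- The vertex `i` lies in the support of `M`: `eᵢ M ≠ 0`. -/
def InSupp (e : J → 𝒜.A) (M : Mod 𝒜) (i : J) : Prop := ∃ m, M.ρ (e i) m ≠ 0

theorem InSupp.of_injective {M N : Mod 𝒜} (h : 𝒜.IsStrict e) (f : M ⟶ N)
    (hf : Function.Injective (Hom.f0 f)) {i : J} (hi : InSupp e M i) : InSupp e N i := by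
  obtain ⟨m, hm⟩ := hi
  refine ⟨Hom.f0 f m, fun h0 => hm (hf ?_)⟩
  rw [map_zero, ← hom_f0_R f (e i) (h.e_mem_R i), h0]

theorem exists_inSupp (h : 𝒜.IsStrict e) (M : Mod 𝒜) [Nontrivial M.carrier] :
    ∃ i, InSupp e M i := by
  obtain ⟨m, hm⟩ := exists_ne (0 : M.carrier)
  by_contra! hne
  apply hm
  rw [← sum_ρ h M m]
  refine Finset.sum_eq_zero fun i _ => ?_
  by_contra h0
  exact hne i ⟨m, h0⟩

theorem ρ_mul_apply (M : Mod 𝒜) (a b : 𝒜.A) (m : M) : M.ρ (a * b) m = M.ρ a (M.ρ b m) := by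
  rw [map_mul, Module.End.mul_apply]

/-- A nonzero morphism connects comparable vertices of the supports: its first component preserves
vertices, and its second one involves elements of `eⱼ W₁ eᵢ` with `i ≤ j`. -/
theorem exists_inSupp_le (h : 𝒜.IsStrict e) {M N : Mod 𝒜} {f : M ⟶ N} (hf : f ≠ 0) :
    ∃ i j, InSupp e M i ∧ InSupp e N j ∧ i ≤ j := by
  by_cases h0 : Hom.f0 f = 0
  · have : ∃ v : 𝒜.deg 1, (v : T) ∈ 𝒜.W₁ ∧ Hom.f1 f v ≠ 0 := by
      by_contra! hne
      exact hf (hom_ext_W₁ (h0.trans hom_zero_f0.symm) fun v hv => hne v hv)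
    obtain ⟨v, hv, hne⟩ := this
    have : ∃ m, Hom.f1 f v m ≠ 0 := by
      by_contra! hm
      exact hne (LinearMap.ext hm)
    obtain ⟨m, hm⟩ := this
    have e1 : Hom.f1 f v m = ∑ j, ∑ i, N.ρ (e j) (Hom.f1 f v (M.ρ (e i) m)) := by
      simp_rw [← map_sum, sum_ρ h M m]
      rw [sum_ρ h N]
    obtain ⟨j, -, hj⟩ := Finset.exists_ne_zero_of_sum_ne_zero (e1 ▸ hm)
    obtain ⟨i, -, hij⟩ := Finset.exists_ne_zero_of_sum_ne_zero hj
    refine ⟨i, j, ⟨m, fun h' => hij (by rw [h', map_zero, map_zero])⟩, ⟨_, hij⟩,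
      h.W₁_le i j ⟨v, hv, fun h' => hij ?_⟩⟩
    have e2 : Hom.f1 f (𝒜.bimul (e j) v (e i)) m = N.ρ (e j) (Hom.f1 f v (M.ρ (e i) m)) := by
      rw [f.bimod]; rfl
    have e3 : 𝒜.bimul (e j) v (e i) = 0 := Subtype.ext h'
    rw [← e2, e3, map_zero]
    rfl
  · have : ∃ m, Hom.f0 f m ≠ 0 := by
      by_contra! hm
      exact h0 (LinearMap.ext hm)
    obtain ⟨m, hm⟩ := this
    rw [← sum_ρ h M m, map_sum] at hm
    obtain ⟨i, -, hi⟩ := Finset.exists_ne_zero_of_sum_ne_zero hm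
    refine ⟨i, i, ⟨m, fun h' => hi (by rw [h', map_zero])⟩, ⟨Hom.f0 f m, ?_⟩, le_rfl⟩
    rwa [hom_f0_R f (e i) (h.e_mem_R i)]

/-- There is no action of `A` from the vertex `i` to another vertex `j` without a path. -/
theorem ρ_ρ_ρ_ne (h : 𝒜.IsStrict e) (M : Mod 𝒜) {i j : J} (hij : ¬ 𝒜.Precedes e i j)
    (hne : j ≠ i) (a : 𝒜.A) (m : M) : M.ρ (e j) (M.ρ a (M.ρ (e i) m)) = 0 := by
  obtain ⟨c, hc⟩ := h.exists_smul a i j hij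
  rw [← ρ_mul_apply, ← ρ_mul_apply, hc, h.idempotents.ortho hne, smul_zero, map_zero]
  rfl

theorem exists_ρ_ρ_ρ_same (h : 𝒜.IsStrict e) (a : 𝒜.A) (i : J) :
    ∃ c : k, ∀ (M : Mod 𝒜) (m : M), M.ρ (e i) (M.ρ a (M.ρ (e i) m)) = c • M.ρ (e i) m := by
  obtain ⟨c, hc⟩ := h.exists_smul a i i fun hii => (hii.lt h).false
  refine ⟨c, fun M m => ?_⟩
  rw [← ρ_mul_apply, ← ρ_mul_apply, hc, h.idempotents.idem i, map_smul]
  rfl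

theorem projGen_ne_zero (h : 𝒜.IsStrict e) (i : J) : projGen e i ≠ 0 := fun h0 =>
  h.mk_e_ne_zero i (congrArg Subtype.val h0)

theorem ρ_projGen (h : 𝒜.IsStrict e) (i : J) :
    (proj 𝒜 e i).ρ (e i) (projGen e i) = projGen e i := by
  apply Subtype.ext
  change Ideal.Quotient.mk 𝒜.ideal (e i) * Ideal.Quotient.mk 𝒜.ideal (e i) = _
  rw [← map_mul, h.idempotents.idem i]
  rfl

theorem inSupp_proj (h : 𝒜.IsStrict e) (i : J) : InSupp e (proj 𝒜 e i) i :=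
  ⟨projGen e i, by rw [ρ_projGen h]; exact projGen_ne_zero h i⟩

theorem InSupp.eq_or_precedes (h : 𝒜.IsStrict e) {i j : J} (hj : InSupp e (proj 𝒜 e i) j) :
    j = i ∨ 𝒜.Precedes e i j := by
  obtain ⟨x, hx⟩ := hj
  by_contra! hne
  obtain ⟨a, rfl⟩ := exists_ρ_projGen i x
  apply hx
  rw [← ρ_projGen h i]
  exact ρ_ρ_ρ_ne h _ hne.2 hne.1 a _

theorem exists_smul_projGen (h : 𝒜.IsStrict e) (i : J) (x : (proj 𝒜 e i).carrier) :
    ∃ c : k, (proj 𝒜 e i).ρ (e i) x = c • projGen e i := by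
  obtain ⟨a, rfl⟩ := exists_ρ_projGen i x
  obtain ⟨c, hc⟩ := exists_ρ_ρ_ρ_same h a i
  refine ⟨c, ?_⟩
  have := hc _ (projGen e i)
  rwa [ρ_projGen h] at this

/-- The radical of `(A/I) eᵢ`, the submodule of the elements `x` with `eᵢ x = 0`. -/
def radProj (h : 𝒜.IsStrict e) (i : J) : Submodule 𝒜.Abar (proj 𝒜 e i).carrier where
  carrier := {x | (proj 𝒜 e i).ρ (e i) x = 0}
  add_mem' {x y} hx hy := by
    rw [Set.mem_ofPred_eq] at *
    rw [map_add, hx, hy, add_zero]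
  zero_mem' := map_zero _
  smul_mem' b x hx := by
    obtain ⟨a, rfl⟩ := Ideal.Quotient.mk_surjective (I := 𝒜.ideal) b
    rw [Set.mem_ofPred_eq] at *
    change (proj 𝒜 e i).ρ (e i) ((proj 𝒜 e i).ρ a x) = 0
    rw [← sum_ρ h _ x, map_sum, map_sum]
    refine Finset.sum_eq_zero fun j _ => ?_
    by_cases hj : i = j
    · subst hj
      rw [hx, map_zero, map_zero]
    · by_cases hs : (proj 𝒜 e i).ρ (e j) x = 0
      · rw [hs, map_zero, map_zero]
      · refine ρ_ρ_ρ_ne h _ (fun hji => ?_) hj a x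
        rcases InSupp.eq_or_precedes h ⟨x, hs⟩ with rfl | hij
        · exact hj rfl
        · exact lt_asymm (hij.lt h) (hji.lt h)

theorem mem_radProj (h : 𝒜.IsStrict e) {i : J} {x : (proj 𝒜 e i).carrier} :
    x ∈ radProj h i ↔ (proj 𝒜 e i).ρ (e i) x = 0 := Iff.rfl

theorem projGen_mem_of_not_mem (h : 𝒜.IsStrict e) {i : J}
    {P : Submodule 𝒜.Abar (proj 𝒜 e i).carrier}
    {x : (proj 𝒜 e i).carrier} (hx : x ∈ P) (hx' : x ∉ radProj h i) : projGen e i ∈ P := by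
  obtain ⟨c, hc⟩ := exists_smul_projGen h i x
  rw [mem_radProj, hc] at hx'
  have hc0 : c ≠ 0 := by rintro rfl; exact hx' (zero_smul _ _)
  have : c • projGen e i ∈ P := by
    rw [← hc]; exact P.smul_mem (Ideal.Quotient.mk 𝒜.ideal (e i)) hx
  have := P.smul_of_tower_mem c⁻¹ this
  rwa [smul_smul, inv_mul_cancel₀ hc0, one_smul] at this

/-- The radical of `(A/I) eᵢ` is its largest proper submodule. -/
theorem jacobson_proj (h : 𝒜.IsStrict e) (i : J) :
    Module.jacobson 𝒜.Abar (proj 𝒜 e i).carrier = radProj h i := by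
  have hgen : projGen e i ∉ radProj h i := by
    rw [mem_radProj, ρ_projGen h]; exact projGen_ne_zero h i
  refine le_antisymm (sInf_le ⟨fun ht => hgen (ht ▸ Submodule.mem_top), fun P hP => ?_⟩)
    (le_sInf fun P hP => ?_)
  · obtain ⟨x, hx, hx'⟩ := SetLike.exists_of_lt hP
    exact eq_top_of_projGen_mem (projGen_mem_of_not_mem h hx hx')
  · by_contra hle
    have : P ⊔ radProj h i = ⊤ := hP.2 _ (left_lt_sup.2 hle)
    obtain ⟨x, hx, y, hy, hxy⟩ := Submodule.mem_sup.1 (this ▸ Submodule.mem_top (x := projGen e i))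
    refine hP.1 (eq_top_of_projGen_mem (projGen_mem_of_not_mem h hx fun hx' => hgen ?_))
    rw [← hxy]
    exact add_mem hx' hy

theorem ker_toSimple (h : 𝒜.IsStrict e) (i : J) : LinearMap.ker (toSimple e i) = radProj h i := by
  rw [← jacobson_proj h i]; exact Submodule.ker_mkQ _

theorem simpleGen_ne_zero (h : 𝒜.IsStrict e) (i : J) : simpleGen e i ≠ 0 := by
  intro h0
  have : projGen e i ∈ LinearMap.ker (toSimple e i) := h0
  rw [ker_toSimple h, mem_radProj, ρ_projGen h] at this
  exact projGen_ne_zero h i this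

theorem ρ_simpleGen (h : 𝒜.IsStrict e) (i : J) :
    (simple 𝒜 e i).ρ (e i) (simpleGen e i) = simpleGen e i := by
  rw [simpleGen, ρ_map, ρ_projGen h]

theorem exists_smul_simpleGen (h : 𝒜.IsStrict e) (i : J) (s : (simple 𝒜 e i).carrier) :
    ∃ c : k, s = c • simpleGen e i := by
  obtain ⟨x, rfl⟩ := toSimple_surjective e i s
  obtain ⟨c, hc⟩ := exists_smul_projGen h i x
  refine ⟨c, ?_⟩
  rw [simpleGen, ← LinearMap.map_smul_of_tower, ← hc, ← sub_eq_zero, ← map_sub]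
  change x - _ ∈ LinearMap.ker (toSimple e i)
  rw [ker_toSimple h, mem_radProj, map_sub, ρ_ρ_same h, sub_self]

theorem ρ_simple (h : 𝒜.IsStrict e) (i : J) (s : (simple 𝒜 e i).carrier) :
    (simple 𝒜 e i).ρ (e i) s = s := by
  obtain ⟨c, rfl⟩ := exists_smul_simpleGen h i s
  rw [map_smul, ρ_simpleGen h]

theorem inSupp_simple (h : 𝒜.IsStrict e) {i j : J} : InSupp e (simple 𝒜 e i) j ↔ j = i := by
  constructor
  · rintro ⟨s, hs⟩
    by_contra hne
    rw [← ρ_simple h i s, ρ_ρ_ne h _ hne] at hs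
    exact hs rfl
  · rintro rfl
    exact ⟨simpleGen e j, by rw [ρ_simpleGen h]; exact simpleGen_ne_zero h j⟩

theorem finrank_simple (h : 𝒜.IsStrict e) (i : J) :
    Module.finrank k (simple 𝒜 e i).carrier = 1 :=
  finrank_eq_one (simpleGen e i) (simpleGen_ne_zero h i) fun s => by
    obtain ⟨c, hc⟩ := exists_smul_simpleGen h i s
    exact ⟨c, hc.symm⟩

theorem IsStrict.finite_proj (h : 𝒜.IsStrict e) (i : J) : Module.Finite k (proj 𝒜 e i).carrier := by
  have := h.finite_Abar
  exact Module.Finite.of_injective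
    ((Submodule.span 𝒜.Abar {Ideal.Quotient.mk 𝒜.ideal (e i)}).subtype.restrictScalars k)
    Subtype.val_injective

theorem IsStrict.finite_simple (h : 𝒜.IsStrict e) (i : J) :
    Module.Finite k (simple 𝒜 e i).carrier := by
  have := h.finite_proj i
  exact Module.Finite.of_surjective ((toSimple e i).restrictScalars k) (toSimple_surjective e i)

/-- A module maps onto `Sᵢ` whenever `i` is minimal in its support. -/
theorem exists_surjective_simple (h : 𝒜.IsStrict e) (M : Mod 𝒜) {i : J} (hi : InSupp e M i)
    (hmin : ∀ l, InSupp e M l → ¬ l < i) :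
    ∃ φ : M.carrier →ₗ[𝒜.Abar] (simple 𝒜 e i).carrier, Function.Surjective φ := by
  obtain ⟨m, hm⟩ := hi
  obtain ⟨lam, hlam⟩ : ∃ lam : Module.Dual k M.carrier, lam (M.ρ (e i) m) ≠ 0 := by
    by_contra! hne
    exact hm ((Module.forall_dual_apply_eq_zero_iff k _).1 hne)
  have key : ∀ (a : 𝒜.A) (x : M), M.ρ (e i) (M.ρ a x) = M.ρ (e i) (M.ρ a (M.ρ (e i) x)) := by
    intro a x
    conv_lhs => rw [← sum_ρ h M x, map_sum, map_sum]
    refine Finset.sum_eq_single i (fun l _ hl => ?_) fun hi => absurd (Finset.mem_univ i) hi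
    by_cases hs : M.ρ (e l) x = 0
    · rw [hs, map_zero, map_zero]
    · exact ρ_ρ_ρ_ne h M (fun hli => hmin l ⟨x, hs⟩ (hli.lt h)) (Ne.symm hl) a x
  refine ⟨{ toFun := fun x => lam (M.ρ (e i) x) • simpleGen e i, map_add' := fun x y => ?_,
            map_smul' := fun b x => ?_ }, fun s => ?_⟩
  · rw [map_add, map_add, add_smul]
  · obtain ⟨a, rfl⟩ := Ideal.Quotient.mk_surjective (I := 𝒜.ideal) b
    obtain ⟨c, hc⟩ := exists_ρ_ρ_ρ_same h a i
    change lam (M.ρ (e i) (M.ρ a x)) • simpleGen e i =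
      (simple 𝒜 e i).ρ a (lam (M.ρ (e i) x) • simpleGen e i)
    have e1 : (simple 𝒜 e i).ρ a (simpleGen e i) = c • simpleGen e i := by
      have := hc (simple 𝒜 e i) (simpleGen e i)
      rwa [ρ_simpleGen h, ρ_simple h] at this
    rw [key, hc, map_smul, map_smul, e1, smul_smul, smul_eq_mul, mul_comm]
  · obtain ⟨c, rfl⟩ := exists_smul_simpleGen h i s
    refine ⟨(c * (lam (M.ρ (e i) m))⁻¹) • m, ?_⟩
    change lam (M.ρ (e i) _) • simpleGen e i = _
    rw [map_smul, map_smul, smul_eq_mul, mul_assoc, inv_mul_cancel₀ hlam, mul_one]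

theorem exists_minimal_inSupp (h : 𝒜.IsStrict e) (M : Mod 𝒜) [Nontrivial M.carrier] :
    ∃ i, InSupp e M i ∧ ∀ l, InSupp e M l → ¬ l < i := by
  classical
  obtain ⟨i, hi⟩ := exists_inSupp h M
  obtain ⟨j, hj, hmin⟩ := (Finset.univ.filter (InSupp e M)).exists_minimal ⟨i, by simpa using hi⟩
  refine ⟨j, by simpa using hj, fun l hl hlt => ?_⟩
  exact hlt.not_ge (hmin (by simpa using hl) hlt.le)

end TriangularInterlacedDitalgebra

/-! ### Indecomposable relative projectives -/

namespace TriangularInterlacedDitalgebra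

variable {k T : Type u} [Field k] [Ring T] [Algebra k T] {J : Type v}
variable {𝒜 : TriangularInterlacedDitalgebra k T}

open TriangularInterlacedDitalgebra.Mod

namespace Mod

theorem isZero_iff_subsingleton (M : Mod 𝒜) : IsZero M ↔ Subsingleton M.carrier := by
  rw [IsZero.iff_id_eq_zero]
  constructor
  · intro h
    refine ⟨fun x y => ?_⟩
    have : ∀ x : M, x = 0 := LinearMap.congr_fun (congrArg Hom.f0 h)
    rw [this x, this y]
  · intro h
    exact hom_ext (LinearMap.ext fun _ => Subsingleton.elim _ _)
      (LinearMap.ext fun _ => LinearMap.ext fun _ => Subsingleton.elim _ _)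

theorem nontrivial_of_not_isZero {M : Mod 𝒜} (h : ¬ IsZero M) : Nontrivial M.carrier := by
  rwa [isZero_iff_subsingleton, not_subsingleton_iff_nontrivial] at h

theorem injective_f0_of_retract {X Y : Mod 𝒜} (s : Y ⟶ X) (t : X ⟶ Y) (h : s ≫ t = 𝟙 Y) :
    Function.Injective (Hom.f0 s) :=
  Function.LeftInverse.injective (LinearMap.congr_fun (congrArg Hom.f0 h))

theorem finite_of_retract {X Y : Mod 𝒜} [Module.Finite k X] (s : Y ⟶ X) (t : X ⟶ Y)
    (h : s ≫ t = 𝟙 Y) : Module.Finite k Y :=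
  Module.Finite.of_injective (Hom.f0 s) (injective_f0_of_retract s t h)

theorem inl_retract {X Y Z : Mod 𝒜} (a : X ≅ Y ⊞ Z) :
    (biprod.inl ≫ a.inv) ≫ (a.hom ≫ biprod.fst) = 𝟙 Y := by simp

theorem inr_retract {X Y Z : Mod 𝒜} (a : X ≅ Y ⊞ Z) :
    (biprod.inr ≫ a.inv) ≫ (a.hom ≫ biprod.snd) = 𝟙 Z := by simp

theorem total_retract {X Y Z : Mod 𝒜} (a : X ≅ Y ⊞ Z) :
    (a.hom ≫ biprod.fst) ≫ (biprod.inl ≫ a.inv) + (a.hom ≫ biprod.snd) ≫ (biprod.inr ≫ a.inv) =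
      𝟙 X := by
  have : a.hom ≫ (biprod.fst ≫ biprod.inl + biprod.snd ≫ biprod.inr) ≫ a.inv = 𝟙 X := by
    rw [biprod.total, Category.id_comp, Iso.hom_inv_id]
  simpa only [Preadditive.add_comp, Preadditive.comp_add, Category.assoc] using this

/-- The vector space underlying a direct sum. -/
def biprodEquiv {X Y Z : Mod 𝒜} (a : X ≅ Y ⊞ Z) : X ≃ₗ[k] Y × Z :=
  LinearEquiv.ofLinearMap
    ((Hom.f0 (a.hom ≫ biprod.fst)).prod (Hom.f0 (a.hom ≫ biprod.snd)))
    ((Hom.f0 (biprod.inl ≫ a.inv)).coprod (Hom.f0 (biprod.inr ≫ a.inv)))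
    (by
      have h1 := congrArg Hom.f0 (inl_retract a)
      have h2 := congrArg Hom.f0 (inr_retract a)
      have h3 : Hom.f0 ((biprod.inl ≫ a.inv) ≫ (a.hom ≫ biprod.snd)) = 0 :=
        congrArg Hom.f0 (show (biprod.inl ≫ a.inv) ≫ (a.hom ≫ biprod.snd) = 0 by simp)
      have h4 : Hom.f0 ((biprod.inr ≫ a.inv) ≫ (a.hom ≫ biprod.fst)) = 0 :=
        congrArg Hom.f0 (show (biprod.inr ≫ a.inv) ≫ (a.hom ≫ biprod.fst) = 0 by simp)
      rw [hom_comp_f0] at h1 h2 h3 h4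
      refine LinearMap.ext fun p => Prod.ext ?_ ?_
      · have e1 := LinearMap.congr_fun h1 p.1
        have e4 := LinearMap.congr_fun h4 p.2
        rw [LinearMap.comp_apply] at e1 e4
        change Hom.f0 (a.hom ≫ biprod.fst) (Hom.f0 (biprod.inl ≫ a.inv) p.1 +
          Hom.f0 (biprod.inr ≫ a.inv) p.2) = p.1
        rw [map_add, e1, e4]
        exact add_zero _
      · have e2 := LinearMap.congr_fun h2 p.2
        have e3 := LinearMap.congr_fun h3 p.1
        rw [LinearMap.comp_apply] at e2 e3
        change Hom.f0 (a.hom ≫ biprod.snd) (Hom.f0 (biprod.inl ≫ a.inv) p.1 +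
          Hom.f0 (biprod.inr ≫ a.inv) p.2) = p.2
        rw [map_add, e2, e3]
        exact zero_add _)
    (by
      have h := congrArg Hom.f0 (total_retract a)
      exact LinearMap.ext fun x => LinearMap.congr_fun h x)

theorem finrank_biprod {X Y Z : Mod 𝒜} [Module.Finite k X] (a : X ≅ Y ⊞ Z) :
    Module.finrank k X = Module.finrank k Y + Module.finrank k Z := by
  have := finite_of_retract _ _ (inl_retract a)
  have := finite_of_retract _ _ (inr_retract a)
  rw [(biprodEquiv a).finrank_eq, Module.finrank_prod]

theorem finrank_pos_of_not_isZero {X : Mod 𝒜} [Module.Finite k X] (h : ¬ IsZero X) :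
    0 < Module.finrank k X := by
  have := nontrivial_of_not_isZero h
  exact Module.finrank_pos

end Mod

variable {e : J → 𝒜.A}

/-- A decomposition of each `(A/I) eᵢ` into an indecomposable object `Qᵢ` with `eᵢ Qᵢ ≠ 0` and
a complement. -/
structure ProjDecomposition (e : J → 𝒜.A) where
  Q : J → 𝒜.Mod
  Y : J → 𝒜.Mod
  iso : ∀ i, proj 𝒜 e i ≅ Q i ⊞ Y i
  indecomposable : ∀ i, Indecomposable (Q i)
  inSupp : ∀ i, InSupp e (Q i) i

namespace ProjDecomposition

variable (D : ProjDecomposition e)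

/-- The inclusion `Qᵢ → (A/I) eᵢ`. -/
def inc (i : J) : D.Q i ⟶ proj 𝒜 e i := biprod.inl ≫ (D.iso i).inv

/-- The projection `(A/I) eᵢ → Qᵢ`. -/
def pr (i : J) : proj 𝒜 e i ⟶ D.Q i := (D.iso i).hom ≫ biprod.fst

theorem inc_pr (i : J) : D.inc i ≫ D.pr i = 𝟙 _ := inl_retract _

end ProjDecomposition

variable [Fintype J] [Preorder J]

/-- `(A/I) eᵢ` is a retract of `A/I`. -/
theorem proj_retract_regular (h : 𝒜.IsStrict e) (i : J) :
    (ofLinear (Submodule.span 𝒜.Abar {Ideal.Quotient.mk 𝒜.ideal (e i)}).subtype :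
      proj 𝒜 e i ⟶ 𝒜.regular) ≫ ofElement (projGen e i) = 𝟙 (proj 𝒜 e i) := by
  have hi : Ideal.Quotient.mk 𝒜.ideal (e i) * Ideal.Quotient.mk 𝒜.ideal (e i) =
      Ideal.Quotient.mk 𝒜.ideal (e i) := by rw [← map_mul, h.idempotents.idem i]
  refine (ofLinear_comp (N := 𝒜.regular) _ _).trans (Eq.trans ?_ (ofLinear_id _))
  refine congrArg ofLinear (LinearMap.ext fun x => Subtype.ext ?_)
  obtain ⟨b, hb⟩ := Submodule.mem_span_singleton.1 x.2
  change (x.1 : 𝒜.Abar) * Ideal.Quotient.mk 𝒜.ideal (e i) = x.1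
  rw [← hb, smul_eq_mul, mul_assoc, hi]

theorem proj_isEProjective (h : 𝒜.IsStrict e) (i : J) : (proj 𝒜 e i).IsEProjective :=
  regular_isEProjective.of_retract _ _ (proj_retract_regular h i)

theorem InSupp.of_biprod (h : 𝒜.IsStrict e) {X Y Z : Mod 𝒜} (a : X ≅ Y ⊞ Z) {i : J}
    (hi : InSupp e X i) : InSupp e Y i ∨ InSupp e Z i := by
  obtain ⟨x, hx⟩ := hi
  by_contra! hne
  apply hx
  have hY : Hom.f0 (a.hom ≫ biprod.fst) (X.ρ (e i) x) = 0 := by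
    rw [← hom_f0_R _ _ (h.e_mem_R i)]
    by_contra h0
    exact hne.1 ⟨_, h0⟩
  have hZ : Hom.f0 (a.hom ≫ biprod.snd) (X.ρ (e i) x) = 0 := by
    rw [← hom_f0_R _ _ (h.e_mem_R i)]
    by_contra h0
    exact hne.2 ⟨_, h0⟩
  exact (biprodEquiv a).injective ((Prod.ext hY hZ : biprodEquiv a _ = 0).trans (map_zero _).symm)

/-- Some indecomposable retract of `X` carries a given vertex of the support. -/
theorem exists_indecomposable_retract (h : 𝒜.IsStrict e) (i : J) (n : ℕ) (X : Mod 𝒜)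
    [Module.Finite k X] (hn : Module.finrank k X ≤ n) (hi : InSupp e X i) :
    ∃ (Q : Mod 𝒜) (s : Q ⟶ X) (t : X ⟶ Q), s ≫ t = 𝟙 Q ∧ Indecomposable Q ∧ InSupp e Q i := by
  induction n generalizing X with
  | zero =>
    obtain ⟨x, hx⟩ := hi
    have := Module.finrank_zero_iff.1 (Nat.le_zero.1 hn)
    exact absurd (Subsingleton.elim _ _) hx
  | succ n ih =>
    by_cases hX : Indecomposable X
    · exact ⟨X, 𝟙 X, 𝟙 X, Category.id_comp _, hX, hi⟩
    · have hX0 : ¬ IsZero X := by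
        intro h0
        have := (isZero_iff_subsingleton X).1 h0
        obtain ⟨x, hx⟩ := hi
        exact hx (Subsingleton.elim _ _)
      have : ∃ Y Z, ∃ a : X ≅ Y ⊞ Z, ¬ IsZero Y ∧ ¬ IsZero Z := by
        by_contra! hne
        exact hX ⟨hX0, fun Y Z a => or_iff_not_imp_left.2 fun hY => not_not.1 fun hZ =>
          hZ (hne Y Z a hY)⟩
      obtain ⟨Y, Z, a, hY, hZ⟩ := this
      have := finite_of_retract _ _ (inl_retract a)
      have := finite_of_retract _ _ (inr_retract a)
      have hd := finrank_biprod a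
      have hY' := finrank_pos_of_not_isZero hY
      have hZ' := finrank_pos_of_not_isZero hZ
      rcases hi.of_biprod h a with hi | hi
      · obtain ⟨Q, s, t, hst, hQ, hQi⟩ := ih Y (by omega) hi
        refine ⟨Q, s ≫ biprod.inl ≫ a.inv, (a.hom ≫ biprod.fst) ≫ t, ?_, hQ, hQi⟩
        simpa using hst
      · obtain ⟨Q, s, t, hst, hQ, hQi⟩ := ih Z (by omega) hi
        refine ⟨Q, s ≫ biprod.inr ≫ a.inv, (a.hom ≫ biprod.snd) ≫ t, ?_, hQ, hQi⟩
        simpa using hst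

theorem IsStrict.nonempty_projDecomposition (h : 𝒜.IsStrict e) :
    Nonempty (ProjDecomposition e) := by
  have : ∀ i, ∃ Q Y : 𝒜.Mod, Nonempty (proj 𝒜 e i ≅ Q ⊞ Y) ∧ Indecomposable Q ∧
      InSupp e Q i := by
    intro i
    have := h.finite_proj i
    obtain ⟨Q, s, t, hst, hQ, hQi⟩ :=
      exists_indecomposable_retract h i _ (proj 𝒜 e i) le_rfl (inSupp_proj h i)
    obtain ⟨Y, a⟩ := exists_iso_biprod_of_retract s t hst
    exact ⟨Q, Y, a, hQ, hQi⟩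
  choose Q Y a hQ hQi using this
  exact ⟨⟨Q, Y, fun i => (a i).some, hQ, hQi⟩⟩

namespace ProjDecomposition

variable (D : ProjDecomposition e)

theorem finite (h : 𝒜.IsStrict e) (i : J) : Module.Finite k (D.Q i).carrier :=
  have := h.finite_proj i
  finite_of_retract _ _ (D.inc_pr i)

theorem isEProjective (h : 𝒜.IsStrict e) (i : J) : (D.Q i).IsEProjective :=
  (proj_isEProjective h i).of_retract _ _ (D.inc_pr i)

theorem eq_or_precedes (h : 𝒜.IsStrict e) {i j : J} (hj : InSupp e (D.Q i) j) :
    j = i ∨ 𝒜.Precedes e i j :=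
  (hj.of_injective h _ (injective_f0_of_retract _ _ (D.inc_pr i))).eq_or_precedes h

/-- As `eᵢ (A/I) eᵢ` is one-dimensional, the complement of `Qᵢ` does not involve the vertex `i`. -/
theorem precedes_of_inSupp (h : 𝒜.IsStrict e) {i j : J} (hj : InSupp e (D.Y i) j) :
    𝒜.Precedes e i j := by
  have hY := inr_retract (D.iso i)
  refine ((hj.of_injective h _ (injective_f0_of_retract _ _ hY)).eq_or_precedes h).resolve_left ?_
  rintro rfl
  obtain ⟨y, hy⟩ := hj
  obtain ⟨q, hq⟩ := D.inSupp j
  obtain ⟨c, hc⟩ := exists_smul_projGen h j (Hom.f0 (D.inc j) q)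
  obtain ⟨c', hc'⟩ := exists_smul_projGen h j (Hom.f0 (biprod.inr ≫ (D.iso j).inv) y)
  rw [hom_f0_R _ _ (h.e_mem_R j)] at hc hc'
  have e1 : Hom.f0 (D.pr j) (Hom.f0 (D.inc j) ((D.Q j).ρ (e j) q)) = (D.Q j).ρ (e j) q :=
    LinearMap.congr_fun (congrArg Hom.f0 (D.inc_pr j)) _
  have e2 : Hom.f0 (D.pr j) (Hom.f0 (biprod.inr ≫ (D.iso j).inv) ((D.Y j).ρ (e j) y)) = 0 := by
    have : (biprod.inr ≫ (D.iso j).inv) ≫ D.pr j = 0 := by simp [pr]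
    exact LinearMap.congr_fun (congrArg Hom.f0 this) _
  rw [hc, map_smul] at e1
  rw [hc', map_smul] at e2
  have hg : Hom.f0 (D.pr j) (projGen e j) ≠ 0 := by
    intro h0
    rw [h0, smul_zero] at e1
    exact hq e1.symm
  have hc0 : c' = 0 := (smul_eq_zero.1 e2).resolve_right hg
  rw [hc0, zero_smul] at hc'
  exact hy (injective_f0_of_retract _ _ hY (hc'.trans (map_zero _).symm))

/-- The map `Qᵢ → (A/I) eᵢ → Sᵢ`. -/
def top (i : J) : D.Q i ⟶ simple 𝒜 e i := D.inc i ≫ ofLinear (toSimple e i)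

theorem top_ne_zero (h : 𝒜.IsStrict e) (i : J) : D.top i ≠ 0 := by
  intro h0
  obtain ⟨q, hq⟩ := D.inSupp i
  obtain ⟨c, hc⟩ := exists_smul_projGen h i (Hom.f0 (D.inc i) q)
  rw [hom_f0_R _ _ (h.e_mem_R i)] at hc
  have e1 : toSimple e i (Hom.f0 (D.inc i) ((D.Q i).ρ (e i) q)) = 0 :=
    LinearMap.congr_fun (congrArg Hom.f0 h0) _
  rw [hc, LinearMap.map_smul_of_tower] at e1
  have hc0 : c = 0 := (smul_eq_zero.1 e1).resolve_right (simpleGen_ne_zero h i)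
  rw [hc0, zero_smul] at hc
  exact hq (injective_f0_of_retract _ _ (D.inc_pr i) (hc.trans (map_zero _).symm))

/-- The projection `(A/I) eᵢ → Sᵢ` only sees the summand `Qᵢ`. -/
theorem pr_top (h : 𝒜.IsStrict e) (i : J) : D.pr i ≫ D.top i = ofLinear (toSimple e i) := by
  have h0 : (biprod.inr ≫ (D.iso i).inv) ≫
      (ofLinear (toSimple e i) : proj 𝒜 e i ⟶ simple 𝒜 e i) = 0 := by
    by_contra hne
    obtain ⟨l, j, hl, hj, hlj⟩ := exists_inSupp_le h hne
    rw [inSupp_simple h] at hj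
    subst hj
    exact ((D.precedes_of_inSupp h hl).lt h).not_ge hlj
  have := congrArg (· ≫ (ofLinear (toSimple e i) : proj 𝒜 e i ⟶ simple 𝒜 e i))
    (total_retract (D.iso i))
  simp only [Preadditive.add_comp, Category.id_comp] at this
  rw [Category.assoc _ (biprod.inr ≫ _), h0, comp_zero, add_zero, Category.assoc] at this
  exact this

theorem nilpotentOrIso (h : 𝒜.IsStrict e) (i : J) : NilpotentOrIso (D.Q i) :=
  have := D.finite h i
  have := h.finite_End (D.Q i)
  (D.indecomposable i).nilpotentOrIso k

/-- If `j` is minimal in the support of an `ℰ`-projective object `X`, then `Qⱼ` is a direct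
summand of `X`: both map onto `Sⱼ`, and lift these maps to one another. -/
theorem exists_retract (h : 𝒜.IsStrict e) (X : Mod 𝒜) [Module.Finite k X] (hX : X.IsEProjective)
    {j : J} (hj : InSupp e X j) (hmin : ∀ l, InSupp e X l → ¬ l < j) :
    ∃ (s : D.Q j ⟶ X) (t : X ⟶ D.Q j), s ≫ t = 𝟙 _ := by
  obtain ⟨φ, hφ⟩ := exists_surjective_simple h X hj hmin
  have := h.finite_proj j
  obtain ⟨t, ht⟩ := hX.exists_lift h (toSimple e j) (toSimple_surjective e j) (ofLinear φ)
  obtain ⟨s, hs⟩ := (D.isEProjective h j).exists_lift h φ hφ (D.top j)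
  obtain ⟨t', ht'⟩ := (D.nilpotentOrIso h j).exists_retract s (t ≫ D.pr j) (D.top j)
    (D.top_ne_zero h j) (by rw [Category.assoc, D.pr_top h, ht, hs])
  exact ⟨s, t', ht'⟩

/-- Splitting off summands `Qⱼ` with `j` minimal in the support, every finite-dimensional
`ℰ`-projective object is a direct sum of objects `Qⱼ`. -/
theorem exists_iso_biproduct (h : 𝒜.IsStrict e) (p : J → Prop) (n : ℕ) (X : Mod 𝒜)
    [Module.Finite k X] (hn : Module.finrank k X ≤ n) (hX : X.IsEProjective)
    (hp : ∀ l, InSupp e X l → p l) :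
    ∃ (m : ℕ) (σ : Fin m → J), (∀ l, p (σ l)) ∧ Nonempty (X ≅ ⨁ fun l => D.Q (σ l)) := by
  have zero_case : IsZero X → ∃ (m : ℕ) (σ : Fin m → J), (∀ l, p (σ l)) ∧
      Nonempty (X ≅ ⨁ fun l => D.Q (σ l)) := by
    intro h0
    refine ⟨0, Fin.elim0, fun l => l.elim0, ⟨h0.iso ?_⟩⟩
    rw [IsZero.iff_id_eq_zero, ← biproduct.total]
    rfl
  induction n generalizing X with
  | zero =>
    have := Module.finrank_zero_iff.1 (Nat.le_zero.1 hn)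
    exact zero_case ((isZero_iff_subsingleton X).2 this)
  | succ n ih =>
    by_cases hX0 : IsZero X
    · exact zero_case hX0
    · have := nontrivial_of_not_isZero hX0
      obtain ⟨j, hj, hmin⟩ := exists_minimal_inSupp h X
      obtain ⟨s, t, hst⟩ := D.exists_retract h X hX hj hmin
      obtain ⟨X', ⟨a⟩⟩ := exists_iso_biprod_of_retract s t hst
      have hr := inr_retract a
      have := finite_of_retract _ _ hr
      have := D.finite h j
      have hd := finrank_biprod a
      have hQ := finrank_pos_of_not_isZero (D.indecomposable j).1
      have hX' : X'.IsEProjective := hX.of_retract _ _ hr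
      have hp' : ∀ l, InSupp e X' l → p l := fun l hl =>
        hp l (hl.of_injective h _ (injective_f0_of_retract _ _ hr))
      obtain ⟨m, σ, hσ, ⟨b⟩⟩ := ih X' (by omega) hX' hp' fun h0 =>
        ⟨0, Fin.elim0, fun l => l.elim0, ⟨h0.iso (by
          rw [IsZero.iff_id_eq_zero, ← biproduct.total]
          rfl)⟩⟩
      refine ⟨m + 1, Fin.cons j σ, fun l => ?_, ⟨a ≪≫ biprod.mapIso (Iso.refl _) b ≪≫
        (biproductFinSucc fun l => D.Q (Fin.cons (α := fun _ => J) j σ l)).symm⟩⟩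
      refine Fin.cases ?_ (fun l => ?_) l
      · exact hp j hj
      · exact hσ l

/-- The objects `Qᵢ` are told apart by their supports: `i` is the smallest vertex occurring in `Qᵢ`. -/
theorem isIndecEProjFamily (h : 𝒜.IsStrict e) : 𝒜.IsIndecEProjFamily e D.Q where
  finite := D.finite h
  indecomposable := D.indecomposable
  projective := D.isEProjective h
  eq_of_iso i j := by
    rintro ⟨a⟩
    have h1 : InSupp e (D.Q j) i := (D.inSupp i).of_injective h a.hom
      (bijective_f0_of_isIso a.hom).1
    have h2 : InSupp e (D.Q i) j := (D.inSupp j).of_injective h a.inv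
      (bijective_f0_of_isIso a.inv).1
    rcases D.eq_or_precedes h h1 with rfl | hji
    · rfl
    · rcases D.eq_or_precedes h h2 with rfl | hij
      · rfl
      · exact absurd (hij.lt h) (lt_asymm (hji.lt h))
  complete M hM hMp hMi := by
    have := nontrivial_of_not_isZero hMi.1
    obtain ⟨j, hj, hmin⟩ := exists_minimal_inSupp h M
    obtain ⟨s, t, hst⟩ := D.exists_retract h M hMp hj hmin
    obtain ⟨Z, ⟨a⟩⟩ := exists_iso_biprod_of_retract s t hst
    rcases hMi.2 _ _ a with h0 | h0
    · exact absurd h0 (D.indecomposable j).1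
    · exact ⟨j, ⟨a ≪≫ (isoBiprodZero h0).symm⟩⟩
  decomposition i := by
    have := h.finite_proj i
    have hr := inr_retract (D.iso i)
    have := finite_of_retract _ _ hr
    obtain ⟨m, σ, hσ, ⟨b⟩⟩ := D.exists_iso_biproduct h (𝒜.Precedes e i) _ (D.Y i) le_rfl
      ((proj_isEProjective h i).of_retract _ _ hr) fun l hl => D.precedes_of_inSupp h hl
    exact ⟨m, σ, hσ, ⟨D.iso i ≪≫ biprod.mapIso (Iso.refl _) b⟩⟩

end ProjDecomposition

end TriangularInterlacedDitalgebra

/-! ### Projective modules over the right algebra -/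

namespace TriangularInterlacedDitalgebra

variable {k T : Type u} [Field k] [Ring T] [Algebra k T] {J : Type v}
variable {𝒜 : TriangularInterlacedDitalgebra k T}

open TriangularInterlacedDitalgebra.Mod

theorem _root_.CategoryTheory.Indecomposable.of_iso {C : Type*} [Category C]
    [Preadditive C] [HasBinaryBiproducts C] {X Y : C} (hX : Indecomposable X) (a : X ≅ Y) :
    Indecomposable Y :=
  ⟨fun h0 => hX.1 (h0.of_iso a), fun U V b => hX.2 U V (a ≪≫ b)⟩

/-- `Hom(A/I, A/I)` is the free `Γ`-module of rank one. -/
def regularEquiv (𝒜 : TriangularInterlacedDitalgebra k T) :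
    𝒜.Γ ≃ₗ[𝒜.Γ] ((homΓ 𝒜).obj 𝒜.regular) where
  toFun γ := γ.unop
  invFun f := MulOpposite.op f
  map_add' _ _ := rfl
  map_smul' _ _ := rfl
  left_inv _ := rfl
  right_inv _ := rfl

theorem homΓ_map_retract {X Y : Mod 𝒜} (s : Y ⟶ X) (t : X ⟶ Y) (hst : s ≫ t = 𝟙 Y) :
    ((homΓ 𝒜).map t).hom ∘ₗ ((homΓ 𝒜).map s).hom = LinearMap.id := by
  rw [← ModuleCat.hom_comp, ← Functor.map_comp, hst, CategoryTheory.Functor.map_id]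
  rfl

theorem homΓ_projective_of_retract {X Y : Mod 𝒜} (s : Y ⟶ X) (t : X ⟶ Y) (hst : s ≫ t = 𝟙 Y)
    (hX : Module.Projective 𝒜.Γ ((homΓ 𝒜).obj X)) : Module.Projective 𝒜.Γ ((homΓ 𝒜).obj Y) :=
  Module.Projective.of_split _ _ (homΓ_map_retract s t hst)

theorem homΓ_finite_of_retract {X Y : Mod 𝒜} (s : Y ⟶ X) (t : X ⟶ Y) (hst : s ≫ t = 𝟙 Y)
    (hX : Module.Finite 𝒜.Γ ((homΓ 𝒜).obj X)) : Module.Finite 𝒜.Γ ((homΓ 𝒜).obj Y) :=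
  Module.Finite.of_surjective ((homΓ 𝒜).map t).hom
    (Function.RightInverse.surjective (LinearMap.congr_fun (homΓ_map_retract s t hst)))

variable {e : J → 𝒜.A}

theorem IsIndecEProjFamily.retract {Q : J → 𝒜.Mod} (hQ : 𝒜.IsIndecEProjFamily e Q) (i : J) :
    ∃ (s : Q i ⟶ proj 𝒜 e i) (t : proj 𝒜 e i ⟶ Q i), s ≫ t = 𝟙 _ := by
  obtain ⟨n, σ, -, ⟨a⟩⟩ := hQ.decomposition i
  exact ⟨_, _, inl_retract a⟩

theorem _root_.IsCompleteIndecProj.of_iso {Λ : Type u} [Ring Λ] {P P' : J → ModuleCat.{u} Λ}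
    (hP : IsCompleteIndecProj Λ P) (a : ∀ i, P i ≅ P' i) : IsCompleteIndecProj Λ P' where
  finite i := have := hP.finite i; Module.Finite.equiv (a i).toLinearEquiv
  projective i := have := hP.projective i; Module.Projective.of_equiv (a i).toLinearEquiv
  indecomposable i := (hP.indecomposable i).of_iso (a i)
  eq_of_iso i j := fun ⟨b⟩ => hP.eq_of_iso i j ⟨a i ≪≫ b ≪≫ (a j).symm⟩
  complete M hM hMi := by
    obtain ⟨i, ⟨b⟩⟩ := hP.complete M hM hMi
    exact ⟨i, ⟨b ≪≫ a i⟩⟩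

theorem exists_lift_of_projective {Λ : Type u} [Ring Λ] {P M Z : ModuleCat.{u} Λ}
    [Module.Projective Λ P] (q : M ⟶ Z) (hq : Function.Surjective q.hom) (θ : P ⟶ Z) :
    ∃ s : P ⟶ M, s ≫ q = θ := by
  obtain ⟨s, hs⟩ := Module.projective_lifting_property q.hom θ.hom hq
  exact ⟨ModuleCat.ofHom s, ModuleCat.hom_ext hs⟩

variable [Fintype J] [Preorder J]

theorem homΓ_proj_projective (h : 𝒜.IsStrict e) (i : J) :
    Module.Projective 𝒜.Γ ((homΓ 𝒜).obj (proj 𝒜 e i)) :=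
  homΓ_projective_of_retract _ _ (proj_retract_regular h i)
    (Module.Projective.of_equiv (regularEquiv 𝒜))

theorem homΓ_proj_finite (h : 𝒜.IsStrict e) (i : J) :
    Module.Finite 𝒜.Γ ((homΓ 𝒜).obj (proj 𝒜 e i)) :=
  homΓ_finite_of_retract _ _ (proj_retract_regular h i)
    (Module.Finite.equiv (regularEquiv 𝒜))

/-- The functor `Hom(A/I, -)` identifies endomorphism rings, hence preserves indecomposability. -/
theorem homΓ_nilpotentOrIso (h : 𝒜.IsStrict e) {M : Mod 𝒜} [Module.Finite k M]
    (hM : NilpotentOrIso M) : NilpotentOrIso ((homΓ 𝒜).obj M) := by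
  intro f
  obtain ⟨(g : End M), rfl⟩ := homΓ_full h f
  rcases hM g with ⟨n, hn⟩ | hu
  · refine Or.inl ⟨n, ?_⟩
    have := (map_pow ((homΓ 𝒜).mapEnd M) g n).symm
    rw [hn] at this
    exact this.trans ((homΓ 𝒜).map_zero M M)
  · exact Or.inr (hu.map ((homΓ 𝒜).mapEnd M))

theorem homΓ_not_isZero {M : Mod 𝒜} (hM : ¬ IsZero M) : ¬ IsZero ((homΓ 𝒜).obj M) := by
  rw [IsZero.iff_id_eq_zero] at hM ⊢
  intro h0
  refine hM (homΓ_faithful ?_)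
  rw [CategoryTheory.Functor.map_id, h0, Functor.map_zero]

theorem IsStrict.nilpotentOrIso (h : 𝒜.IsStrict e) {M : Mod 𝒜} [Module.Finite k M]
    (hM : Indecomposable M) : NilpotentOrIso M :=
  have := h.finite_End M
  hM.nilpotentOrIso k

theorem homΓ_indecomposable (h : 𝒜.IsStrict e) {M : Mod 𝒜} [Module.Finite k M]
    (hM : Indecomposable M) : Indecomposable ((homΓ 𝒜).obj M) :=
  (homΓ_nilpotentOrIso h (h.nilpotentOrIso hM)).indecomposable (homΓ_not_isZero hM.1)

theorem nonempty_iso_of_homΓ (h : 𝒜.IsStrict e) {M N : Mod 𝒜} [Module.Finite k M]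
    [Module.Finite k N] (a : (homΓ 𝒜).obj M ≅ (homΓ 𝒜).obj N) : Nonempty (M ≅ N) := by
  obtain ⟨f, hf⟩ := homΓ_full h a.hom
  obtain ⟨g, hg⟩ := homΓ_full h a.inv
  refine ⟨⟨f, g, homΓ_faithful ?_, homΓ_faithful ?_⟩⟩
  · rw [Functor.map_comp, hf, hg, a.hom_inv_id, CategoryTheory.Functor.map_id]
  · rw [Functor.map_comp, hf, hg, a.inv_hom_id, CategoryTheory.Functor.map_id]

/-- The object `A/I` is the direct sum of the objects `(A/I) eᵢ`. -/
theorem sum_ofElement_projGen (h : 𝒜.IsStrict e) :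
    ∑ i, (ofElement (projGen e i) : 𝒜.regular ⟶ proj 𝒜 e i) ≫
      (ofLinear (Submodule.span 𝒜.Abar {Ideal.Quotient.mk 𝒜.ideal (e i)}).subtype :
        proj 𝒜 e i ⟶ 𝒜.regular) = 𝟙 𝒜.regular := by
  have e1 : ∀ i, (ofElement (projGen e i) : 𝒜.regular ⟶ proj 𝒜 e i) ≫
      (ofLinear (Submodule.span 𝒜.Abar {Ideal.Quotient.mk 𝒜.ideal (e i)}).subtype :
        proj 𝒜 e i ⟶ 𝒜.regular) = 𝒜.rightMul (Ideal.Quotient.mk 𝒜.ideal (e i)) := fun i =>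
    ofElement_comp_ofLinear _ _
  rw [Finset.sum_congr rfl fun i _ => e1 i, ← rightMul_one, ← map_one (Ideal.Quotient.mk 𝒜.ideal),
    ← h.idempotents.complete, map_sum]
  exact (map_sum (AddMonoidHom.mk' 𝒜.rightMul 𝒜.rightMul_add) _ _).symm

/-- A nonzero projective module over a left noetherian ring has a simple quotient: a nonzero linear
form on it has a finitely generated image. -/
theorem exists_simple_quotient {Λ : Type u} [Ring Λ] [IsNoetherianRing Λ] (M : ModuleCat.{u} Λ)
    [Module.Projective Λ M] (hM : ¬ IsZero M) :
    ∃ (Z : ModuleCat.{u} Λ) (q : M ⟶ Z), IsSimpleModule Λ Z ∧ Function.Surjective q.hom := by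
  have : Nontrivial M := by
    by_contra hn
    rw [not_nontrivial_iff_subsingleton] at hn
    exact hM (ModuleCat.isZero_of_subsingleton M)
  obtain ⟨x, hx⟩ := exists_ne (0 : M)
  obtain ⟨s, hs⟩ := Module.Projective.out (R := Λ) (P := M)
  have hsx : s x ≠ 0 := fun h0 => hx (by rw [← hs x, h0, map_zero])
  obtain ⟨p, hp⟩ := Finsupp.ne_iff.1 hsx
  let f : M →ₗ[Λ] Λ := Finsupp.lapply p ∘ₗ s
  have hf : (f.rangeRestrict x : LinearMap.range f) ≠ 0 := fun h0 => hp (congrArg Subtype.val h0)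
  have : Nontrivial (LinearMap.range f) := ⟨⟨_, _, hf⟩⟩
  obtain ⟨N, hN, -⟩ := (eq_top_or_exists_le_coatom (⊥ : Submodule Λ (LinearMap.range f))).resolve_left
    bot_ne_top
  refine ⟨ModuleCat.of Λ (LinearMap.range f ⧸ N), ModuleCat.ofHom (N.mkQ ∘ₗ f.rangeRestrict),
    isSimpleModule_iff_isCoatom.2 hN, ?_⟩
  exact N.mkQ_surjective.comp f.surjective_rangeRestrict

/-- The modules `Hom(A/I, Qⱼ)` generate: `Γ` is a direct summand of a sum of them. -/
theorem exists_homΓ_ne_zero (h : 𝒜.IsStrict e) {Q : J → 𝒜.Mod} (hQ : 𝒜.IsIndecEProjFamily e Q)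
    (Z : ModuleCat.{u} 𝒜.Γ) [Nontrivial Z] : ∃ j, ∃ θ : (homΓ 𝒜).obj (Q j) ⟶ Z, θ ≠ 0 := by
  by_contra! hne
  have hP : ∀ i (θ : (homΓ 𝒜).obj (proj 𝒜 e i) ⟶ Z), θ = 0 := by
    intro i θ
    obtain ⟨n, σ, -, ⟨a⟩⟩ := hQ.decomposition i
    have h1 : (homΓ 𝒜).map (biprod.inl ≫ a.inv) ≫ θ = 0 := hne i _
    have h2 : (homΓ 𝒜).map (biprod.inr ≫ a.inv) ≫ θ = 0 := by
      have h3 : ∀ l, (homΓ 𝒜).map (biproduct.ι (fun l => Q (σ l)) l ≫ biprod.inr ≫ a.inv) ≫ θ = 0 :=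
        fun l => hne (σ l) _
      have e1 := congrArg (fun f => (homΓ 𝒜).map (f ≫ biprod.inr ≫ a.inv) ≫ θ)
        (biproduct.total (f := fun l => Q (σ l)))
      simp only [Category.id_comp] at e1
      rw [← e1, Preadditive.sum_comp, Functor.map_sum, Preadditive.sum_comp]
      refine Finset.sum_eq_zero fun l _ => ?_
      rw [Category.assoc, Functor.map_comp, Category.assoc, h3, comp_zero]
    have e2 := congrArg (fun f => (homΓ 𝒜).map f ≫ θ) (total_retract a)
    simp only [CategoryTheory.Functor.map_id, Category.id_comp] at e2
    rw [← e2, Functor.map_add, Preadditive.add_comp, Functor.map_comp _ (a.hom ≫ biprod.fst),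
      Functor.map_comp _ (a.hom ≫ biprod.snd), Category.assoc, Category.assoc, h1, h2,
      comp_zero, comp_zero, add_zero]
  obtain ⟨z, hz⟩ := exists_ne (0 : Z)
  let θ : (𝒜.regular ⟶ 𝒜.regular) →ₗ[𝒜.Γ] Z :=
    LinearMap.toSpanSingleton 𝒜.Γ Z z ∘ₗ (regularEquiv 𝒜).symm.toLinearMap
  have hθ : θ (𝟙 𝒜.regular) = z := one_smul _ z
  apply hz
  rw [← hθ, ← sum_ofElement_projGen h, map_sum]
  refine Finset.sum_eq_zero fun i _ => ?_
  have := hP i ((homΓ 𝒜).map (ofLinear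
    (Submodule.span 𝒜.Abar {Ideal.Quotient.mk 𝒜.ideal (e i)}).subtype :
      proj 𝒜 e i ⟶ 𝒜.regular) ≫ ModuleCat.ofHom θ)
  exact LinearMap.congr_fun (congrArg ModuleCat.Hom.hom this) (ofElement (projGen e i))

/-- The modules `Hom(A/I, Qᵢ)` exhaust the indecomposable projectives: an indecomposable projective
module and some `Hom(A/I, Qⱼ)` share a simple quotient. -/
theorem isCompleteIndecProj_homΓ (h : 𝒜.IsStrict e) {Q : J → 𝒜.Mod}
    (hQ : 𝒜.IsIndecEProjFamily e Q) :
    IsCompleteIndecProj 𝒜.Γ (fun i => (homΓ 𝒜).obj (Q i)) := by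
  have hproj : ∀ i, Module.Projective 𝒜.Γ ((homΓ 𝒜).obj (Q i)) := fun i => by
    obtain ⟨s, t, hst⟩ := hQ.retract i
    exact homΓ_projective_of_retract s t hst (homΓ_proj_projective h i)
  refine ⟨fun i => ?_, hproj, fun i => ?_, fun i j => ?_, fun M hM hMi => ?_⟩
  · obtain ⟨s, t, hst⟩ := hQ.retract i
    exact homΓ_finite_of_retract s t hst (homΓ_proj_finite h i)
  · have := hQ.finite i
    exact homΓ_indecomposable h (hQ.indecomposable i)
  · rintro ⟨a⟩
    have := hQ.finite i
    have := hQ.finite j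
    exact hQ.eq_of_iso i j (nonempty_iso_of_homΓ h a)
  · have := h.finite_Γ
    have : IsNoetherianRing 𝒜.Γ := isNoetherian_of_tower k inferInstance
    obtain ⟨Z, q, hZ, hq⟩ := exists_simple_quotient M hMi.1
    have := IsSimpleModule.nontrivial 𝒜.Γ Z
    obtain ⟨j, θ, hθ⟩ := exists_homΓ_ne_zero h hQ Z
    have hθ' : Function.Surjective θ.hom :=
      LinearMap.surjective_of_ne_zero fun h0 => hθ (ModuleCat.hom_ext h0)
    obtain ⟨t, ht⟩ := exists_lift_of_projective θ hθ' q
    have := hproj j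
    obtain ⟨s, hs⟩ := exists_lift_of_projective q hq θ
    have := hQ.finite j
    exact ⟨j, (homΓ_nilpotentOrIso h (h.nilpotentOrIso (hQ.indecomposable j))).nonempty_iso hMi
      s t θ hθ (by rw [ht, hs])⟩

theorem isCompleteIndecProj_induced (h : 𝒜.IsStrict e) {Q : J → 𝒜.Mod}
    (hQ : 𝒜.IsIndecEProjFamily e Q) :
    IsCompleteIndecProj 𝒜.Γ (fun i => 𝒜.induced (Q i)) :=
  (isCompleteIndecProj_homΓ h hQ).of_iso fun i =>
    have := h.finite_Abar
    have := hQ.finite i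
    (inducedIso h (Q i)).symm

end TriangularInterlacedDitalgebra

/-! ### Filtrations -/

/-- The image of a filtration under an injective map has the same factors. -/
theorem Submodule.nonempty_quotient_map_equiv {Λ M N : Type*} [Ring Λ] [AddCommGroup M] [Module Λ M]
    [AddCommGroup N] [Module Λ N] (f : M →ₗ[Λ] N) (hf : Function.Injective f)
    (U U' : Submodule Λ M) :
    Nonempty ((U.map f ⧸ (U'.map f).submoduleOf (U.map f)) ≃ₗ[Λ] (U ⧸ U'.submoduleOf U)) := by
  let a := Submodule.equivMapOfInjective f hf U
  refine ⟨(Submodule.Quotient.equiv (U'.submoduleOf U) _ a ?_).symm⟩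
  ext y
  obtain ⟨x, rfl⟩ := a.surjective y
  rw [Submodule.mem_map_equiv, a.symm_apply_apply]
  change (x : M) ∈ U' ↔ f x ∈ U'.map f
  exact (hf.mem_set_image (s := (U' : Set M))).symm

section

variable {Λ : Type u} [Ring Λ] {J : Type v} {Δ Δ' : J → ModuleCat.{u} Λ}

theorem HasDeltaFiltration.of_subsingleton (M : Type u) [AddCommGroup M] [Module Λ M]
    [Subsingleton M] : HasDeltaFiltration Δ M :=
  ⟨0, fun _ => ⊤, rfl, Subsingleton.elim _ _, fun _ hj => absurd hj (Nat.not_lt_zero _)⟩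

theorem HasDeltaFiltration.of_linearEquiv {M N : Type u} [AddCommGroup M] [Module Λ M]
    [AddCommGroup N] [Module Λ N] (a : M ≃ₗ[Λ] N) (hM : HasDeltaFiltration Δ M) :
    HasDeltaFiltration Δ N := by
  obtain ⟨t, F, h0, ht, hF⟩ := hM
  refine ⟨t, fun j => (F j).map a.toLinearMap, ?_, ?_, fun j hj => ?_⟩
  · change (F 0).map a.toLinearMap = ⊤
    rw [h0, Submodule.map_top, LinearMap.range_eq_top.2 a.surjective]
  · change (F t).map a.toLinearMap = ⊥
    rw [ht, Submodule.map_bot]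
  · obtain ⟨hle, i, ⟨b⟩⟩ := hF j hj
    obtain ⟨c⟩ := Submodule.nonempty_quotient_map_equiv a.toLinearMap a.injective (F j) (F (j + 1))
    exact ⟨Submodule.map_mono hle, i, ⟨c.trans b⟩⟩

theorem HasDeltaFiltration.congr {M : Type u} [AddCommGroup M] [Module Λ M]
    (hM : HasDeltaFiltration Δ M) (a : ∀ i, Δ i ≅ Δ' i) : HasDeltaFiltration Δ' M := by
  obtain ⟨t, F, h0, ht, hF⟩ := hM
  refine ⟨t, F, h0, ht, fun j hj => ?_⟩
  obtain ⟨hle, i, ⟨b⟩⟩ := hF j hj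
  exact ⟨hle, i, ⟨b.trans (a i).toLinearEquiv⟩⟩

/-- An extension of some `Δᵢ` by a filtered module is filtered. -/
theorem HasDeltaFiltration.of_exact {K M : Type u} [AddCommGroup K] [Module Λ K] [AddCommGroup M]
    [Module Λ M] (hK : HasDeltaFiltration Δ K) (f : K →ₗ[Λ] M) (hf : Function.Injective f) {i : J}
    (g : M →ₗ[Λ] Δ i) (hg : Function.Surjective g) (hfg : LinearMap.range f = LinearMap.ker g) :
    HasDeltaFiltration Δ M := by
  obtain ⟨t, F, h0, ht, hF⟩ := hK
  refine ⟨t + 1, fun j => Nat.casesOn j ⊤ fun j => (F j).map f, rfl, ?_, fun j hj => ?_⟩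
  · change (F t).map f = ⊥
    rw [ht, Submodule.map_bot]
  · cases j with
    | zero =>
      refine ⟨le_top, i, ?_⟩
      change Nonempty (((⊤ : Submodule Λ M) ⧸ ((F 0).map f).submoduleOf ⊤) ≃ₗ[Λ] Δ i)
      have hs : Function.Surjective (g ∘ₗ (⊤ : Submodule Λ M).subtype) := fun z => by
        obtain ⟨m, rfl⟩ := hg z
        exact ⟨⟨m, trivial⟩, rfl⟩
      refine ⟨(Submodule.quotEquivOfEq _ _ ?_).trans (LinearMap.quotKerEquivOfSurjective _ hs)⟩
      rw [h0, Submodule.map_top, hfg, LinearMap.ker_comp]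
      rfl
    | succ j =>
      obtain ⟨hle, i, ⟨b⟩⟩ := hF j (Nat.lt_of_succ_lt_succ hj)
      obtain ⟨c⟩ := Submodule.nonempty_quotient_map_equiv f hf (F j) (F (j + 1))
      exact ⟨Submodule.map_mono hle, i, ⟨c.trans b⟩⟩

theorem Abelian.Ext.nontrivial_of_iso {C : Type*} [Category C] [Abelian C] [HasExt.{v} C]
    {X X' Y Y' : C} (a : X ≅ X') (b : Y ≅ Y') {n : ℕ} (hn : Nontrivial (Abelian.Ext X Y n)) :
    Nontrivial (Abelian.Ext X' Y' n) := by
  let c := ((Abelian.extFunctor n).mapIso a.symm.op).app Y ≪≫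
    ((Abelian.extFunctor n).obj (Opposite.op X')).mapIso b
  have : Nontrivial (((Abelian.extFunctor n).obj (Opposite.op X)).obj Y) := hn
  exact (c.addCommGroupIsoToAddEquiv.toEquiv).symm.nontrivial

/-- If every morphism from the kernel of a projective presentation extends to the presentation,
then the first extension group vanishes. -/
theorem Abelian.Ext.eq_zero_of_extension {C : Type*} [Category C] [Abelian C] [HasExt.{v} C]
    {S : ShortComplex C} (hS : S.ShortExact) (Y : C) [Projective S.X₂]
    (hY : ∀ f : S.X₁ ⟶ Y, ∃ g : S.X₂ ⟶ Y, S.f ≫ g = f) (x : Abelian.Ext S.X₃ Y 1) : x = 0 := by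
  obtain ⟨y, rfl⟩ := Abelian.Ext.contravariant_sequence_exact₃ hS _ x
    (Abelian.Ext.eq_zero_of_projective (n := 0) _) (add_comm 1 0)
  obtain ⟨f, rfl⟩ := Abelian.Ext.addEquiv₀.symm.surjective y
  obtain ⟨g, rfl⟩ := hY f
  have e1 : Abelian.Ext.addEquiv₀.symm (S.f ≫ g) =
      (Abelian.Ext.mk₀ S.f).comp (Abelian.Ext.mk₀ g) (zero_add 0) := by
    rw [Abelian.Ext.mk₀_comp_mk₀]
    rfl
  rw [e1]
  exact hS.extClass_comp_assoc _

theorem Abelian.Ext.eq_zero_of_shift {C : Type*} [Category C] [Abelian C] [HasExt.{v} C]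
    {S : ShortComplex C} (hS : S.ShortExact) (Y : C) [Projective S.X₂] (n : ℕ)
    (hn : ∀ y : Abelian.Ext S.X₁ Y n, y = 0) (x : Abelian.Ext S.X₃ Y (n + 1)) : x = 0 := by
  obtain ⟨y, rfl⟩ := Abelian.Ext.contravariant_sequence_exact₃ hS _ x
    (Abelian.Ext.eq_zero_of_projective _) (add_comm 1 n)
  rw [hn y, Abelian.Ext.comp_zero]

theorem IsStrictHomologicalSystem.of_iso {k : Type u} [Field k] [Algebra k Λ] [Preorder J]
    (hΔ : IsStrictHomologicalSystem k Λ Δ) (a : ∀ i, Δ i ≅ Δ' i) :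
    IsStrictHomologicalSystem k Λ Δ' where
  finiteDimensional := hΔ.finiteDimensional
  finite_index := hΔ.finite_index
  nonempty_index := hΔ.nonempty_index
  finite i := have := hΔ.finite i; Module.Finite.equiv (a i).toLinearEquiv
  indecomposable i := (hΔ.indecomposable i).of_iso (a i)
  eq_of_iso i j := fun ⟨b⟩ => hΔ.eq_of_iso i j ⟨a i ≪≫ b ≪≫ (a j).symm⟩
  hom i j _ := hΔ.hom i j ((a i).homCongr (a j)).nontrivial
  ext i j hn := hΔ.ext i j (Abelian.Ext.nontrivial_of_iso (a i).symm (a j).symm hn)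
  filtration := hΔ.filtration.congr a
  card := hΔ.card
  ext_all n hn1 i j hn :=
    hΔ.ext_all n hn1 i j (Abelian.Ext.nontrivial_of_iso (a i).symm (a j).symm hn)

end

namespace TriangularInterlacedDitalgebra

variable {k T : Type u} [Field k] [Ring T] [Algebra k T] {J : Type v}
variable {𝒜 : TriangularInterlacedDitalgebra k T}

open TriangularInterlacedDitalgebra.Mod

variable {e : J → 𝒜.A}

theorem InSupp.nontrivial {M : Mod 𝒜} {i : J} (hi : InSupp e M i) : Nontrivial M.carrier := by
  obtain ⟨m, hm⟩ := hi
  exact ⟨_, _, hm⟩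

variable [Fintype J] [Preorder J]

theorem not_isZero_simple (h : 𝒜.IsStrict e) (i : J) : ¬ IsZero (simple 𝒜 e i) := by
  rw [isZero_iff_subsingleton, not_subsingleton_iff_nontrivial]
  exact ((inSupp_simple h).2 rfl).nontrivial

theorem simple_indecomposable (h : 𝒜.IsStrict e) (i : J) : Indecomposable (simple 𝒜 e i) := by
  refine ⟨not_isZero_simple h i, fun Y Z a => ?_⟩
  by_contra! hne
  have := h.finite_simple i
  have := finite_of_retract _ _ (inl_retract a)
  have := finite_of_retract _ _ (inr_retract a)
  have h1 := finrank_pos_of_not_isZero hne.1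
  have h2 := finrank_pos_of_not_isZero hne.2
  have h3 := finrank_biprod a
  rw [finrank_simple h] at h3
  omega

theorem finrank_ker_lt (h : 𝒜.IsStrict e) {M : Mod 𝒜} [Module.Finite k M] {i : J}
    (φ : M.carrier →ₗ[𝒜.Abar] (simple 𝒜 e i).carrier) (hφ : Function.Surjective φ) :
    Module.finrank k (LinearMap.ker φ) < Module.finrank k M := by
  have h1 := LinearMap.finrank_range_add_finrank_ker (φ.restrictScalars k)
  rw [(LinearMap.range_eq_top (f := φ.restrictScalars k)).2 hφ, finrank_top,
    finrank_simple h] at h1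
  change 1 + Module.finrank k (LinearMap.ker φ) = _ at h1
  omega

/-- Filtering a module by simple modules filters its image under `Hom(A/I, -)`. -/
theorem homΓ_hasDeltaFiltration (h : 𝒜.IsStrict e) (n : ℕ) (M : Mod 𝒜) [Module.Finite k M]
    (hn : Module.finrank k M ≤ n) :
    HasDeltaFiltration (fun i => (homΓ 𝒜).obj (simple 𝒜 e i)) ((homΓ 𝒜).obj M) := by
  induction n generalizing M with
  | zero =>
    have := Module.finrank_zero_iff.1 (Nat.le_zero.1 hn)
    have h0 := (homΓ 𝒜).map_isZero ((isZero_iff_subsingleton M).2 this)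
    have := ModuleCat.subsingleton_of_isZero h0
    exact HasDeltaFiltration.of_subsingleton _
  | succ n ih =>
    by_cases hM : Nontrivial M.carrier
    · obtain ⟨i, hi, hmin⟩ := exists_minimal_inSupp h M
      obtain ⟨φ, hφ⟩ := exists_surjective_simple h M hi hmin
      have : Module.Finite k (LinearMap.ker φ) :=
        Module.Finite.of_injective ((LinearMap.ker φ).subtype.restrictScalars k)
          Subtype.val_injective
      have hlt := finrank_ker_lt h φ hφ
      have hS := homΓ_shortExact h φ hφ
      have h1 := ih (of 𝒜 (LinearMap.ker φ)) (Nat.le_of_lt_succ (hlt.trans_le hn))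
      refine h1.of_exact _ ((ModuleCat.mono_iff_injective _).1 hS.mono_f) (i := i) _
        ((ModuleCat.epi_iff_surjective _).1 hS.epi_g) ?_
      exact ((ShortComplex.moduleCat_exact_iff_range_eq_ker _).1 hS.exact)
    · rw [not_nontrivial_iff_subsingleton] at hM
      have h0 := (homΓ 𝒜).map_isZero ((isZero_iff_subsingleton M).2 hM)
      have := ModuleCat.subsingleton_of_isZero h0
      exact HasDeltaFiltration.of_subsingleton _

/-! ### Extensions -/

theorem ρ_of_mem_ker_toSimple (h : 𝒜.IsStrict e) {l : J} {x : (proj 𝒜 e l).carrier}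
    (hx : x ∈ LinearMap.ker (toSimple e l)) : (proj 𝒜 e l).ρ (e l) x = 0 := by
  rwa [ker_toSimple h, mem_radProj] at hx

/-- The radical of `(A/I) eₗ` is supported on successors of `l`. -/
theorem InSupp.precedes_of_ker (h : 𝒜.IsStrict e) {l i : J}
    (hi : InSupp e (of 𝒜 (LinearMap.ker (toSimple e l))) i) : 𝒜.Precedes e l i := by
  have hi' : InSupp e (proj 𝒜 e l) i := hi.of_injective h
    (ofLinear (LinearMap.ker (toSimple e l)).subtype) Subtype.val_injective
  refine (hi'.eq_or_precedes h).resolve_left ?_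
  rintro rfl
  obtain ⟨x, hx⟩ := hi
  apply hx
  exact Subtype.ext (ρ_of_mem_ker_toSimple h x.2)

/-- Unless `l < j`, every morphism from the radical of `(A/I) eₗ` to `Sⱼ` extends to `(A/I) eₗ`: its
first component vanishes for reasons of support, and the second one can be prescribed freely. -/
theorem exists_extension (h : 𝒜.IsStrict e) {l j : J} (hlj : ¬ l < j)
    (f : of 𝒜 (LinearMap.ker (toSimple e l)) ⟶ simple 𝒜 e j) :
    ∃ g : proj 𝒜 e l ⟶ simple 𝒜 e j, ofLinear (LinearMap.ker (toSimple e l)).subtype ≫ g = f := by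
  have f0 : ∀ (f : of 𝒜 (LinearMap.ker (toSimple e l)) ⟶ simple 𝒜 e j) x, Hom.f0 f x = 0 := by
    intro f x
    rw [← ρ_simple h j (Hom.f0 f x), hom_f0_R f _ (h.e_mem_R j)]
    by_contra hne
    exact hlj ((InSupp.precedes_of_ker h ⟨x, fun h0 => hne (by rw [h0, map_zero])⟩).lt h)
  -- the projection onto the radical along the line spanned by `eₗ`
  let p : proj 𝒜 e l →ₗ[k] LinearMap.ker (toSimple e l) :=
    (LinearMap.id - (proj 𝒜 e l).ρ (e l)).codRestrict
      ((LinearMap.ker (toSimple e l)).restrictScalars k) fun x => by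
        rw [Submodule.restrictScalars_mem, ker_toSimple h, mem_radProj, LinearMap.sub_apply, map_sub,
          ρ_ρ_same h]
        exact sub_self _
  have hp : ∀ x, (p x : (proj 𝒜 e l).carrier) = x - (proj 𝒜 e l).ρ (e l) x := fun x => rfl
  have hp_ker : ∀ x : LinearMap.ker (toSimple e l), p x = x := by
    intro x
    apply Subtype.ext
    rw [hp, ρ_of_mem_ker_toSimple h x.2, sub_zero]
  have hpR := comm_R_of_comm_e h (M := proj 𝒜 e l) (N := of 𝒜 (LinearMap.ker (toSimple e l))) p
    fun i x => Subtype.ext (by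
      change (p _ : (proj 𝒜 e l).carrier) = (proj 𝒜 e l).ρ (e i) (p x : (proj 𝒜 e l).carrier)
      rw [hp, hp, map_sub]
      by_cases hi : i = l
      · rw [hi]
      · rw [ρ_ρ_ne h _ hi, ρ_ρ_ne h _ (Ne.symm hi)])
  let q : 𝒜.Abar →ₗ[k] LinearMap.ker (toSimple e l) :=
    p ∘ₗ Hom.f0 (ofElement (projGen e l) : 𝒜.regular ⟶ proj 𝒜 e l)
  have hqR : ∀ (a : 𝒜.A), (a : T) ∈ 𝒜.R → ∀ x : 𝒜.Abar,
      q (𝒜.regular.ρ a x) = (of 𝒜 (LinearMap.ker (toSimple e l))).ρ a (q x) := by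
    intro a ha x
    exact (congrArg p (hom_f0_R (ofElement (projGen e l) : 𝒜.regular ⟶ proj 𝒜 e l)
      a ha x).symm).trans (hpR a ha _)
  have hq_ker : ∀ x : LinearMap.ker (toSimple e l), q (x.1.1 : 𝒜.Abar) = x := by
    intro x
    have : Hom.f0 (ofElement (projGen e l) : 𝒜.regular ⟶ proj 𝒜 e l) (x.1.1 : 𝒜.Abar) = x.1 :=
      LinearMap.congr_fun (congrArg Hom.f0 (proj_retract_regular h l)) x.1
    change p _ = x
    rw [this, hp_ker]
  let ψ : 𝒜.W₁ →ₗ[k] 𝒜.Abar →ₗ[k] simple 𝒜 e j :=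
    LinearMap.lcomp k _ q ∘ₗ Hom.f1 f ∘ₗ Submodule.inclusion 𝒜.isLayer.W₁_le
  have hψ : WeakDitalgebra.IsRBimod 𝒜.R 𝒜.regular.ρ (simple 𝒜 e j).ρ ψ := by
    intro r hr w w'
    have := WeakDitalgebra.IsBimod.isRBimod (R := 𝒜.R) f.bimod 𝒜.isLayer.W₁_le r hr w w'
    refine ⟨fun hw => LinearMap.ext fun x => ?_, fun hw => LinearMap.ext fun x => ?_⟩
    · exact LinearMap.congr_fun (this.1 hw) (q x)
    · refine (LinearMap.congr_fun (this.2 hw) (q x)).trans ?_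
      exact congrArg (Hom.f1 f (Submodule.inclusion 𝒜.isLayer.W₁_le w)) (hqR r hr x).symm
  obtain ⟨F, -, hF⟩ := exists_regular_hom (N := simple 𝒜 e j) 0 ψ hψ
  refine ⟨(ofLinear (Submodule.span 𝒜.Abar {Ideal.Quotient.mk 𝒜.ideal (e l)}).subtype :
      proj 𝒜 e l ⟶ 𝒜.regular) ≫ F, ?_⟩
  refine hom_ext_W₁ (LinearMap.ext fun x => by rw [f0, f0]) fun v hv => LinearMap.ext fun x => ?_
  refine (ofLinear_comp_f1 _ _ _ _).trans ((ofLinear_comp_f1 _ _ _ _).trans ?_)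
  refine (LinearMap.congr_fun (hF ⟨v, hv⟩) _).trans ?_
  exact congrArg (Hom.f1 f v) (hq_ker x)

/-- Dimension shift along `0 → rad((A/I) eₗ) → (A/I) eₗ → Sₗ → 0`. -/
theorem ext_simple_eq_zero (h : 𝒜.IsStrict e) {l j : J} (hlj : ¬ l < j) (n : ℕ)
    (hn : n = 0 ∨ ∀ y : Abelian.Ext ((homΓ 𝒜).obj (of 𝒜 (LinearMap.ker (toSimple e l))))
      ((homΓ 𝒜).obj (simple 𝒜 e j)) n, y = 0)
    (x : Abelian.Ext ((homΓ 𝒜).obj (simple 𝒜 e l)) ((homΓ 𝒜).obj (simple 𝒜 e j)) (n + 1)) :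
    x = 0 := by
  have hS := homΓ_shortExact h (toSimple e l) (toSimple_surjective e l)
  have : Projective ((homΓ 𝒜).obj (proj 𝒜 e l)) :=
    (IsProjective.iff_projective _).1 (homΓ_proj_projective h l)
  rcases hn with rfl | hn
  · refine Abelian.Ext.eq_zero_of_extension hS _ (fun θ => ?_) x
    have := h.finite_proj l
    have : Module.Finite k (LinearMap.ker (toSimple e l)) :=
      Module.Finite.of_injective ((LinearMap.ker (toSimple e l)).subtype.restrictScalars k)
        Subtype.val_injective
    obtain ⟨f, rfl⟩ := homΓ_full h (M := of 𝒜 (LinearMap.ker (toSimple e l))) θ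
    obtain ⟨g, rfl⟩ := exists_extension h hlj f
    exact ⟨(homΓ 𝒜).map g, ((homΓ 𝒜).map_comp _ _).symm⟩
  · exact Abelian.Ext.eq_zero_of_shift hS _ n hn x

/-- Dévissage along a filtration of `M` with simple factors. -/
theorem ext_eq_zero_of_simple (h : 𝒜.IsStrict e) (j : J) (n : ℕ)
    (hS : ∀ l, ¬ l < j → ∀ x : Abelian.Ext ((homΓ 𝒜).obj (simple 𝒜 e l))
      ((homΓ 𝒜).obj (simple 𝒜 e j)) (n + 1), x = 0)
    (d : ℕ) (M : Mod 𝒜) [Module.Finite k M]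
    (hd : Module.finrank k M ≤ d) (hM : ∀ l, InSupp e M l → ¬ l < j)
    (x : Abelian.Ext ((homΓ 𝒜).obj M) ((homΓ 𝒜).obj (simple 𝒜 e j)) (n + 1)) : x = 0 := by
  have zero_case : Subsingleton M.carrier → x = 0 := fun hM0 => by
    have := ((homΓ 𝒜).map_isZero ((isZero_iff_subsingleton M).2 hM0)).projective
    exact Abelian.Ext.eq_zero_of_projective x
  induction d generalizing M with
  | zero => exact zero_case (Module.finrank_zero_iff.1 (Nat.le_zero.1 hd))
  | succ d ih =>
    by_cases hM0 : Nontrivial M.carrier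
    · obtain ⟨l, hl, hmin⟩ := exists_minimal_inSupp h M
      obtain ⟨φ, hφ⟩ := exists_surjective_simple h M hl hmin
      have : Module.Finite k (LinearMap.ker φ) :=
        Module.Finite.of_injective ((LinearMap.ker φ).subtype.restrictScalars k)
          Subtype.val_injective
      have hlt := finrank_ker_lt h φ hφ
      have hE := homΓ_shortExact h φ hφ
      have hM' : ∀ i, InSupp e (of 𝒜 (LinearMap.ker φ)) i → ¬ i < j := fun i hi =>
        hM i (hi.of_injective h (ofLinear (LinearMap.ker φ).subtype) Subtype.val_injective)
      obtain ⟨y, rfl⟩ := Abelian.Ext.contravariant_sequence_exact₂ hE _ x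
        (ih (of 𝒜 (LinearMap.ker φ)) (Nat.le_of_lt_succ (hlt.trans_le hd)) hM' _ fun h0 => by
          have := ((homΓ 𝒜).map_isZero ((isZero_iff_subsingleton (of 𝒜 (LinearMap.ker φ))).2
            h0)).projective
          exact Abelian.Ext.eq_zero_of_projective _)
      rw [hS l (hM l hl) y, Abelian.Ext.comp_zero]
    · exact zero_case (not_nontrivial_iff_subsingleton.1 hM0)

/-- If no vertex of the support of `M` is smaller than `j`, then `Hom(A/I, M)` has no higher
extensions by `Hom(A/I, Sⱼ)`. -/
theorem ext_eq_zero (h : 𝒜.IsStrict e) (j : J) (n : ℕ) (M : Mod 𝒜) [Module.Finite k M]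
    (hM : ∀ l, InSupp e M l → ¬ l < j)
    (x : Abelian.Ext ((homΓ 𝒜).obj M) ((homΓ 𝒜).obj (simple 𝒜 e j)) (n + 1)) : x = 0 := by
  induction n generalizing M with
  | zero =>
    exact ext_eq_zero_of_simple h j 0 (fun l hl => ext_simple_eq_zero h hl 0 (Or.inl rfl)) _ M le_rfl
      hM x
  | succ n ih =>
    refine ext_eq_zero_of_simple h j (n + 1) (fun l hl => ext_simple_eq_zero h hl (n + 1)
      (Or.inr fun y => ?_)) _ M le_rfl hM x
    have := h.finite_proj l
    have : Module.Finite k (LinearMap.ker (toSimple e l)) :=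
      Module.Finite.of_injective ((LinearMap.ker (toSimple e l)).subtype.restrictScalars k)
        Subtype.val_injective
    exact ih (of 𝒜 (LinearMap.ker (toSimple e l)))
      (fun i hi hij => hl (((hi.precedes_of_ker h).lt h).trans hij)) y

/-! ### The homological system -/

theorem ext_simple_lt (h : 𝒜.IsStrict e) (n : ℕ) (hn : 1 ≤ n) (i j : J)
    (hx : Nontrivial (Abelian.Ext ((homΓ 𝒜).obj (simple 𝒜 e i)) ((homΓ 𝒜).obj (simple 𝒜 e j)) n)) :
    i < j := by
  by_contra hij
  obtain ⟨n, rfl⟩ := Nat.exists_eq_add_of_le' hn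
  obtain ⟨x, hx⟩ := exists_ne (0 : Abelian.Ext ((homΓ 𝒜).obj (simple 𝒜 e i))
    ((homΓ 𝒜).obj (simple 𝒜 e j)) (n + 1))
  have := h.finite_simple i
  refine hx (ext_eq_zero h j n (simple 𝒜 e i) (fun l hl => ?_) x)
  rwa [(inSupp_simple h).1 hl]

theorem isStrictHomologicalSystem_homΓ [Nonempty J] (h : 𝒜.IsStrict e) :
    IsStrictHomologicalSystem k 𝒜.Γ (fun i => (homΓ 𝒜).obj (simple 𝒜 e i)) where
  finiteDimensional := h.finite_Γ
  finite_index := inferInstance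
  nonempty_index := inferInstance
  finite i := by
    have := h.finite_Abar
    have := h.finite_simple i
    have : Module.Finite k (𝒜.regular ⟶ simple 𝒜 e i) := h.finite_hom _ _
    exact Module.Finite.of_restrictScalars_finite k 𝒜.Γ (𝒜.regular ⟶ simple 𝒜 e i)
  indecomposable i := have := h.finite_simple i; homΓ_indecomposable h (simple_indecomposable h i)
  eq_of_iso i j := fun ⟨a⟩ => by
    have := h.finite_simple i
    have := h.finite_simple j
    obtain ⟨b⟩ := nonempty_iso_of_homΓ h a
    exact (inSupp_simple h).1 (((inSupp_simple h).2 rfl).of_injective h b.hom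
      (bijective_f0_of_isIso b.hom).1)
  hom i j hij := by
    obtain ⟨θ, hθ⟩ := exists_ne (0 : (homΓ 𝒜).obj (simple 𝒜 e i) ⟶ (homΓ 𝒜).obj (simple 𝒜 e j))
    have := h.finite_simple i
    obtain ⟨f, rfl⟩ := homΓ_full h θ
    have hf : f ≠ 0 := fun h0 => hθ (by rw [h0, Functor.map_zero])
    obtain ⟨i', j', hi, hj, hle⟩ := exists_inSupp_le h hf
    rwa [(inSupp_simple h).1 hi, (inSupp_simple h).1 hj] at hle
  ext i j := ext_simple_lt h 1 le_rfl i j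
  filtration := by
    have := h.finite_Abar
    exact (homΓ_hasDeltaFiltration h _ 𝒜.regular le_rfl).of_linearEquiv (regularEquiv 𝒜).symm
  card := by
    obtain ⟨D⟩ := h.nonempty_projDecomposition
    exact ⟨_, isCompleteIndecProj_homΓ h (D.isIndecEProjFamily h)⟩
  ext_all := ext_simple_lt h

end TriangularInterlacedDitalgebra

theorem mainTheorem5 {k T : Type u} [Field k] [IsAlgClosed k] [Ring T] [Algebra k T]
    {J : Type v} [Fintype J] [Nonempty J] [Preorder J]
    (𝒜 : TriangularInterlacedDitalgebra k T) (e : J → 𝒜.A) (h𝒜 : 𝒜.IsStrict e) :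
    (∃ Q : J → 𝒜.Mod, 𝒜.IsIndecEProjFamily e Q) ∧
    (∀ Q : J → 𝒜.Mod, 𝒜.IsIndecEProjFamily e Q →
      IsCompleteIndecProj 𝒜.Γ (fun i => 𝒜.induced (Q i))) ∧
    IsStrictHomologicalSystem k 𝒜.Γ (fun i => 𝒜.induced (𝒜.simple e i)) := by
  refine ⟨?_, fun Q hQ => TriangularInterlacedDitalgebra.isCompleteIndecProj_induced h𝒜 hQ,
    (TriangularInterlacedDitalgebra.isStrictHomologicalSystem_homΓ h𝒜).of_iso fun i =>
      have := h𝒜.finite_Abar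
      have := h𝒜.finite_simple i
      (TriangularInterlacedDitalgebra.inducedIso h𝒜 (𝒜.simple e i)).symm⟩
  obtain ⟨D⟩ := h𝒜.nonempty_projDecomposition
  exact ⟨D.Q, D.isIndecEProjFamily h𝒜⟩

end
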